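/- Let $n\ge 2$ and let $(M,g,J,\omega)$ be a closed almost Kähler manifold of real dimension $2n$: $\omega$ is a symplectic form, $J$ an almost complex structure with $\omega(JX,JY)=\omega(X,Y)$ and $\omega(v,Jv)>0$ for $v\neq0$, and $g(X,Y)=\omega(X,JY)$. Suppose that $J$ is not integrable, i.e. its Nijenhuis tensor does not vanish identically. Fix $k\in\{2,3,\dots,\infty\}$. Notation. For a real function $\phi$ of class $C^2$ put $(Jd\phi)(X)=d\phi(JX)$, $\omega(\phi)=\omega+d(Jd\phi)$, $H(\phi)=P_{1,1}\,\omega(\phi)$, $\tau(\phi)=P_{2,0}\,\omega(\phi)$ (the $(1,1)$- and $(2,0)$-parts), $h(\phi)(X,Y)=\frac12\big(H(\phi)(X,JY)+H(\phi)(Y,JX)\big)$, and define $F(\phi)$ and $F_1(\phi)$ by $F(\phi)\,\omega^n=\omega(\phi)^n$ and $F_1(\phi)\,\omega^n=n(n-1)\,\tau(\phi)\wedge\overline{\tau(\phi)}\wedge H(\phi)^{n-2}$. Let $A$ be the space of real $C^k$ functions $\phi$ on $M$ with $\int_M\phi\,\omega^n=0$, with the $C^k$ topology, and let $A_+\subset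 A$ be the set of those $\phi$ for which $\omega(\phi)$ tames $J$, i.e. $\omega(\phi)(v,Jv)>0$ for all $v\ne0$. For a function $\psi$ put $a_{\omega(\phi)}(\psi)=\sup\{s>0:\ h(\phi+s\psi)\text{ is positive definite on }M\}$. Data. Consider the following data: a function $\phi\in C^\infty(M;\mathbb R)$ with $h(\phi)$ positive definite on $M$; a point $p_0$ with an open neighbourhood $U_0$ on which $\tau(\phi)$ is nowhere zero; smooth vector fields $\epsilon_1,\dots,\epsilon_n$ on $U_0$ such that $\epsilon_1,J\epsilon_1,\dots,\epsilon_n,J\epsilon_n$ is a $g$-orthonormal frame, with $e_\alpha=(\epsilon_\alpha-\sqrt{-1}J\epsilon_\alpha)/\sqrt2$ and dual coframe $\theta^\alpha$; real numbers $\lambda_\alpha$ with $H(\phi)=\sqrt{-1}\sum_\alpha\lambda_\alpha\,\theta^\alpha\wedge\bar\theta^\alpha$ at $p_0$; a smooth coordinate system $\varphi^{-1}:U_0\to\mathbb C^n$ with $\varphi(0)=p_0$ and $\partial/\partial z_\alpha=e_\alpha$ at $p_0$, whose image contains the polydisk $\triangle=\{|z_i|\le1,\ 1\le i\le n\}$,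 such that for some constant $\delta>0$ one has $|\tau(\phi)(e_1,e_2)|\ge\delta$ on $\varphi(\triangle)$; and a $C^k$ function $\tilde\eta:\mathbb R\to\mathbb R$ with $\tilde\eta(r)=1$ for $r\le\frac12$ and $\tilde\eta(r)=0$ for $r\ge1$. For $R>2$ let $$\psi_R(z)=\Big(\sum_{i=1}^2\frac{\lambda_i}{2}|z_i|^2\,\tilde\eta(|R^2z_i|)\Big)\prod_{i=1}^n\tilde\eta(|Rz_i|),$$ regarded through $\varphi$ as a function on $U_0$ and extended by $0$ to $M$, let $\triangle_R=\{|z_i|\le 1/R,\ 1\le i\le n\}$, and let $\phi_R=\phi+a_{\omega(\phi)}(\psi_R)\,\psi_R$. Claim. Such data exist. For all such data and every $R_1>2$ there is $R_0\ge R_1$ such that $\phi_0=\phi_{R_0}$ satisfies: $0<a_{\omega(\phi)}(\psi_{R_0})\le1$; after addition of a constant, $\phi_0$ lies on the boundary of $A_+$ in $A$; $F_1(\phi_0)>0$ on $\varphi(\triangle_{R_0})$; and $F(\phi_0)>0$ everywhere on $M$. -/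

import Mathlib

open scoped Manifold ContDiff

namespace AlmostKahler

/-- The model space `ℝ^{2n}`. -/
abbrev Model (n : ℕ) : Type := EuclideanSpace ℝ (Fin (2 * n))

section Forms

variable {n : ℕ} {M : Type*} [TopologicalSpace M] [ChartedSpace (Model n) M]

/-- The tangent space `T_p M` of a manifold modelled on `ℝ^{2n}`. -/
abbrev Tan (n : ℕ) {M : Type*} [TopologicalSpace M] [ChartedSpace (Model n) M] (p : M) : Type :=
  TangentSpace 𝓘(ℝ, Model n) p

/-- Real differential `k`-forms (no regularity is imposed here). -/
abbrev DForm (n : ℕ) (M : Type*) [TopologicalSpace M] [ChartedSpace (Model n) M] (k : ℕ) : Type _ :=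
  (p : M) → Tan n p [⋀^Fin k]→L[ℝ] ℝ

/-- The coordinate expression of a form in a chart: its pull-back by the inverse of the chart. -/
noncomputable def DForm.inChart {k : ℕ} (β : DForm n M k) (e : OpenPartialHomeomorph M (Model n)) :
    Model n → Model n [⋀^Fin k]→L[ℝ] ℝ :=
  fun x => (β (e.symm x)).compContinuousLinearMap
    (mfderiv 𝓘(ℝ, Model n) 𝓘(ℝ, Model n) e.symm x)

/-- A smooth form: all its coordinate expressions are smooth. -/
def DForm.IsSmooth {k : ℕ} (β : DForm n M k) : Prop :=
  ∀ q : M, ContDiffOn ℝ ∞ (β.inChart (chartAt (Model n) q)) (chartAt (Model n) q).target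

/-- The exterior derivative on a manifold, computed at `p` in the chart at `p`. -/
noncomputable def DForm.d {k : ℕ} (β : DForm n M k) : DForm n M (k + 1) := fun p =>
  (extDeriv (β.inChart (chartAt (Model n) p)) (chartAt (Model n) p p)).compContinuousLinearMap
    (mfderiv 𝓘(ℝ, Model n) 𝓘(ℝ, Model n) (chartAt (Model n) p) p)

/-- A field of endomorphisms of the tangent bundle. -/
abbrev EndField (n : ℕ) (M : Type*) [TopologicalSpace M] [ChartedSpace (Model n) M] : Type _ :=
  (p : M) → Tan n p →L[ℝ] Tan n p

/-- The coordinate expression of a field of endomorphisms in a chart. -/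
noncomputable def EndField.inChart (J : EndField n M) (e : OpenPartialHomeomorph M (Model n)) :
    Model n → Model n →L[ℝ] Model n :=
  fun x => (mfderiv 𝓘(ℝ, Model n) 𝓘(ℝ, Model n) e (e.symm x)).comp
    ((J (e.symm x)).comp (mfderiv 𝓘(ℝ, Model n) 𝓘(ℝ, Model n) e.symm x))

/-- A smooth field of endomorphisms. -/
def EndField.IsSmooth (J : EndField n M) : Prop :=
  ∀ q : M, ContDiffOn ℝ ∞ (J.inChart (chartAt (Model n) q)) (chartAt (Model n) q).target

/-- The one-form `J dφ`, given by `(J dφ)(X) = dφ(J X)`. -/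
noncomputable def Jd (J : EndField n M) (φ : M → ℝ) : DForm n M 1 := fun p =>
  ContinuousAlternatingMap.ofSubsingleton ℝ (Tan n p) ℝ (0 : Fin 1)
    ((mfderiv 𝓘(ℝ, Model n) 𝓘(ℝ, ℝ) φ p).comp (J p))

/-- `Ω(φ) = Ω + d(J dφ)`. -/
noncomputable def pot (J : EndField n M) (Ω : DForm n M 2) (φ : M → ℝ) : DForm n M 2 :=
  fun p => Ω p + (Jd J φ).d p

/-- A two-form tames `J`: `α(v, J v) > 0` for every nonzero tangent vector `v`. -/
def Tames (J : EndField n M) (α : DForm n M 2) : Prop :=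
  ∀ (p : M) (v : Tan n p), v ≠ 0 → 0 < α p ![v, J p v]

/-- The `(1,1)`-part of a real two-form; it is again real. Its complex bilinear extension is the
restriction of `α` to `T^{1,0} × T^{0,1}` and `T^{0,1} × T^{1,0}`, and vanishes on
`T^{1,0} × T^{1,0}` and on `T^{0,1} × T^{0,1}`. -/
noncomputable def P11 (J : EndField n M) (α : DForm n M 2) (p : M) (X Y : Tan n p) : ℝ :=
  (α p ![X, Y] + α p ![J p X, J p Y]) / 2

/-- The `(2,0)`-part of a real two-form, as a complex-valued real bilinear form on `T_p M`. Its
complex bilinear extension is the restriction of `α` to `T^{1,0} × T^{1,0}` (where `J = i`), and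
vanishes as soon as one argument is in `T^{0,1}`. -/
noncomputable def P20 (J : EndField n M) (α : DForm n M 2) (p : M) (X Y : Tan n p) : ℂ :=
  (((α p ![X, Y] - α p ![J p X, J p Y] : ℝ) : ℂ)
    - Complex.I * ((α p ![J p X, Y] + α p ![X, J p Y] : ℝ) : ℂ)) / 4

/-- `H(φ) = P_{1,1}(Ω(φ))`. -/
noncomputable def H (J : EndField n M) (Ω : DForm n M 2) (φ : M → ℝ) (p : M)
    (X Y : Tan n p) : ℝ :=
  P11 J (pot J Ω φ) p X Y

/-- `τ(φ) = P_{2,0}(Ω(φ))`. -/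
noncomputable def tau (J : EndField n M) (Ω : DForm n M 2) (φ : M → ℝ) (p : M)
    (X Y : Tan n p) : ℂ :=
  P20 J (pot J Ω φ) p X Y

/-- `h(φ)(X, Y) = (H(φ)(X, J Y) + H(φ)(Y, J X)) / 2`. -/
noncomputable def h (J : EndField n M) (Ω : DForm n M 2) (φ : M → ℝ) (p : M)
    (X Y : Tan n p) : ℝ :=
  (H J Ω φ p X (J p Y) + H J Ω φ p Y (J p X)) / 2

/-- `h(φ)` is positive definite at every point of `M`. -/
def HPos (J : EndField n M) (Ω : DForm n M 2) (φ : M → ℝ) : Prop :=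
  ∀ (p : M) (v : Tan n p), v ≠ 0 → 0 < h J Ω φ p v v

/-- The positivity amplitude `a_Ω(φ) = sup {s > 0 : h(s φ) is positive definite on M}`. -/
noncomputable def amplitude (J : EndField n M) (Ω : DForm n M 2) (φ : M → ℝ) : ℝ :=
  sSup {s : ℝ | 0 < s ∧ HPos J Ω (fun p => s * φ p)}

/-- The value `(α₁ ∧ ⋯ ∧ αₙ)(v₁, …, v₂ₙ)` of the wedge product of `n` two-forms, with the
convention `(θ ∧ θ')(X, Y) = θ(X) θ'(Y) - θ(Y) θ'(X)` for one-forms. -/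
def wedge {𝕂 V : Type*} [Field 𝕂] (α : Fin n → V → V → 𝕂) (v : Fin (2 * n) → V) : 𝕂 :=
  (∑ σ : Equiv.Perm (Fin (2 * n)), ((Equiv.Perm.sign σ : ℤ) : 𝕂) *
    ∏ i : Fin n, α i (v (σ ⟨2 * i, by omega⟩)) (v (σ ⟨2 * i + 1, by omega⟩))) / 2 ^ n

/-- The standard basis of `T_p M = ℝ^{2n}`. -/
noncomputable def stdFrame (p : M) : Fin (2 * n) → Tan n p :=
  fun i => EuclideanSpace.single i (1 : ℝ)

/-- `F(φ)`, defined by `F(φ) Ωⁿ = Ω(φ)ⁿ`. -/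
noncomputable def F (J : EndField n M) (Ω : DForm n M 2) (φ : M → ℝ) (p : M) : ℝ :=
  wedge (fun _ : Fin n => fun X Y : Tan n p => pot J Ω φ p ![X, Y]) (stdFrame p) /
    wedge (fun _ : Fin n => fun X Y : Tan n p => Ω p ![X, Y]) (stdFrame p)

/-- `F_j(φ)`, defined by
`F_j(φ) Ωⁿ = n! / (j!² (n - 2j)!) (τ(φ) ∧ conj τ(φ))^j ∧ H(φ)^{n - 2j}` for `2j ≤ n`
(the right-hand side is a real form). -/
noncomputable def Fj (J : EndField n M) (Ω : DForm n M 2) (j : ℕ) (φ : M → ℝ) (p : M) : ℝ :=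
  ((n.factorial : ℂ) / ((j.factorial : ℂ) ^ 2 * ((n - 2 * j).factorial : ℂ)) *
    wedge (fun i : Fin n => fun X Y : Tan n p =>
      if (i : ℕ) < 2 * j then
        (if (i : ℕ) % 2 = 0 then tau J Ω φ p X Y else (starRingEnd ℂ) (tau J Ω φ p X Y))
      else (H J Ω φ p X Y : ℂ)) (stdFrame p) /
    wedge (fun _ : Fin n => fun X Y : Tan n p => (Ω p ![X, Y] : ℂ)) (stdFrame p)).re

/-- Complex bilinear extension of a real bilinear, complex-valued form to `T_p M ⊗ ℂ`; a pair
`(u, v)` stands for the complex tangent vector `u + i v`. -/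
noncomputable def cext {V : Type*} (B : V → V → ℂ) (X Y : V × V) : ℂ :=
  B X.1 Y.1 - B X.2 Y.2 + Complex.I * (B X.2 Y.1 + B X.1 Y.2)

end Forms

/-- An almost Kähler structure on `M`: an almost complex structure `J` and a symplectic form `Ω`
compatible with it. The Riemannian metric is `g(X, Y) = Ω(X, J Y)`. -/
structure AKStructure (n : ℕ) (M : Type*) [TopologicalSpace M] [ChartedSpace (Model n) M] where
  /-- the almost complex structure -/
  J : EndField n M
  /-- the symplectic form -/
  Ω : DForm n M 2
  smooth_J : J.IsSmooth
  sq_J : ∀ (p : M) (v : Tan n p), J p (J p v) = -v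
  smooth_Ω : Ω.IsSmooth
  closed_Ω : ∀ p : M, Ω.d p = 0
  invariant : ∀ (p : M) (u v : Tan n p), Ω p ![J p u, J p v] = Ω p ![u, v]
  tames : Tames J Ω

/-- `X` is a vector field which is smooth on the set `U`. -/
def IsSmoothField {n : ℕ} {M : Type*} [TopologicalSpace M] [ChartedSpace (Model n) M]
    [IsManifold 𝓘(ℝ, Model n) ∞ M] (X : (p : M) → Tan n p) (U : Set M) : Prop :=
  ContMDiffOn 𝓘(ℝ, Model n) 𝓘(ℝ, Model n).tangent ∞
    (fun p => (⟨p, X p⟩ : TangentBundle 𝓘(ℝ, Model n) M)) U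

namespace AKStructure

section Basic

variable {n : ℕ} {M : Type*} [TopologicalSpace M] [ChartedSpace (Model n) M]

/-- The metric `g(X, Y) = Ω(X, J Y)`. -/
noncomputable def g (K : AKStructure n M) (p : M) (X Y : Tan n p) : ℝ := K.Ω p ![X, K.J p Y]

/-- The Nijenhuis tensor `N(X, Y) = [JX, JY] - J[X, JY] - J[JX, Y] - [X, Y]`. -/
noncomputable def nijenhuis (K : AKStructure n M) (X Y : (p : M) → Tan n p) (p : M) : Tan n p :=
  VectorField.mlieBracket 𝓘(ℝ, Model n) (fun q => K.J q (X q)) (fun q => K.J q (Y q)) p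
    - K.J p (VectorField.mlieBracket 𝓘(ℝ, Model n) X (fun q => K.J q (Y q)) p)
    - K.J p (VectorField.mlieBracket 𝓘(ℝ, Model n) (fun q => K.J q (X q)) Y p)
    - VectorField.mlieBracket 𝓘(ℝ, Model n) X Y p

end Basic

variable {n : ℕ} {M : Type*} [TopologicalSpace M] [ChartedSpace (Model n) M]
  [IsManifold 𝓘(ℝ, Model n) ∞ M]

/-- `J` is integrable: its Nijenhuis tensor vanishes identically. -/
def IsIntegrable (K : AKStructure n M) : Prop :=
  ∀ X Y : (p : M) → Tan n p, IsSmoothField X Set.univ → IsSmoothField Y Set.univ →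
    ∀ p : M, K.nijenhuis X Y p = 0

end AKStructure

section FunctionSpaces

variable {n : ℕ} {M : Type*} [TopologicalSpace M] [ChartedSpace (Model n) M]

/-- The `C^k` topology on `C^k(M; ℝ)`, `0 ≤ k ≤ ∞`: uniform convergence, on compact subsets of
coordinate patches, of all partial derivatives of order at most `k`. -/
noncomputable instance ckTopology (k : ℕ∞) : TopologicalSpace C^k⟮𝓘(ℝ, Model n), M; 𝓘(ℝ, ℝ), ℝ⟯ :=
  ⨅ (e : atlas (Model n) M) (j : {j : ℕ // (j : ℕ∞) ≤ k}),
    TopologicalSpace.induced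
      (fun f => UniformOnFun.ofFun {C : Set (Model n) | IsCompact C ∧ C ⊆ e.1.target}
        (iteratedFDeriv ℝ j.1 (fun x => f (e.1.symm x))))
      inferInstance

variable [IsManifold 𝓘(ℝ, Model n) ∞ M] [CompactSpace M] [T2Space M]

theorem exists_partition (n : ℕ) (M : Type*) [TopologicalSpace M] [ChartedSpace (Model n) M]
    [IsManifold 𝓘(ℝ, Model n) ∞ M] [CompactSpace M] [T2Space M] :
    ∃ ρ : SmoothPartitionOfUnity M 𝓘(ℝ, Model n) M Set.univ,
      ρ.IsSubordinate fun q => (chartAt (Model n) q).source :=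
  SmoothPartitionOfUnity.exists_isSubordinate 𝓘(ℝ, Model n) isClosed_univ _
    (fun q => (chartAt (Model n) q).open_source)
    (fun q _ => Set.mem_iUnion.2 ⟨q, mem_chart_source _ q⟩)

/-- A smooth partition of unity subordinate to the coordinate patches. -/
noncomputable def partition (n : ℕ) (M : Type*) [TopologicalSpace M] [ChartedSpace (Model n) M]
    [IsManifold 𝓘(ℝ, Model n) ∞ M] [CompactSpace M] [T2Space M] :
    SmoothPartitionOfUnity M 𝓘(ℝ, Model n) M Set.univ :=
  Classical.choose (exists_partition n M)

/-- The integral `∫_M f Ωⁿ`, for the orientation of `M` given by `Ωⁿ`, computed with a partition of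
unity. In a chart with the orientation of `M` or the opposite one, `Ωⁿ` is the density
`|Ωⁿ(∂₁, …, ∂₂ₙ)| dx`. -/
noncomputable def integral (K : AKStructure n M) (f : M → ℝ) : ℝ :=
  ∑ᶠ q : M, ∫ x in (chartAt (Model n) q).target,
    partition n M q ((chartAt (Model n) q).symm x) * f ((chartAt (Model n) q).symm x) *
      |wedge (fun _ : Fin n => fun X Y : Model n => K.Ω.inChart (chartAt (Model n) q) x ![X, Y])
        (fun i => EuclideanSpace.single i (1 : ℝ))|

/-- The space `A = {φ : ∫_M φ Ωⁿ = 0}` of functions of class `C^k`. -/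
def A (K : AKStructure n M) (k : ℕ∞) : Set C^k⟮𝓘(ℝ, Model n), M; 𝓘(ℝ, ℝ), ℝ⟯ :=
  {φ | integral K φ = 0}

/-- The set `A₊` of the `φ` in `A` such that `Ω(φ)` tames `J`, as a subset of the space `A` with
its `C^k` topology. -/
def APlus (K : AKStructure n M) (k : ℕ∞) : Set (A K k) :=
  {φ | Tames K.J (pot K.J K.Ω φ.1)}

end FunctionSpaces

section Construction

variable {n : ℕ} {M : Type*} [TopologicalSpace M] [ChartedSpace (Model n) M]

/-- The closed polydisk `{z ∈ ℂⁿ : |z_i| ≤ r}`. -/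
def polydisk (n : ℕ) (r : ℝ) : Set (Fin n → ℂ) := {z | ∀ i, ‖z i‖ ≤ r}

/-- The complex tangent vector `e = (ε - i J ε) / √2`. -/
noncomputable def eVec (K : AKStructure n M) {p : M} (ε : Tan n p) : Tan n p × Tan n p :=
  ((Real.sqrt 2)⁻¹ • ε, -((Real.sqrt 2)⁻¹ • K.J p ε))

/-- The complex conjugate of `e = (ε - i J ε) / √2`. -/
noncomputable def eBar (K : AKStructure n M) {p : M} (ε : Tan n p) : Tan n p × Tan n p :=
  ((Real.sqrt 2)⁻¹ • ε, (Real.sqrt 2)⁻¹ • K.J p ε)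

/-- The data of the construction: a smooth function `φ` with `h(φ)` positive definite on `M`;
a coordinate system `χ⁻¹ : U₀ → ℂⁿ` (`χ.target` is `U₀`, and the centre is `p₀ = χ 0`) whose image
contains the closed unit polydisk; a unitary frame `e_α = (ε_α - i J ε_α) / √2` on `U₀` which at
`p₀` is `∂/∂z_α` and diagonalizes `H(φ)` with eigenvalues `lam α`; `τ(φ)` does not vanish on `U₀`
and its `(1,2)`-component is bounded away from `0` on the polydisk; a cut-off function `η` of
class `C^k`. -/
structure Data (K : AKStructure n M) [IsManifold 𝓘(ℝ, Model n) ∞ M] (hn : 2 ≤ n) (k : ℕ∞) where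
  φ : M → ℝ
  smooth_φ : ContMDiff 𝓘(ℝ, Model n) 𝓘(ℝ, ℝ) ∞ φ
  hpos : HPos K.J K.Ω φ
  χ : OpenPartialHomeomorph (Fin n → ℂ) M
  smooth_χ : ContMDiffOn 𝓘(ℝ, Fin n → ℂ) 𝓘(ℝ, Model n) ∞ χ χ.source
  smooth_χ_symm : ContMDiffOn 𝓘(ℝ, Model n) 𝓘(ℝ, Fin n → ℂ) ∞ χ.symm χ.target
  polydisk_subset : polydisk n 1 ⊆ χ.source
  tau_ne : ∀ p ∈ χ.target, ∃ X Y : Tan n p, tau K.J K.Ω φ p X Y ≠ 0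
  ε : Fin n → (p : M) → Tan n p
  smooth_ε : ∀ α, IsSmoothField (ε α) χ.target
  orthonormal : ∀ p ∈ χ.target, ∀ α β,
    K.g p (ε α p) (ε β p) = (if α = β then 1 else 0) ∧ K.g p (ε α p) (K.J p (ε β p)) = 0
  /-- `∂/∂z_α = (∂/∂x_α - i ∂/∂y_α) / 2` equals `e_α` at `p₀` -/
  coord_re : ∀ α, mfderiv 𝓘(ℝ, Fin n → ℂ) 𝓘(ℝ, Model n) χ 0 (Pi.single α (1 : ℂ)) =
    Real.sqrt 2 • ε α (χ 0)
  coord_im : ∀ α, mfderiv 𝓘(ℝ, Fin n → ℂ) 𝓘(ℝ, Model n) χ 0 (Pi.single α Complex.I) =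
    Real.sqrt 2 • K.J (χ 0) (ε α (χ 0))
  lam : Fin n → ℝ
  /-- `H(φ) = i ∑ lam α θ^α ∧ conj θ^α` at `p₀` -/
  diag : ∀ α β, cext (fun X Y => (H K.J K.Ω φ (χ 0) X Y : ℂ))
    (eVec K (ε α (χ 0))) (eBar K (ε β (χ 0))) = if α = β then Complex.I * (lam α : ℂ) else 0
  tau_12 : ∃ ε₁ : ℝ, 0 < ε₁ ∧ ∀ z ∈ polydisk n 1,
    ε₁ ≤ ‖cext (tau K.J K.Ω φ (χ z)) (eVec K (ε ⟨0, by omega⟩ (χ z)))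
      (eVec K (ε ⟨1, by omega⟩ (χ z)))‖
  η : ℝ → ℝ
  contDiff_η : ContDiff ℝ k η
  η_one : ∀ r ≤ 1 / 2, η r = 1
  η_zero : ∀ r, 1 ≤ r → η r = 0

namespace Data

variable [IsManifold 𝓘(ℝ, Model n) ∞ M] {K : AKStructure n M} {hn : 2 ≤ n} {k : ℕ∞}

/-- `Φ_R(z) = ∑_{i = 1, 2} (lam i / 2) |z_i|² η(|R² z_i|)`. -/
noncomputable def Phi (D : Data K hn k) (R : ℝ) (z : Fin n → ℂ) : ℝ :=
  D.lam ⟨0, by omega⟩ / 2 * ‖z ⟨0, by omega⟩‖ ^ 2 * D.η (R ^ 2 * ‖z ⟨0, by omega⟩‖) +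
  D.lam ⟨1, by omega⟩ / 2 * ‖z ⟨1, by omega⟩‖ ^ 2 * D.η (R ^ 2 * ‖z ⟨1, by omega⟩‖)

open Classical in
/-- The function `ψ_R = Φ_R(z) η(|R z₁|) ⋯ η(|R zₙ|)`, transported to `U₀` by `χ` and extended by
zero to `M`. -/
noncomputable def psi (D : Data K hn k) (R : ℝ) (p : M) : ℝ :=
  if p ∈ D.χ.target then
    D.Phi R (D.χ.symm p) * ∏ i, D.η (R * ‖D.χ.symm p i‖)
  else 0

/-- The positivity amplitude `a = a_{Ω(φ)}(ψ_R)`. -/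
noncomputable def amp (D : Data K hn k) (R : ℝ) : ℝ :=
  amplitude K.J (pot K.J K.Ω D.φ) (D.psi R)

/-- `φ_R = φ + a_{Ω(φ)}(ψ_R) ψ_R`. -/
noncomputable def phiR (D : Data K hn k) (R : ℝ) (p : M) : ℝ :=
  D.φ p + D.amp R * D.psi R p

end Data

end Construction

end AlmostKahler

open scoped Topology
set_option linter.unusedSectionVars false

/-! Work in the coordinates of the data. At the centre J is multiplication by i, the symplectic form
is ∑ 2 dx_a ∧ dy_a, and H(φ) is ∑ 2 λ_a dx_a ∧ dy_a with all λ_a > 0. The construction is a scaling: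
ψ_R(z) = R⁻⁴ P(R² z) C(R z), where P is a sum of a function of z₁ and a function of z₂, and both P
and the cut-off C are independent of R. Hence, uniformly on the shrinking polydisk, the Hessian of
ψ_R is C(R z) D²P(R² z) + O(1/R), and its gradient is O(R⁻²). Since J → i there, d(J dψ_R) is, up to
o(1), a bounded form c₁ dx₁ ∧ dy₁ + c₂ dx₂ ∧ dy₂. It is of type (1,1) and diagonal, so in the limit
it changes neither τ(φ) nor the λ_a with a > 2.

Amplitude (`amplitude_spec`, `Data.not_tames_one`). The number Ω(φ + sψ)(v, Jv) is affine in s and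
positive at s = 0, so the good s ≥ 0 form an interval, which is open because M is compact. At the
centre ψ_R = ∑ (λ_i/2)|z_i|², whose d(J d·) is -2λ_i dx_i ∧ dy_i, so positivity fails at s = 1. Thus
0 < a ≤ 1, and at s = a the form is semidefinite but does not tame J.

Positivity on the polydisk (`Data.exists_limit_form`, `Data.eventually_pos`). Neither a(R), nor C(R
z), nor D²P(R² z) need converge, but all are bounded, so they converge along every ultrafilter finer
than "R → ∞, z in the polydisk of radius 1/R". The limit of Ω(φ_R) is a two-form B on ℂⁿ whose
(1,1)-part is ∑ t_a dx_a ∧ dy_a, with t_a ≥ 0 and t_a > 0 for a > 2, and whose (2,0)-part is that of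
Ω(φ) at p₀, nonzero on the first two directions. For such a B both quantities are positive. A kernel
vector of B lies in the first two directions and is annihilated by τ there, so it vanishes; the
segment from B to the standard form stays nondegenerate, whence Bⁿ > 0 (`wedge_pos_of_tau_ne`).
Expanding τ ∧ conj τ ∧ Hⁿ⁻² in dz, dz̄ gives nonnegative terms, one of them a positive multiple of
|τ₁₂|² ∏_{a>2} t_a (`re_wedge_tau_pos`). Positivity along every such ultrafilter is positivity for
all large R. Off the polydisk ψ_R vanishes, so Ω(φ_R) = Ω(φ) tames J and F > 0.

Boundary (`exists_mem_frontier`). Subtracting means turns s ↦ φ + sψ_R into a continuous line in A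
that lies in A₊ for 0 ≤ s < a and leaves it at s = a.

Existence (`nonempty_data`). In a chart, the J-anti-invariant part of d(J df) for f with constant
differential is df applied to J N, with N the Nijenhuis tensor. So where N ≠ 0 a small multiple of a
suitable f has τ ≠ 0 and still tames. At that point the metric and h(φ) are diagonalized
simultaneously over ℂ, the directions are ordered so that τ₁₂ ≠ 0, the frame is extended by
Gram–Schmidt, and a small ball is parametrized by ℂⁿ with the prescribed derivative at the centre.
-/

namespace AlmostKahler

/-! ### Wedge products of two-forms as determinants -/

section WedgeAlgebra

variable {n : ℕ} {𝕂 V : Type*} [Field 𝕂]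

/-- The indices of `2n` vectors, grouped in pairs. -/
def pairEquiv (n : ℕ) : Fin n × Fin 2 ≃ Fin (2 * n) where
  toFun x := ⟨2 * x.1 + x.2, by omega⟩
  invFun j := (⟨j / 2, by omega⟩, ⟨j % 2, by omega⟩)
  left_inv := by
    rintro ⟨i, s⟩
    ext <;> simp <;> omega
  right_inv := by
    intro j
    ext
    simp
    omega

/-- With arguments indexed by (factor, slot), exchanging the slots of each factor is a
`prodCongrRight` and permuting whole factors is a `prodCongrLeft`, whose signs are known. -/
theorem wedge_eq_sum_pairs (α : Fin n → V → V → 𝕂) (v : Fin (2 * n) → V) :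
    wedge α v = (∑ σ : Equiv.Perm (Fin n × Fin 2), ((Equiv.Perm.sign σ : ℤ) : 𝕂) *
      ∏ i : Fin n, α i (v (pairEquiv n (σ (i, 0)))) (v (pairEquiv n (σ (i, 1))))) / 2 ^ n := by
  unfold wedge
  congr 1
  refine (Fintype.sum_equiv (pairEquiv n).permCongr _ _ fun σ => ?_).symm
  rw [Equiv.Perm.sign_permCongr]
  refine congrArg _ (Finset.prod_congr rfl fun i _ => ?_)
  have h0 : (pairEquiv n).symm ⟨2 * i, by omega⟩ = (i, 0) := by
    rw [Equiv.symm_apply_eq]; ext; simp [pairEquiv]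
  have h1 : (pairEquiv n).symm ⟨2 * i + 1, by omega⟩ = (i, 1) := by
    rw [Equiv.symm_apply_eq]; ext; simp [pairEquiv]
  simp only [Equiv.permCongr_apply, h0, h1]

/-- The wedge product of the two-forms `X i 0 ∧ X i 1` is a determinant. -/
theorem wedge_decomposable [CharZero 𝕂] (X : Fin n → Fin 2 → V → 𝕂) (v : Fin (2 * n) → V) :
    wedge (fun i a b => X i 0 a * X i 1 b - X i 0 b * X i 1 a) v =
      (Matrix.of fun j k : Fin n × Fin 2 => X j.1 j.2 (v (pairEquiv n k))).det := by
  rw [wedge_eq_sum_pairs]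
  set w : Fin n × Fin 2 → V := fun k => v (pairEquiv n k) with hw
  have hprod : ∀ σ : Equiv.Perm (Fin n × Fin 2),
      ((Equiv.Perm.sign σ : ℤ) : 𝕂) * ∏ i : Fin n,
        (X i 0 (w (σ (i, 0))) * X i 1 (w (σ (i, 1))) - X i 0 (w (σ (i, 1))) * X i 1 (w (σ (i, 0))))
      = ∑ t : Fin n → Equiv.Perm (Fin 2),
        ((Equiv.Perm.sign (σ * Equiv.prodCongrRight t) : ℤ) : 𝕂) *
          ∏ j : Fin n × Fin 2, X j.1 j.2 (w ((σ * Equiv.prodCongrRight t) j)) := by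
    intro σ
    have : ∀ i : Fin n, (X i 0 (w (σ (i, 0))) * X i 1 (w (σ (i, 1)))
        - X i 0 (w (σ (i, 1))) * X i 1 (w (σ (i, 0)))) =
        ∑ t : Equiv.Perm (Fin 2), ((Equiv.Perm.sign t : ℤ) : 𝕂) *
          ∏ s : Fin 2, X i s (w (σ (i, t s))) := by
      intro i
      have := Matrix.det_fin_two (Matrix.of fun a s : Fin 2 => X i s (w (σ (i, a))))
      rw [Matrix.det_apply'] at this
      simp only [Matrix.of_apply] at this
      rw [this]
      ring
    simp only [this]
    rw [Finset.prod_univ_sum, Finset.mul_sum, Fintype.piFinset_univ]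
    refine Finset.sum_congr rfl fun t _ => ?_
    rw [Equiv.Perm.sign_mul, Equiv.Perm.sign_prodCongrRight, Finset.prod_mul_distrib,
      Fintype.prod_prod_type]
    simp only [Equiv.Perm.coe_mul, Function.comp_apply, Equiv.prodCongrRight_apply]
    push_cast
    ring
  rw [Finset.sum_congr rfl fun σ _ => hprod σ, Finset.sum_comm]
  -- For a fixed choice t of slot exchanges, σ ↦ σ t reindexes the sum into one determinant; the 2ⁿ
  -- choices of t cancel the denominator.
  have hinner : ∀ t : Fin n → Equiv.Perm (Fin 2),
      (∑ σ : Equiv.Perm (Fin n × Fin 2),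
        ((Equiv.Perm.sign (σ * Equiv.prodCongrRight t) : ℤ) : 𝕂) *
          ∏ j : Fin n × Fin 2, X j.1 j.2 (w ((σ * Equiv.prodCongrRight t) j))) =
      (Matrix.of fun j k : Fin n × Fin 2 => X j.1 j.2 (w k)).det := by
    intro t
    rw [← Matrix.det_transpose, Matrix.det_apply']
    exact Fintype.sum_equiv (Equiv.mulRight (Equiv.prodCongrRight t)) _ _ fun σ => rfl
  rw [Finset.sum_congr rfl fun t _ => hinner t, Finset.sum_const, Finset.card_univ,
    Fintype.card_fun, Fintype.card_perm]
  simp [hw]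

/-- The wedge product is multilinear in the two-forms. -/
theorem wedge_sum {κ : Type*} [Fintype κ] [DecidableEq κ] (c : Fin n → κ → 𝕂)
    (β : Fin n → κ → V → V → 𝕂) (v : Fin (2 * n) → V) :
    wedge (fun i a b => ∑ k, c i k * β i k a b) v =
      ∑ f : Fin n → κ, (∏ i, c i (f i)) * wedge (fun i => β i (f i)) v := by
  unfold wedge
  simp only [Finset.prod_univ_sum, Fintype.piFinset_univ, Finset.prod_mul_distrib, Finset.mul_sum]
  rw [Finset.sum_comm, Finset.sum_div]
  refine Finset.sum_congr rfl fun f _ => ?_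
  rw [mul_div_assoc', Finset.mul_sum]
  congr 1
  exact Finset.sum_congr rfl fun σ _ => by ring

theorem wedge_sum_decomposable [CharZero 𝕂] {κ : Type*} [Fintype κ] [DecidableEq κ]
    (c : Fin n → κ → 𝕂) (X : Fin n → κ → Fin 2 → V → 𝕂) (v : Fin (2 * n) → V) :
    wedge (fun i a b => ∑ k, c i k * (X i k 0 a * X i k 1 b - X i k 0 b * X i k 1 a)) v =
      ∑ f : Fin n → κ, (∏ i, c i (f i)) *
        (Matrix.of fun j k : Fin n × Fin 2 => X j.1 (f j.1) j.2 (v (pairEquiv n k))).det := by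
  rw [wedge_sum c (fun i k a b => X i k 0 a * X i k 1 b - X i k 0 b * X i k 1 a)]
  exact Finset.sum_congr rfl fun f _ =>
    congrArg _ (wedge_decomposable (fun i => X i (f i)) v)

/-- The permutation acts once on each of the two slots, so its sign is a square: two-forms commute.
-/
theorem sign_prodCongrLeft_const (π : Equiv.Perm (Fin n)) :
    Equiv.Perm.sign (Equiv.prodCongrLeft fun _ : Fin 2 => π) = 1 := by
  rw [Equiv.Perm.sign_prodCongrLeft]
  simp

/-- The top power of `∑ t m • X m 0 ∧ X m 1`. -/
theorem wedge_symplectic [CharZero 𝕂] (t : Fin n → 𝕂) (X : Fin n → Fin 2 → V → 𝕂)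
    (v : Fin (2 * n) → V) :
    wedge (fun _ a b => ∑ m, t m * (X m 0 a * X m 1 b - X m 0 b * X m 1 a)) v =
      (n.factorial : 𝕂) * (∏ m, t m) *
        (Matrix.of fun j k : Fin n × Fin 2 => X j.1 j.2 (v (pairEquiv n k))).det := by
  rw [wedge_sum_decomposable (fun _ => t) (fun _ => X)]
  -- A one-form pair used twice gives a repeated row, so only the n! permutations survive.
  have hinj : ∀ f : Fin n → Fin n, f ∉ Finset.univ.image (fun π : Equiv.Perm (Fin n) => ⇑π) →
      (∏ i, t (f i)) *
        (Matrix.of fun j k : Fin n × Fin 2 => X (f j.1) j.2 (v (pairEquiv n k))).det = 0 := by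
    intro f hf
    have hni : ¬ Function.Injective f := fun hi => hf (by
      simp only [Finset.mem_image, Finset.mem_univ, true_and]
      exact ⟨Equiv.ofBijective f (Finite.injective_iff_bijective.1 hi), rfl⟩)
    simp only [Function.Injective, not_forall] at hni
    obtain ⟨a, b, hab, hne⟩ := hni
    rw [Matrix.det_zero_of_row_eq (i := (a, 0)) (j := (b, 0)) (by simp [hne]), mul_zero]
    ext k
    simp [hab]
  rw [← Finset.sum_subset (Finset.subset_univ _) (fun f _ hf => hinj f hf),
    Finset.sum_image (fun a _ b _ h => DFunLike.coe_injective h)]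
  have hperm : ∀ π : Equiv.Perm (Fin n), (∏ i, t (π i)) *
      (Matrix.of fun j k : Fin n × Fin 2 => X (π j.1) j.2 (v (pairEquiv n k))).det =
      (∏ m, t m) * (Matrix.of fun j k : Fin n × Fin 2 => X j.1 j.2 (v (pairEquiv n k))).det := by
    intro π
    have := Matrix.det_permute (Equiv.prodCongrLeft fun _ : Fin 2 => π)
      (Matrix.of fun j k : Fin n × Fin 2 => X j.1 j.2 (v (pairEquiv n k)))
    rw [sign_prodCongrLeft_const] at this
    rw [Equiv.prod_comp π t]
    simp only [Units.val_one, Int.cast_one, one_mul] at this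
    rw [← this]
    rfl
  rw [Finset.sum_congr rfl fun π _ => hperm π, Finset.sum_const, Finset.card_univ,
    Fintype.card_perm, Fintype.card_fin, nsmul_eq_mul, mul_assoc]

/-- An alternating bilinear form of rank at most `2r` is a sum of `r` decomposable forms. -/
theorem exists_decomposition [AddCommGroup V] [Module 𝕂 V] [FiniteDimensional 𝕂 V] (r : ℕ) :
    ∀ α : V →ₗ[𝕂] V →ₗ[𝕂] 𝕂, (∀ u, α u u = 0) →
      Module.finrank 𝕂 V ≤ Module.finrank 𝕂 (LinearMap.ker α) + 2 * r →
      ∃ X : Fin r → Fin 2 → V →ₗ[𝕂] 𝕂,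
        ∀ u v, α u v = ∑ i, (X i 0 u * X i 1 v - X i 0 v * X i 1 u) := by
  induction r with
  | zero =>
    intro α _ hr
    refine ⟨fun i => i.elim0, fun u v => ?_⟩
    have hker : LinearMap.ker α = ⊤ :=
      Submodule.eq_top_of_finrank_eq (le_antisymm (Submodule.finrank_le _) (by simpa using hr))
    rw [LinearMap.ker_eq_top.1 hker]
    simp
  | succ r ih =>
    intro α halt hr
    by_cases h0 : α = 0
    · exact ⟨fun _ _ => 0, fun u v => by simp [h0]⟩
    have hskew : ∀ u v, α u v = - α v u := fun u v => by
      have := halt (u + v)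
      simp only [map_add, LinearMap.add_apply, halt, zero_add, add_zero] at this
      exact eq_neg_of_add_eq_zero_right (by rw [← this, add_comm])
    obtain ⟨u, v₀, huv₀⟩ : ∃ u v, α u v ≠ 0 := by
      by_contra! h
      exact h0 (LinearMap.ext₂ h)
    set v := (α u v₀)⁻¹ • v₀ with hv
    have huv : α u v = 1 := by simp [hv, huv₀]
    have hvu : α v u = -1 := by rw [hskew, huv]
    -- Removing the hyperbolic plane spanned by u and v: subtracting (α u) ∧ (α v) puts both u and v
    -- into the kernel, so the rank drops by two.
    set β : V →ₗ[𝕂] V →ₗ[𝕂] 𝕂 :=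
      α - ((LinearMap.lsmul 𝕂 (V →ₗ[𝕂] 𝕂)).flip (α v) ∘ₗ α u
        - (LinearMap.lsmul 𝕂 (V →ₗ[𝕂] 𝕂)).flip (α u) ∘ₗ α v) with hβ
    have hβa : ∀ x y, β x y = α x y - (α u x * α v y - α u y * α v x) := fun x y => by
      simp [hβ, mul_comm]
    have h1 : LinearMap.ker α < LinearMap.ker α ⊔ Submodule.span 𝕂 {u} := by
      refine lt_of_le_of_ne le_sup_left fun h => ?_
      have hu : u ∈ LinearMap.ker α := by
        rw [h]; exact Submodule.mem_sup_right (Submodule.mem_span_singleton_self u)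
      rw [LinearMap.mem_ker] at hu
      simp [hu] at huv
    have hker : ∀ x ∈ LinearMap.ker α, ∀ y, α x y = 0 ∧ α y x = 0 := fun x hx y => by
      rw [LinearMap.mem_ker] at hx
      have : α x y = 0 := by simp [hx]
      exact ⟨this, by rw [hskew, this, neg_zero]⟩
    -- The vector v is new: α u vanishes on ker α and on u, but takes the value 1 at v.
    have h2 : LinearMap.ker α ⊔ Submodule.span 𝕂 {u} < LinearMap.ker β := by
      refine lt_of_le_of_ne (sup_le (fun x hx => ?_) ?_) fun h => ?_
      · rw [LinearMap.mem_ker]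
        ext y
        simp [hβa, hker x hx]
      · rw [Submodule.span_singleton_le_iff_mem, LinearMap.mem_ker]
        ext y
        simp [hβa, halt, hvu]
      · have hvm : v ∈ LinearMap.ker α ⊔ Submodule.span 𝕂 {u} := by
          rw [h, LinearMap.mem_ker]
          ext y
          simp [hβa, halt, huv]
        obtain ⟨x, hx, y, hy, hxy⟩ := Submodule.mem_sup.1 hvm
        obtain ⟨c, rfl⟩ := Submodule.mem_span_singleton.1 hy
        rw [← hxy] at huv
        simp [halt, (hker x hx u).2] at huv
    obtain ⟨X, hX⟩ := ih β (fun x => by rw [hβa, halt]; ring) (by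
      have := Submodule.finrank_lt_finrank_of_lt h1
      have := Submodule.finrank_lt_finrank_of_lt h2
      omega)
    refine ⟨Fin.cons ![α u, α v] X, fun x y => ?_⟩
    rw [Fin.sum_univ_succ]
    simp only [Fin.cons_zero, Fin.cons_succ, ← hX, hβa]
    simp

/-- The top power of a nondegenerate two-form does not vanish on a basis. -/
theorem wedge_ne_zero_of_nondegenerate [CharZero 𝕂] [AddCommGroup V] [Module 𝕂 V]
    (b : Module.Basis (Fin (2 * n)) 𝕂 V) (α : V →ₗ[𝕂] V →ₗ[𝕂] 𝕂) (halt : ∀ u, α u u = 0)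
    (hnd : ∀ u, α u = 0 → u = 0) : wedge (fun _ : Fin n => fun u v => α u v) b ≠ 0 := by
  have := b.finiteDimensional_of_finite
  obtain ⟨X, hX⟩ := exists_decomposition n α halt (by
    rw [Module.finrank_eq_card_basis b, Fintype.card_fin]; omega)
  have : (fun _ : Fin n => fun u v => α u v) =
      fun _ a c => ∑ m, 1 * (X m 0 a * X m 1 c - X m 0 c * X m 1 a) := by
    ext i u v
    simp [hX]
  rw [this, wedge_symplectic (fun _ => 1) (fun m s => X m s)]
  refine mul_ne_zero (by simp [Nat.factorial_ne_zero]) fun hdet => ?_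
  -- A null vector of the matrix gives a vector killed by all the one-forms, hence in the kernel of
  -- α.
  obtain ⟨c, hc, hMc⟩ := Matrix.exists_mulVec_eq_zero_iff.2 hdet
  refine hc ?_
  have hx : ∑ k, c k • b (pairEquiv n k) = 0 := by
    apply hnd
    ext y
    rw [hX]
    have hz : ∀ i s, X i s (∑ k, c k • b (pairEquiv n k)) = 0 := fun i s => by
      have := congrFun hMc (i, s)
      simp only [Matrix.mulVec, dotProduct, Matrix.of_apply, Pi.zero_apply] at this
      rw [map_sum, ← this]
      exact Finset.sum_congr rfl fun k _ => by rw [map_smul, smul_eq_mul, mul_comm]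
    simp [hz]
  have hli := (b.reindex (pairEquiv n).symm).linearIndependent
  rw [Fintype.linearIndependent_iff] at hli
  funext k
  exact hli c (by simpa using hx) k

end WedgeAlgebra

/-! ### Change of basis and orientation -/

section WedgeBasis

variable {n : ℕ} {𝕂 V : Type*} [Field 𝕂] [Algebra ℝ 𝕂] [AddCommGroup V] [Module ℝ V]

/-- The wedge product of `n` two-forms is a top-degree form. -/
theorem wedge_linear_comb (α : Fin n → V →ₗ[ℝ] V →ₗ[ℝ] 𝕂) (b v : Fin (2 * n) → V)
    (A : Matrix (Fin n × Fin 2) (Fin n × Fin 2) ℝ)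
    (hv : ∀ k, v (pairEquiv n k) = ∑ m, A m k • b (pairEquiv n m)) :
    wedge (fun i x y => α i x y) v = algebraMap ℝ 𝕂 A.det * wedge (fun i x y => α i x y) b := by
  rw [wedge_eq_sum_pairs, wedge_eq_sum_pairs, mul_div_assoc']
  congr 1
  set w : Fin n × Fin 2 → V := fun k => b (pairEquiv n k) with hw
  have hexp : ∀ (i : Fin n) (k l : Fin n × Fin 2), α i (v (pairEquiv n k)) (v (pairEquiv n l)) =
      ∑ g : (Fin n × Fin 2) × (Fin n × Fin 2), algebraMap ℝ 𝕂 (A g.1 k * A g.2 l) * α i (w g.1) (w g.2) := by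
    intro i k l
    rw [hv, hv, Fintype.sum_prod_type (α₁ := Fin n × Fin 2)]
    simp only [map_sum, LinearMap.coe_sum, Finset.sum_apply, map_smul, LinearMap.smul_apply]
    simp only [Finset.smul_sum]
    rw [Finset.sum_comm]
    refine Finset.sum_congr rfl fun x _ => Finset.sum_congr rfl fun y _ => ?_
    rw [smul_smul, Algebra.smul_def, mul_comm (A y l)]
  simp only [hexp]
  simp only [Finset.prod_univ_sum, Fintype.piFinset_univ, Finset.prod_mul_distrib, Finset.mul_sum]
  rw [Finset.sum_comm]
  -- The expansion assigns to each factor a pair of basis indices; regrouping the pairs as one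
  -- self-map f of the index set exposes the minor with rows selected by f.
  let e : ((Fin n × Fin 2) → (Fin n × Fin 2)) ≃ (Fin n → ((Fin n × Fin 2) × (Fin n × Fin 2))) :=
    { toFun := fun f i => (f (i, 0), f (i, 1))
      invFun := fun g j => if j.2 = 0 then (g j.1).1 else (g j.1).2
      left_inv := by
        intro f
        funext j
        obtain ⟨i, s⟩ := j
        fin_cases s <;> rfl
      right_inv := by
        intro g
        rfl }
  rw [← Fintype.sum_equiv e (fun f => algebraMap ℝ 𝕂 (A.submatrix f id).det *
    ∏ i, α i (w (f (i, 0))) (w (f (i, 1)))) _ ?_]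
  · have hinj : ∀ f : (Fin n × Fin 2) → (Fin n × Fin 2), f ∉ Finset.univ.image (fun π : Equiv.Perm (Fin n × Fin 2) => ⇑π) →
        algebraMap ℝ 𝕂 (A.submatrix f id).det * ∏ i, α i (w (f (i, 0))) (w (f (i, 1))) = 0 := by
      intro f hf
      have hni : ¬ Function.Injective f := fun hi => hf (by
        simp only [Finset.mem_image, Finset.mem_univ, true_and]
        exact ⟨Equiv.ofBijective f (Finite.injective_iff_bijective.1 hi), rfl⟩)
      simp only [Function.Injective, not_forall] at hni
      obtain ⟨x, y, hxy, hne⟩ := hni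
      rw [Matrix.det_zero_of_row_eq hne, map_zero, zero_mul]
      ext k
      simp [hxy]
    rw [← Finset.sum_subset (Finset.subset_univ _) (fun f _ hf => hinj f hf),
      Finset.sum_image (fun a _ b _ h => DFunLike.coe_injective h)]
    refine Finset.sum_congr rfl fun π _ => ?_
    rw [Matrix.det_permute, map_mul, map_intCast]
    ring
  · intro f
    rw [← Matrix.det_transpose, Matrix.det_apply', map_sum, Finset.sum_mul]
    refine Finset.sum_congr rfl fun σ _ => ?_
    rw [map_mul, map_intCast, map_prod, mul_assoc]
    congr 2
    rw [Fintype.prod_prod_type]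
    refine Finset.prod_congr rfl fun i _ => ?_
    rw [Fin.prod_univ_two, map_mul]
    rfl

/-- The quotient of two top-degree forms does not depend on the basis. -/
theorem wedge_div_wedge_basis (α β : Fin n → V →ₗ[ℝ] V →ₗ[ℝ] 𝕂)
    (b b' : Module.Basis (Fin (2 * n)) ℝ V) :
    wedge (fun i x y => α i x y) b' / wedge (fun i x y => β i x y) b' =
      wedge (fun i x y => α i x y) b / wedge (fun i x y => β i x y) b := by
  set c := b.reindex (pairEquiv n).symm
  set c' := b'.reindex (pairEquiv n).symm
  have hv : ∀ k, b' (pairEquiv n k) = ∑ m, c.toMatrix c' m k • b (pairEquiv n m) := fun k => by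
    have := (c.sum_toMatrix_smul_self c' k).symm
    simpa [c, c'] using this
  have hdet : algebraMap ℝ 𝕂 (c.toMatrix c').det ≠ 0 := by
    rw [Ne, map_eq_zero]
    exact (c.isUnit_det c').ne_zero
  rw [wedge_linear_comb α b b' _ hv, wedge_linear_comb β b b' _ hv, mul_div_mul_left _ _ hdet]

/-- Two nondegenerate two-forms joined by a segment of nondegenerate two-forms define the same
orientation. -/
theorem wedge_div_wedge_pos (b : Module.Basis (Fin (2 * n)) ℝ V) (α β : V →ₗ[ℝ] V →ₗ[ℝ] ℝ)
    (hα : ∀ u, α u u = 0) (hβ : ∀ u, β u u = 0)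
    (hnd : ∀ s ∈ Set.Icc (0 : ℝ) 1, ∀ u, ((1 - s) • α + s • β) u = 0 → u = 0) :
    0 < wedge (fun _ : Fin n => fun u v => α u v) b /
      wedge (fun _ : Fin n => fun u v => β u v) b := by
  set W : ℝ → ℝ := fun s =>
    wedge (fun _ : Fin n => fun u v => ((1 - s) • α + s • β) u v) b with hW
  have hcont : Continuous W := by
    simp only [hW, wedge, LinearMap.add_apply, LinearMap.smul_apply]
    fun_prop
  have hne : ∀ s ∈ Set.Icc (0 : ℝ) 1, W s ≠ 0 := fun s hs =>
    wedge_ne_zero_of_nondegenerate b _ (fun u => by simp [hα, hβ]) (hnd s hs)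
  have h0 : wedge (fun _ : Fin n => fun u v => α u v) b = W 0 := by simp [hW]
  have h1 : wedge (fun _ : Fin n => fun u v => β u v) b = W 1 := by simp [hW]
  rw [h0, h1]
  -- The top power along the segment is continuous and never zero, so its end values have the same
  -- sign.
  have hiv := intermediate_value_uIcc (a := 0) (b := 1) hcont.continuousOn
  have hnot : (0 : ℝ) ∉ Set.uIcc (W 0) (W 1) := fun h => by
    obtain ⟨s, hs, hs0⟩ := hiv h
    rw [Set.uIcc_of_le zero_le_one] at hs
    exact hne s hs hs0
  rw [Set.mem_uIcc] at hnot
  push Not at hnot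
  have w0 := hne 0 (by simp)
  have w1 := hne 1 (by simp)
  rcases lt_or_gt_of_ne w0 with h | h
  · exact div_pos_of_neg_of_neg h (hnot.1 h.le)
  · exact div_pos h (lt_of_le_of_ne (not_lt.1 fun h' => (hnot.2 h'.le).not_gt h) w1.symm)

end WedgeBasis

/-! ### Top-degree forms on ℂⁿ in the coordinates z and z̄ -/

section WedgeComplex

/-- The real basis `∂/∂x₁, ∂/∂y₁, …` of `ℂⁿ`. -/
noncomputable def cbasis (n : ℕ) : Module.Basis (Fin (2 * n)) ℝ (Fin n → ℂ) :=
  (Pi.basis fun _ : Fin n => Complex.basisOneI).reindex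
    ((Equiv.sigmaEquivProd (Fin n) (Fin 2)).trans (pairEquiv n))

theorem cbasis_apply {n : ℕ} (k : Fin n × Fin 2) :
    cbasis n (pairEquiv n k) = Pi.single k.1 (![1, Complex.I] k.2) := by
  simp [cbasis]

/-- The two-form `dx_α ∧ dy_α` on `ℂⁿ`. -/
def areaForm {n : ℕ} (α : Fin n) (u v : Fin n → ℂ) : ℝ := (starRingEnd ℂ (u α) * v α).im

/-- The coordinates `z_i` (`c = 0`) and their conjugates (`c = 1`). -/
noncomputable def czeta {n : ℕ} (c : Fin 2) (i : Fin n) (u : Fin n → ℂ) : ℂ :=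
  if c = 0 then u i else starRingEnd ℂ (u i)

theorem czeta_cbasis {n : ℕ} (c : Fin 2) (i : Fin n) (k : Fin n × Fin 2) :
    czeta c i (cbasis n (pairEquiv n k)) =
      if i = k.1 then czeta c 0 (fun _ : Fin 1 => ![1, Complex.I] k.2) else 0 := by
  rw [cbasis_apply]
  by_cases h : i = k.1
  · subst h; simp [czeta]
  · simp [czeta, h]

/-- The matrix is block diagonal, and each pair dz, dz̄ evaluated on ∂x, ∂y has determinant -2i. -/
theorem det_czeta (n : ℕ) : (Matrix.of fun j k : Fin n × Fin 2 =>
    czeta j.2 j.1 (cbasis n (pairEquiv n k))).det = (-2 * Complex.I) ^ n := by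
  have : (Matrix.of fun j k : Fin n × Fin 2 => czeta j.2 j.1 (cbasis n (pairEquiv n k))) =
      (Matrix.blockDiagonal fun _ : Fin n => !![1, Complex.I; 1, -Complex.I]).submatrix
        (Equiv.prodComm _ _) (Equiv.prodComm _ _) := by
    ext ⟨i, s⟩ ⟨j, t⟩
    rw [Matrix.of_apply, czeta_cbasis]
    by_cases h : i = j
    · subst h
      fin_cases s <;> fin_cases t <;> simp [czeta, Matrix.blockDiagonal_apply]
    · simp [h, Matrix.blockDiagonal_apply]
  rw [this, Matrix.det_submatrix_equiv_self, Matrix.det_blockDiagonal]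
  simp only [Matrix.det_fin_two_of, Finset.prod_const, Finset.card_univ, Fintype.card_fin]
  ring

/-- The position of the conjugated factors in `τ ∧ conj τ ∧ H ∧ ⋯ ∧ H`. -/
def conjFlag {m : ℕ} (j : Fin (m + 2) × Fin 2) : Fin 2 :=
  if j.1 = 0 then 0 else if j.1 = 1 then 1 else j.2

/-- The index of the factors in the leading term of `τ ∧ conj τ ∧ H ∧ ⋯ ∧ H`. -/
def baseIndex {m : ℕ} (j : Fin (m + 2) × Fin 2) : Fin (m + 2) :=
  if j.1 = 0 ∨ j.1 = 1 then (if j.2 = 0 then 0 else 1) else j.1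

/-- The leading term has its first rows in the order z₀, z₁, z̄₀, z̄₁; one transposition brings them
to z₀, z̄₀, z₁, z̄₁ and costs the sign. Relabelling coordinates by π moves z and z̄ together and
costs none. -/
theorem det_czeta_base {m : ℕ} (π : Equiv.Perm (Fin (m + 2))) :
    (Matrix.of fun j k : Fin (m + 2) × Fin 2 =>
      czeta (conjFlag j) (π (baseIndex j)) (cbasis (m + 2) (pairEquiv (m + 2) k))).det =
      -(-2 * Complex.I) ^ (m + 2) := by
  set N := Matrix.of fun j k : Fin (m + 2) × Fin 2 =>
      czeta (conjFlag j) (π (baseIndex j)) (cbasis (m + 2) (pairEquiv (m + 2) k)) with hN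
  have h1 := Matrix.det_permute' (Equiv.prodCongrLeft fun _ : Fin 2 => π) N
  rw [sign_prodCongrLeft_const] at h1
  simp only [Units.val_one, Int.cast_one, one_mul] at h1
  rw [← h1]
  have h01 : (((0 : Fin (m + 2)), (1 : Fin 2)) : Fin (m + 2) × Fin 2) ≠ (1, 0) := by simp
  have h2 := Matrix.det_permute (Equiv.swap (((0 : Fin (m + 2)), (1 : Fin 2))) (1, 0))
    (Matrix.of fun j k : Fin (m + 2) × Fin 2 =>
      czeta j.2 j.1 (cbasis (m + 2) (pairEquiv (m + 2) k)))
  rw [Equiv.Perm.sign_swap h01, det_czeta] at h2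
  simp only [Units.val_neg, Units.val_one, Int.cast_neg, Int.cast_one, neg_one_mul] at h2
  rw [← h2]
  congr 1
  ext ⟨i, s⟩ ⟨j, t⟩
  simp only [Matrix.submatrix_apply, hN, Matrix.of_apply, czeta_cbasis, id,
    Equiv.prodCongrLeft_apply, EmbeddingLike.apply_eq_iff_eq]
  have hkey : Equiv.swap (((0 : Fin (m + 2)), (1 : Fin 2))) (1, 0) (i, s) =
      (baseIndex (i, s), conjFlag (i, s)) := by
    by_cases h0 : i = 0
    · subst h0
      fin_cases s
      · rw [Equiv.swap_apply_of_ne_of_ne (by simp) (by simp)]; simp [baseIndex, conjFlag]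
      · simp [baseIndex, conjFlag]
    by_cases h1 : i = 1
    · subst h1
      fin_cases s
      · simp [baseIndex, conjFlag]
      · rw [Equiv.swap_apply_of_ne_of_ne (by simp) (by simp)]; simp [baseIndex, conjFlag]
    · rw [Equiv.swap_apply_of_ne_of_ne (by simp [h0]) (by simp [h1])]
      simp [baseIndex, conjFlag, h0, h1]
  rw [hkey]

/-- The factors of the term of index `f` in the expansion of `τ ∧ conj τ ∧ H ∧ ⋯ ∧ H`. -/
def termIndex {m : ℕ} (f : Fin (m + 2) → Fin (m + 2) × Fin (m + 2)) (j : Fin (m + 2) × Fin 2) :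
    Fin (m + 2) := if j.2 = 0 then (f j.1).1 else (f j.1).2

/-- The coefficients in the expansion of `τ ∧ conj τ ∧ H ∧ ⋯ ∧ H`. -/
noncomputable def termCoeff {m : ℕ} (T : Fin (m + 2) → Fin (m + 2) → ℂ) (t : Fin (m + 2) → ℝ)
    (i : Fin (m + 2)) (k : Fin (m + 2) × Fin (m + 2)) : ℂ :=
  if i = 0 then T k.1 k.2 / 2 else if i = 1 then starRingEnd ℂ (T k.1 k.2) / 2
  else if k.1 = k.2 then Complex.I / 2 * (t k.1 : ℂ) else 0

theorem prod_termCoeff {m : ℕ} (T : Fin (m + 2) → Fin (m + 2) → ℂ) (t : Fin (m + 2) → ℝ)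
    (f : Fin (m + 2) → Fin (m + 2) × Fin (m + 2)) (hf : ∀ i : Fin m, (f i.succ.succ).1 = (f i.succ.succ).2) :
    ∏ i, termCoeff T t i (f i) = T (f 0).1 (f 0).2 * starRingEnd ℂ (T (f 1).1 (f 1).2) / 4 *
      ((Complex.I / 2) ^ m * ((∏ i : Fin m, t (f i.succ.succ).1 : ℝ) : ℂ)) := by
  rw [Fin.prod_univ_succ, Fin.prod_univ_succ]
  have h : ∀ i : Fin m, termCoeff T t i.succ.succ (f i.succ.succ) =
      Complex.I / 2 * (t (f i.succ.succ).1 : ℂ) := fun i => by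
    have h1 : (i.succ.succ : Fin (m + 2)) ≠ 1 := by
      rw [← Fin.succ_zero_eq_one]; exact fun h => Fin.succ_ne_zero _ (Fin.succ_injective _ h)
    simp [termCoeff, Fin.succ_ne_zero, h1, hf]
  simp only [h, Finset.prod_mul_distrib, Finset.prod_const, Finset.card_univ, Fintype.card_fin]
  simp [termCoeff]
  ring

/-- The normalizations cancel: (i/2)(-2i) = 1 for each of the m factors H, and (-2i)² = -4
compensates the factors 1/2 from τ and conj τ together with the sign of the transposition. -/
theorem coeff_identity (m : ℕ) (c r : ℂ) : c / 4 * ((Complex.I / 2) ^ m * r) *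
    -(-2 * Complex.I) ^ (m + 2) = c * r := by
  have h : (Complex.I / 2) ^ m * (-2 * Complex.I) ^ m = 1 := by
    rw [← mul_pow]
    have : Complex.I / 2 * (-2 * Complex.I) = 1 := by
      linear_combination -Complex.I_mul_I
    rw [this, one_pow]
  rw [pow_add]
  linear_combination (- c / 4 * r * (-2 * Complex.I) ^ 2) * h + (-c * r) * Complex.I_mul_I

/-- A nonzero term needs every dz_a and every dz̄_a exactly once. The factors H use dz_a and dz̄_a
with the same a, so τ and conj τ are left with the same two indices. If these occur in the same
order the coefficient is |T|² times a product of t's; in the opposite order the sign from skewness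
of T cancels the sign of the determinant. -/
theorem term_nonneg {m : ℕ} (T : Fin (m + 2) → Fin (m + 2) → ℂ) (hT : ∀ a b, T a b = - T b a)
    (t : Fin (m + 2) → ℝ) (ht : ∀ i, 0 ≤ t i) (f : Fin (m + 2) → Fin (m + 2) × Fin (m + 2)) :
    0 ≤ ((∏ i, termCoeff T t i (f i)) *
      (Matrix.of fun j k : Fin (m + 2) × Fin 2 => czeta (conjFlag j) (termIndex f j)
        (cbasis (m + 2) (pairEquiv (m + 2) k))).det).re := by
  have h20 : ∀ i : Fin m, (i.succ.succ : Fin (m + 2)) ≠ 0 := fun i => Fin.succ_ne_zero _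
  have h21 : ∀ i : Fin m, (i.succ.succ : Fin (m + 2)) ≠ 1 := fun i => by
    rw [← Fin.succ_zero_eq_one]; exact fun h => Fin.succ_ne_zero _ (Fin.succ_injective _ h)
  by_cases hf : ∀ i : Fin m, (f i.succ.succ).1 = (f i.succ.succ).2
  swap
  · push Not at hf
    obtain ⟨i, hi⟩ := hf
    rw [Finset.prod_eq_zero (Finset.mem_univ i.succ.succ), zero_mul, Complex.zero_re]
    simp [termCoeff, h20, h21, hi]
  rw [prod_termCoeff T t f hf]
  by_cases hinj : Function.Injective fun j => (conjFlag j, termIndex f j)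
  swap
  · simp only [Function.Injective, not_forall] at hinj
    obtain ⟨x, y, hxy, hne⟩ := hinj
    rw [Matrix.det_zero_of_row_eq hne, mul_zero, Complex.zero_re]
    rw [Prod.mk.injEq] at hxy
    ext k
    simp [hxy.1, hxy.2]
  -- The indices of the unconjugated factors dz; distinctness of the rows makes g a permutation.
  set g : Fin (m + 2) → Fin (m + 2) :=
    fun i => if i = 0 then (f 0).1 else if i = 1 then (f 0).2 else (f i).1 with hg
  have hginj : Function.Injective g := by
    intro x y hxy
    have key : ∀ z : Fin (m + 2), (fun j => (conjFlag j, termIndex f j))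
        (if z = 0 then (0, 0) else if z = 1 then (0, 1) else (z, 0)) = (0, g z) := by
      intro z
      by_cases hz0 : z = 0
      · simp [hz0, conjFlag, termIndex, hg]
      by_cases hz1 : z = 1
      · simp [hz1, conjFlag, termIndex, hg]
      · simp [hz0, hz1, conjFlag, termIndex, hg]
    have h := hinj ((key x).trans ((congrArg (Prod.mk 0) hxy).trans (key y).symm))
    by_cases hx0 : x = 0 <;> by_cases hy0 : y = 0 <;> by_cases hx1 : x = 1 <;>
      by_cases hy1 : y = 1 <;> simp_all
  set π : Equiv.Perm (Fin (m + 2)) :=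
    Equiv.ofBijective g (Finite.injective_iff_bijective.1 hginj) with hπ
  have hπa : ∀ i, π i = g i := fun i => rfl
  -- An index of conj τ cannot be one taken by a factor H, since that dz̄ is already used; only the
  -- two indices of τ remain.
  have hmem : ∀ s : Fin 2, termIndex f (1, s) = g 0 ∨ termIndex f (1, s) = g 1 := by
    intro s
    obtain ⟨i, hi⟩ := π.surjective (termIndex f (1, s))
    rw [hπa] at hi
    by_cases hi0 : i = 0
    · left; rw [← hi, hi0]
    by_cases hi1 : i = 1
    · right; rw [← hi, hi1]
    exfalso
    obtain ⟨i, rfl⟩ := Fin.exists_succ_eq.2 hi0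
    obtain ⟨i, rfl⟩ := Fin.exists_succ_eq.2 (fun h => hi1 (by rw [h]; rfl) : i ≠ 0)
    have : (fun j => (conjFlag j, termIndex f j)) (i.succ.succ, 1) =
        (fun j => (conjFlag j, termIndex f j)) (1, s) := by
      simp only [Prod.mk.injEq]
      refine ⟨by simp [conjFlag, h20, h21], ?_⟩
      rw [← hi]
      simp [termIndex, hg, h20, h21, hf]
    have := hinj this
    simp only [Prod.mk.injEq] at this
    exact h21 i this.1
  have hne : termIndex f (1, 0) ≠ termIndex f (1, 1) := fun h => by
    have : (fun j => (conjFlag j, termIndex f j)) (1, 0) =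
        (fun j => (conjFlag j, termIndex f j)) ((1 : Fin (m + 2)), (1 : Fin 2)) := by
      simp [h, conjFlag]
    simpa using hinj this
  have ht' : 0 ≤ ∏ i : Fin m, t (f i.succ.succ).1 := Finset.prod_nonneg fun i _ => ht _
  have h00 : g 0 = (f 0).1 := by simp [hg]
  have h11 : g 1 = (f 0).2 := by simp [hg]
  have hrest : ∀ (i : Fin m) (s : Fin 2),
      termIndex f (i.succ.succ, s) = g i.succ.succ := fun i s => by
    fin_cases s <;> simp [termIndex, hg, h20, h21, hf]
  rcases hmem 0 with h0 | h0 <;> rcases hmem 1 with h1 | h1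
  · exact absurd (h0.trans h1.symm) hne
  · have hidx : ∀ j, termIndex f j = π (baseIndex j) := by
      rintro ⟨i, s⟩
      rw [hπa]
      refine Fin.cases ?_ (fun i => Fin.cases ?_ (fun i => ?_) i) i
      · fin_cases s <;> simp [termIndex, baseIndex, hg]
      · fin_cases s <;> simp [baseIndex, h0, h1]
      · rw [hrest]; simp [baseIndex, h20, h21]
    simp only [hidx]
    rw [det_czeta_base, coeff_identity]
    have hc : (f 1).1 = (f 0).1 := by rw [← h00, ← h0]; simp [termIndex]
    have hd : (f 1).2 = (f 0).2 := by rw [← h11, ← h1]; simp [termIndex]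
    rw [hc, hd, Complex.mul_conj, ← Complex.ofReal_mul, Complex.ofReal_re]
    exact mul_nonneg (Complex.normSq_nonneg _) ht'
  · have hidx : ∀ j, termIndex f j = π (baseIndex (Equiv.swap (1, 0) (1, 1) j)) ∧
        conjFlag j = conjFlag (Equiv.swap ((1 : Fin (m + 2)), (0 : Fin 2)) (1, 1) j) := by
      rintro ⟨i, s⟩
      rw [hπa]
      refine Fin.cases ?_ (fun i => Fin.cases ?_ (fun i => ?_) i) i
      · rw [Equiv.swap_apply_of_ne_of_ne (by simp) (by simp)]
        fin_cases s <;> simp [termIndex, baseIndex, hg]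
      · fin_cases s <;> simp [baseIndex, h0, h1, conjFlag]
      · rw [hrest, Equiv.swap_apply_of_ne_of_ne (by simp [h21]) (by simp [h21])]
        simp [baseIndex, h20, h21]
    have hM : (Matrix.of fun j k : Fin (m + 2) × Fin 2 => czeta (conjFlag j) (termIndex f j)
        (cbasis (m + 2) (pairEquiv (m + 2) k))) =
        (Matrix.of fun j k : Fin (m + 2) × Fin 2 => czeta (conjFlag j) (π (baseIndex j))
        (cbasis (m + 2) (pairEquiv (m + 2) k))).submatrix
          (Equiv.swap ((1 : Fin (m + 2)), (0 : Fin 2)) (1, 1)) id := by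
      ext j k
      rw [Matrix.of_apply, (hidx j).1, (hidx j).2]
      rfl
    have hsw : ((1 : Fin (m + 2)), (0 : Fin 2)) ≠ (1, 1) := by simp
    rw [hM, Matrix.det_permute, det_czeta_base, Equiv.Perm.sign_swap hsw, mul_left_comm,
      coeff_identity]
    have hc : (f 1).1 = (f 0).2 := by rw [← h11, ← h0]; simp [termIndex]
    have hd : (f 1).2 = (f 0).1 := by rw [← h00, ← h1]; simp [termIndex]
    have : starRingEnd ℂ (T (f 1).1 (f 1).2) = - starRingEnd ℂ (T (f 0).1 (f 0).2) := by
      rw [hc, hd, hT, map_neg]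
    rw [this, mul_neg, Complex.mul_conj]
    simp only [Units.val_neg, Units.val_one, Int.cast_neg, Int.cast_one, neg_mul, one_mul, neg_neg]
    rw [← Complex.ofReal_mul, Complex.ofReal_re]
    exact mul_nonneg (Complex.normSq_nonneg _) ht'
  · exact absurd (h0.trans h1.symm) hne

/-- The term in which τ and conj τ both take the indices 0, 1 and the other factors take one
remaining index each; it equals |T₀₁|² ∏_{i ≥ 2} t_i. -/
theorem term_pos {m : ℕ} (T : Fin (m + 2) → Fin (m + 2) → ℂ) (hT : T 0 1 ≠ 0)
    (t : Fin (m + 2) → ℝ) (ht : ∀ i : Fin m, 0 < t i.succ.succ) :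
    0 < ((∏ i, termCoeff T t i ((fun i => if i = 0 ∨ i = 1 then (0, 1) else (i, i)) i)) *
      (Matrix.of fun j k : Fin (m + 2) × Fin 2 => czeta (conjFlag j)
        (termIndex (fun i => if i = 0 ∨ i = 1 then (0, 1) else (i, i)) j)
        (cbasis (m + 2) (pairEquiv (m + 2) k))).det).re := by
  have h20 : ∀ i : Fin m, (i.succ.succ : Fin (m + 2)) ≠ 0 := fun i => Fin.succ_ne_zero _
  have h21 : ∀ i : Fin m, (i.succ.succ : Fin (m + 2)) ≠ 1 := fun i => by
    rw [← Fin.succ_zero_eq_one]; exact fun h => Fin.succ_ne_zero _ (Fin.succ_injective _ h)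
  rw [prod_termCoeff T t _ (fun i => by simp [h20, h21])]
  have hidx : ∀ j : Fin (m + 2) × Fin 2,
      termIndex (fun i => if i = 0 ∨ i = 1 then (0, 1) else (i, i)) j =
      (1 : Equiv.Perm (Fin (m + 2))) (baseIndex j) := by
    rintro ⟨i, s⟩
    by_cases h : i = 0 ∨ i = 1
    · simp [termIndex, baseIndex, h]
    · simp [termIndex, baseIndex, h]
  simp only [hidx]
  rw [det_czeta_base, coeff_identity]
  simp only [true_or, or_true, if_true, h20, h21, or_self, if_false]
  rw [Complex.mul_conj, ← Complex.ofReal_mul, Complex.ofReal_re]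
  exact mul_pos (Complex.normSq_pos.2 hT) (Finset.prod_pos fun i _ => ht i)

/-- Positivity of `τ ∧ conj τ ∧ Hⁿ⁻²` for `H = ∑ t_α dx_α ∧ dy_α ≥ 0` with at most two vanishing
coefficients. -/
theorem re_wedge_tau_pos {n : ℕ} (hn : 2 ≤ n) (T : Fin n → Fin n → ℂ)
    (hT : ∀ a b, T a b = - T b a) (hT01 : T ⟨0, by omega⟩ ⟨1, by omega⟩ ≠ 0)
    (t : Fin n → ℝ) (ht : ∀ i, 0 ≤ t i) (ht' : ∀ i : Fin n, 2 ≤ (i : ℕ) → 0 < t i) :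
    0 < (wedge (fun (i : Fin n) (u v : Fin n → ℂ) =>
      if (i : ℕ) < 2 * 1 then
        (if (i : ℕ) % 2 = 0 then ∑ a, ∑ b, T a b * u a * v b
          else starRingEnd ℂ (∑ a, ∑ b, T a b * u a * v b))
      else ((∑ a, t a * areaForm a u v : ℝ) : ℂ)) (cbasis n)).re := by
  obtain ⟨m, rfl⟩ : ∃ m, n = m + 2 := ⟨n - 2, by omega⟩
  have h20 : ∀ i : Fin m, (i.succ.succ : Fin (m + 2)) ≠ 0 := fun i => Fin.succ_ne_zero _
  have h21 : ∀ i : Fin m, (i.succ.succ : Fin (m + 2)) ≠ 1 := fun i => by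
    rw [← Fin.succ_zero_eq_one]; exact fun h => Fin.succ_ne_zero _ (Fin.succ_injective _ h)
  have hskew : ∀ u v : Fin (m + 2) → ℂ, ∑ a, ∑ b, T a b * u a * v b =
      ∑ k : Fin (m + 2) × Fin (m + 2), T k.1 k.2 / 2 * (u k.1 * v k.2 - v k.1 * u k.2) := by
    intro u v
    have h1 : ∑ k : Fin (m + 2) × Fin (m + 2), T k.1 k.2 / 2 * (v k.1 * u k.2) =
        - ∑ k : Fin (m + 2) × Fin (m + 2), T k.1 k.2 / 2 * (u k.1 * v k.2) := by
      rw [← Finset.sum_neg_distrib]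
      refine Fintype.sum_equiv (Equiv.prodComm _ _) _ _ fun k => ?_
      simp only [Equiv.prodComm_apply, Prod.fst_swap, Prod.snd_swap]
      rw [hT k.1 k.2]
      ring
    simp only [mul_sub, Finset.sum_sub_distrib, h1]
    rw [sub_neg_eq_add, ← Finset.sum_add_distrib, Fintype.sum_prod_type]
    exact Finset.sum_congr rfl fun a _ => Finset.sum_congr rfl fun b _ => by ring
  have hform : (fun (i : Fin (m + 2)) (u v : Fin (m + 2) → ℂ) =>
      if (i : ℕ) < 2 * 1 then
        (if (i : ℕ) % 2 = 0 then ∑ a, ∑ b, T a b * u a * v b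
          else starRingEnd ℂ (∑ a, ∑ b, T a b * u a * v b))
      else ((∑ a, t a * areaForm a u v : ℝ) : ℂ)) =
      fun i u v => ∑ k : Fin (m + 2) × Fin (m + 2), termCoeff T t i k *
        (czeta (conjFlag (i, 0)) k.1 u * czeta (conjFlag (i, 1)) k.2 v
          - czeta (conjFlag (i, 0)) k.1 v * czeta (conjFlag (i, 1)) k.2 u) := by
    funext i u v
    refine Fin.cases ?_ (fun i => Fin.cases ?_ (fun i => ?_) i) i
    · simp [hskew, termCoeff, czeta, conjFlag]
    · have h2 : starRingEnd ℂ (2 : ℂ) = 2 := map_ofNat _ 2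
      simp [hskew, termCoeff, czeta, conjFlag, h2]
    · rw [if_neg (by simp)]
      rw [Fintype.sum_prod_type]
      simp only [termCoeff, h20, h21, if_false]
      simp only [ite_mul, zero_mul, Finset.sum_ite_eq, Finset.mem_univ, if_true]
      push_cast
      refine Finset.sum_congr rfl fun a _ => ?_
      -- This is dx ∧ dy = (i/2) dz ∧ dz̄.
      have : ((areaForm a u v : ℝ) : ℂ) =
          Complex.I / 2 * (u a * starRingEnd ℂ (v a) - v a * starRingEnd ℂ (u a)) := by
        apply Complex.ext <;> simp [areaForm] <;> ring
      rw [this]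
      simp [czeta, conjFlag, h20, h21]
      ring
  rw [hform]
  have := wedge_sum_decomposable (termCoeff T t)
    (fun i (k : Fin (m + 2) × Fin (m + 2)) s (u : Fin (m + 2) → ℂ) =>
      czeta (conjFlag (i, s)) (if s = 0 then k.1 else k.2) u) (cbasis (m + 2))
  simp only [if_true, one_ne_zero, if_false] at this
  rw [this, Complex.re_sum]
  exact Finset.sum_pos' (fun f _ => term_nonneg T hT t ht f)
    ⟨_, Finset.mem_univ _, term_pos T hT01 t fun i => ht' _ (by simp)⟩

/-- The top power of `∑ t_α dx_α ∧ dy_α`. -/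
theorem wedge_area_eq {n : ℕ} (t : Fin n → ℝ) :
    wedge (fun (_ : Fin n) (u v : Fin n → ℂ) => ((∑ a, t a * areaForm a u v : ℝ) : ℂ))
      (cbasis n) = ((n.factorial * ∏ a, t a : ℝ) : ℂ) := by
  have h : (fun (_ : Fin n) (u v : Fin n → ℂ) => ((∑ a, t a * areaForm a u v : ℝ) : ℂ)) =
      fun _ u v => ∑ a, (Complex.I / 2 * (t a : ℂ)) *
        (czeta 0 a u * czeta 1 a v - czeta 0 a v * czeta 1 a u) := by
    funext _ u v
    push_cast
    refine Finset.sum_congr rfl fun a _ => ?_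
    have : ((areaForm a u v : ℝ) : ℂ) =
        Complex.I / 2 * (u a * starRingEnd ℂ (v a) - v a * starRingEnd ℂ (u a)) := by
      apply Complex.ext <;> simp [areaForm] <;> ring
    rw [this]
    simp [czeta]
    ring
  rw [h, wedge_symplectic _ (fun m s => czeta s m), det_czeta, Finset.prod_mul_distrib]
  have h2 : (Complex.I / 2) ^ n * (-2 * Complex.I) ^ n = 1 := by
    rw [← mul_pow]
    have : Complex.I / 2 * (-2 * Complex.I) = 1 := by
      linear_combination -Complex.I_mul_I
    rw [this, one_pow]
  simp only [Finset.prod_const, Finset.card_univ, Fintype.card_fin]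
  push_cast
  linear_combination (n.factorial : ℂ) * (∏ a, (t a : ℂ)) * h2

end WedgeComplex

/-! ### Parametrizations and transition maps -/

section Param

variable {n : ℕ} {M : Type*} [TopologicalSpace M] [ChartedSpace (Model n) M]
  {E : Type*} [NormedAddCommGroup E] [NormedSpace ℝ E]

/-- A smooth parametrization of an open subset of `M`. -/
structure IsParam (n : ℕ) {M : Type*} [TopologicalSpace M] [ChartedSpace (Model n) M]
    {E : Type*} [NormedAddCommGroup E] [NormedSpace ℝ E]
    (χ : OpenPartialHomeomorph E M) : Prop where
  smooth : ContMDiffOn 𝓘(ℝ, E) 𝓘(ℝ, Model n) ∞ χ χ.source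
  smooth_symm : ContMDiffOn 𝓘(ℝ, Model n) 𝓘(ℝ, E) ∞ χ.symm χ.target

/-- The derivative of a parametrization. -/
noncomputable def tmap (n : ℕ) {M : Type*} [TopologicalSpace M] [ChartedSpace (Model n) M]
    {E : Type*} [NormedAddCommGroup E] [NormedSpace ℝ E]
    (χ : OpenPartialHomeomorph E M) (z : E) : E →L[ℝ] Model n :=
  mfderiv 𝓘(ℝ, E) 𝓘(ℝ, Model n) χ z

/-- The inverse of the derivative of a parametrization. -/
noncomputable def tinv (n : ℕ) {M : Type*} [TopologicalSpace M] [ChartedSpace (Model n) M]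
    {E : Type*} [NormedAddCommGroup E] [NormedSpace ℝ E]
    (χ : OpenPartialHomeomorph E M) (z : E) : Model n →L[ℝ] E :=
  mfderiv 𝓘(ℝ, Model n) 𝓘(ℝ, E) χ.symm (χ z)

/-- The value of a field of endomorphisms as an endomorphism of the model space. -/
def EndField.at (J : EndField n M) (p : M) : Model n →L[ℝ] Model n := J p

/-- A field of endomorphisms in the coordinates of a parametrization. -/
noncomputable def jhat (J : EndField n M) (χ : OpenPartialHomeomorph E M) (z : E) : E →L[ℝ] E :=
  (tinv n χ z).comp ((J.at (χ z)).comp (tmap n χ z))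

/-- A two-form in the coordinates of a parametrization. -/
noncomputable def pb2 (α : DForm n M 2) (χ : OpenPartialHomeomorph E M) (z u v : E) : ℝ :=
  α (χ z) ![tmap n χ z u, tmap n χ z v]

variable {χ : OpenPartialHomeomorph E M}

theorem IsParam.mdifferentiableAt (hχ : IsParam n χ) {z : E} (hz : z ∈ χ.source) :
    MDifferentiableAt 𝓘(ℝ, E) 𝓘(ℝ, Model n) χ z :=
  (hχ.smooth.contMDiffAt (χ.open_source.mem_nhds hz)).mdifferentiableAt (by simp)

theorem IsParam.mdifferentiableAt_symm (hχ : IsParam n χ) {z : E} (hz : z ∈ χ.source) :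
    MDifferentiableAt 𝓘(ℝ, Model n) 𝓘(ℝ, E) χ.symm (χ z) :=
  (hχ.smooth_symm.contMDiffAt (χ.open_target.mem_nhds (χ.map_source hz))).mdifferentiableAt
    (by simp)

theorem IsParam.tinv_tmap (hχ : IsParam n χ) {z : E} (hz : z ∈ χ.source) (u : E) :
    tinv n χ z (tmap n χ z u) = u := by
  have h := mfderiv_comp z (hχ.mdifferentiableAt_symm hz) (hχ.mdifferentiableAt hz)
  have h2 : (χ.symm ∘ χ) =ᶠ[nhds z] id := by
    filter_upwards [χ.open_source.mem_nhds hz] with y hy using χ.left_inv hy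
  rw [h2.mfderiv_eq, mfderiv_id] at h
  exact (congrArg (fun L : E →L[ℝ] E => L u) h).symm

theorem IsParam.tmap_tinv (hχ : IsParam n χ) {z : E} (hz : z ∈ χ.source) (w : Model n) :
    tmap n χ z (tinv n χ z w) = w := by
  have hd : MDifferentiableAt 𝓘(ℝ, E) 𝓘(ℝ, Model n) χ (χ.symm (χ z)) := by
    rw [χ.left_inv hz]; exact hχ.mdifferentiableAt hz
  have h := mfderiv_comp (χ z) hd (hχ.mdifferentiableAt_symm hz)
  have h2 : (χ ∘ χ.symm) =ᶠ[nhds (χ z)] id := by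
    filter_upwards [χ.open_target.mem_nhds (χ.map_source hz)] with y hy using χ.right_inv hy
  rw [h2.mfderiv_eq, mfderiv_id, χ.left_inv hz] at h
  exact (congrArg (fun L : Model n →L[ℝ] Model n => L w) h).symm

theorem IsParam.jhat_tmap (hχ : IsParam n χ) (J : EndField n M) {z : E} (hz : z ∈ χ.source)
    (u : E) : tmap n χ z (jhat J χ z u) = J.at (χ z) (tmap n χ z u) := by
  simp only [jhat, ContinuousLinearMap.comp_apply, hχ.tmap_tinv hz]

/-- The derivative of a parametrization as a linear equivalence. -/
noncomputable def IsParam.tequiv (hχ : IsParam n χ) {z : E} (hz : z ∈ χ.source) :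
    E ≃ₗ[ℝ] Model n :=
  { (tmap n χ z).toLinearMap with
    invFun := tinv n χ z
    left_inv := hχ.tinv_tmap hz
    right_inv := hχ.tmap_tinv hz }

variable [IsManifold 𝓘(ℝ, Model n) ∞ M]

theorem isParam_chartAt_symm (q : M) : IsParam n (chartAt (Model n) q).symm :=
  ⟨by simpa using contMDiffOn_chart_symm, by simpa using contMDiffOn_chart⟩

/-- The transition to a chart of the manifold is smooth. -/
theorem IsParam.contDiffOn_transition (hχ : IsParam n χ) (q : M) :
    ContDiffOn ℝ ∞ (chartAt (Model n) q ∘ χ) (χ.source ∩ χ ⁻¹' (chartAt (Model n) q).source) := by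
  rw [← contMDiffOn_iff_contDiffOn]
  exact (contMDiffOn_chart (n := ∞) (I := 𝓘(ℝ, Model n))).comp
    (hχ.smooth.mono Set.inter_subset_left) Set.inter_subset_right

theorem isOpen_transition (χ : OpenPartialHomeomorph E M) (q : M) :
    IsOpen (χ.source ∩ χ ⁻¹' (chartAt (Model n) q).source) :=
  χ.isOpen_inter_preimage (chartAt (Model n) q).open_source

theorem IsParam.fderiv_transition (hχ : IsParam n χ) (q : M) {z : E} (hz : z ∈ χ.source)
    (hq : χ z ∈ (chartAt (Model n) q).source) :
    fderiv ℝ (chartAt (Model n) q ∘ χ) z =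
      (tinv n (chartAt (Model n) q).symm (chartAt (Model n) q (χ z))).comp (tmap n χ z) := by
  have hd : MDifferentiableAt 𝓘(ℝ, Model n) 𝓘(ℝ, Model n) (chartAt (Model n) q) (χ z) :=
    mdifferentiableAt_atlas (chart_mem_atlas _ q) hq
  have h := mfderiv_comp z hd (hχ.mdifferentiableAt hz)
  rw [mfderiv_eq_fderiv] at h
  rw [tinv, (chartAt (Model n) q).left_inv hq]
  exact h

theorem IsParam.tmap_eq (hχ : IsParam n χ) (q : M) {z : E} (hz : z ∈ χ.source)
    (hq : χ z ∈ (chartAt (Model n) q).source) (u : E) :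
    tmap n (chartAt (Model n) q).symm (chartAt (Model n) q (χ z))
      (fderiv ℝ (chartAt (Model n) q ∘ χ) z u) = tmap n χ z u := by
  rw [hχ.fderiv_transition q hz hq, ContinuousLinearMap.comp_apply,
    (isParam_chartAt_symm q).tmap_tinv]
  exact (chartAt (Model n) q).map_source hq

end Param

/-! ### Coordinate expressions of J, of two-forms and of d(J dψ) -/

section Pullback

theorem two_le_infty : (2 : WithTop ℕ∞) ≤ ∞ := by
  change ((2 : ℕ∞) : WithTop ℕ∞) ≤ _
  exact WithTop.coe_le_coe.2 le_top

/-- An alternating two-form as a bilinear form. -/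
noncomputable def bil (E : Type*) [NormedAddCommGroup E] [NormedSpace ℝ E] :
    (E [⋀^Fin 2]→L[ℝ] ℝ) →L[ℝ] E →L[ℝ] E →L[ℝ] ℝ :=
  (ContinuousLinearMap.compL ℝ E (E [⋀^Fin 1]→L[ℝ] ℝ) (E →L[ℝ] ℝ)
    ((ContinuousAlternatingMap.ofSubsingletonLIE (𝕜 := ℝ) (E := E) (F := ℝ)
      (0 : Fin 1)).symm.toContinuousLinearEquiv :
      (E [⋀^Fin 1]→L[ℝ] ℝ) →L[ℝ] E →L[ℝ] ℝ)).comp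
    (ContinuousAlternatingMap.curryLeftLI (𝕜 := ℝ) (E := E) (F := ℝ)
      (n := 1)).toContinuousLinearMap

theorem bil_apply {E : Type*} [NormedAddCommGroup E] [NormedSpace ℝ E] (β : E [⋀^Fin 2]→L[ℝ] ℝ)
    (u v : E) : bil E β u v = β ![u, v] := by
  have : (Matrix.vecCons u fun _ : Fin 1 => v) = ![u, v] := by
    ext i; fin_cases i <;> rfl
  rw [← this]
  rfl

theorem contDiff_bil (E : Type*) [NormedAddCommGroup E] [NormedSpace ℝ E] :
    ContDiff ℝ ∞ (bil E) := by
  fun_prop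

theorem contDiff_flip (E F : Type*) [NormedAddCommGroup E] [NormedSpace ℝ E]
    [NormedAddCommGroup F] [NormedSpace ℝ F] :
    ContDiff ℝ ∞ (fun f : E →L[ℝ] F →L[ℝ] ℝ => f.flip) :=
  ContinuousLinearMap.contDiff (𝕜 := ℝ) (E := E →L[ℝ] F →L[ℝ] ℝ) (F := F →L[ℝ] E →L[ℝ] ℝ)
    ((ContinuousLinearMap.flipₗᵢ ℝ E F ℝ).toContinuousLinearEquiv :
      (E →L[ℝ] F →L[ℝ] ℝ) →L[ℝ] F →L[ℝ] E →L[ℝ] ℝ)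

variable {n : ℕ} {M : Type*} [TopologicalSpace M] [ChartedSpace (Model n) M]
  {E : Type*} [NormedAddCommGroup E] [NormedSpace ℝ E] {χ : OpenPartialHomeomorph E M}
  [IsManifold 𝓘(ℝ, Model n) ∞ M]

theorem IsParam.tinv_eq (hχ : IsParam n χ) (q : M) {z : E} (hz : z ∈ χ.source)
    (hq : χ z ∈ (chartAt (Model n) q).source) :
    fderiv ℝ (χ.symm ∘ (chartAt (Model n) q).symm) (chartAt (Model n) q (χ z)) =
      (tinv n χ z).comp (tmap n (chartAt (Model n) q).symm (chartAt (Model n) q (χ z))) := by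
  have hx := (chartAt (Model n) q).map_source hq
  have h0 := (chartAt (Model n) q).left_inv hq
  have hd : MDifferentiableAt 𝓘(ℝ, Model n) 𝓘(ℝ, E) χ.symm
      ((chartAt (Model n) q).symm (chartAt (Model n) q (χ z))) := by
    rw [h0]; exact hχ.mdifferentiableAt_symm hz
  have h := mfderiv_comp (chartAt (Model n) q (χ z)) hd
    ((isParam_chartAt_symm q).mdifferentiableAt hx)
  rw [mfderiv_eq_fderiv] at h
  rw [h, h0]
  rfl

/-- Smoothness of J is given only in the preferred charts. Near each point the expression is the
chart expression conjugated by the derivative of the transition map, which is smooth. -/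
theorem contDiffOn_jhat {J : EndField n M} (hJ : J.IsSmooth) (hχ : IsParam n χ) :
    ContDiffOn ℝ ∞ (jhat J χ) χ.source := by
  intro z₀ hz₀
  set q := χ z₀ with hq
  set e := chartAt (Model n) q with he
  set S := χ.source ∩ χ ⁻¹' e.source with hS
  have hSo : IsOpen S := isOpen_transition χ q
  have hz₀S : z₀ ∈ S := ⟨hz₀, mem_chart_source (Model n) q⟩
  have hθ := hχ.contDiffOn_transition q
  have hκ : ContDiffOn ℝ ∞ (χ.symm ∘ e.symm) (e.target ∩ e.symm ⁻¹' χ.target) := by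
    rw [← contMDiffOn_iff_contDiffOn]
    exact hχ.smooth_symm.comp ((contMDiffOn_chart_symm (n := ∞) (I := 𝓘(ℝ, Model n))).mono
      Set.inter_subset_left) Set.inter_subset_right
  have hκo : IsOpen (e.target ∩ e.symm ⁻¹' χ.target) :=
    e.symm.isOpen_inter_preimage χ.open_target
  have hmaps : Set.MapsTo (e ∘ χ) S (e.target ∩ e.symm ⁻¹' χ.target) := fun z hz =>
    ⟨e.map_source hz.2, by
      simp only [Set.mem_preimage, Function.comp_apply, e.left_inv hz.2, χ.map_source hz.1]⟩
  have h1 : ContDiffOn ℝ ∞ (fun z => fderiv ℝ (χ.symm ∘ e.symm) ((e ∘ χ) z)) S :=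
    (hκ.fderiv_of_isOpen hκo (by simp)).comp hθ hmaps
  have h2 : ContDiffOn ℝ ∞ (fun z => J.inChart e ((e ∘ χ) z)) S :=
    (hJ q).comp hθ fun z hz => (hmaps hz).1
  have h3 : ContDiffOn ℝ ∞ (fderiv ℝ (e ∘ χ)) S := hθ.fderiv_of_isOpen hSo (by simp)
  refine ContDiffAt.contDiffWithinAt (((h1.clm_comp (h2.clm_comp h3)).congr
    fun z hz => ?_).contDiffAt (hSo.mem_nhds hz₀S))
  ext u
  have hx := e.map_source hz.2
  have hJe : ∀ w, J.inChart e (e (χ z)) w =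
      tinv n e.symm (e (χ z)) (J.at (χ z) (tmap n e.symm (e (χ z)) w)) := fun w => by
    rw [← e.left_inv hz.2, e.right_inv hx]
    rfl
  simp only [Function.comp_apply, ContinuousLinearMap.comp_apply]
  rw [hJe, hχ.tmap_eq q hz.1 hz.2, hχ.tinv_eq q hz.1 hz.2, ContinuousLinearMap.comp_apply,
    (isParam_chartAt_symm q).tmap_tinv hx]
  rfl

/-- The value of a form as a form on the model space. -/
def DForm.at {k : ℕ} (α : DForm n M k) (p : M) : Model n [⋀^Fin k]→L[ℝ] ℝ := α p

/-- The bilinear form of a two-form in the coordinates of a parametrization. -/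
noncomputable def bhat (α : DForm n M 2) (χ : OpenPartialHomeomorph E M) (z : E) :
    E →L[ℝ] E →L[ℝ] ℝ :=
  (((bil (Model n) (α.at (χ z))).comp (tmap n χ z)).flip.comp (tmap n χ z)).flip

theorem bhat_apply (α : DForm n M 2) (χ : OpenPartialHomeomorph E M) (z u v : E) :
    bhat α χ z u v = pb2 α χ z u v := by
  simp only [bhat, ContinuousLinearMap.flip_apply, ContinuousLinearMap.comp_apply]
  rw [bil_apply]
  rfl

theorem contDiffOn_bhat {Ω : DForm n M 2} (hΩ : Ω.IsSmooth) (hχ : IsParam n χ) :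
    ContDiffOn ℝ ∞ (bhat Ω χ) χ.source := by
  intro z₀ hz₀
  set q := χ z₀ with hq
  set e := chartAt (Model n) q with he
  set S := χ.source ∩ χ ⁻¹' e.source with hS
  have hSo : IsOpen S := isOpen_transition χ q
  have hz₀S : z₀ ∈ S := ⟨hz₀, mem_chart_source (Model n) q⟩
  have hθ := hχ.contDiffOn_transition q
  have h2 : ContDiffOn ℝ ∞ (fun z => bil (Model n) (Ω.inChart e ((e ∘ χ) z))) S :=
    (contDiff_bil (Model n)).comp_contDiffOn ((hΩ q).comp hθ fun z hz => e.map_source hz.2)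
  have h3 : ContDiffOn ℝ ∞ (fderiv ℝ (e ∘ χ)) S := hθ.fderiv_of_isOpen hSo (by simp)
  have hflip : ∀ {f : E → E →L[ℝ] Model n →L[ℝ] ℝ}, ContDiffOn ℝ ∞ f S →
      ContDiffOn ℝ ∞ (fun z => (f z).flip) S := fun hf =>
    (contDiff_flip E (Model n)).comp_contDiffOn hf
  have hflip' : ∀ {f : E → E →L[ℝ] E →L[ℝ] ℝ}, ContDiffOn ℝ ∞ f S →
      ContDiffOn ℝ ∞ (fun z => (f z).flip) S := fun hf =>
    (contDiff_flip E E).comp_contDiffOn hf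
  refine ContDiffAt.contDiffWithinAt (((hflip' ((hflip (h2.clm_comp h3)).clm_comp h3)).congr
    fun z hz => ?_).contDiffAt (hSo.mem_nhds hz₀S))
  ext u v
  rw [bhat_apply]
  simp only [ContinuousLinearMap.flip_apply, ContinuousLinearMap.comp_apply, bil_apply]
  rw [pb2, ← hχ.tmap_eq q hz.1 hz.2 u, ← hχ.tmap_eq q hz.1 hz.2 v]
  have : ∀ a b : Model n, Ω.inChart e (e (χ z)) ![a, b] =
      Ω (χ z) ![tmap n e.symm (e (χ z)) a, tmap n e.symm (e (χ z)) b] := fun a b => by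
    have hc : (⇑(tmap n e.symm (e (χ z))) ∘ ![a, b]) =
        ![tmap n e.symm (e (χ z)) a, tmap n e.symm (e (χ z)) b] := by
      ext i
      fin_cases i <;> rfl
    have h1 : Ω.inChart e (e (χ z)) ![a, b] =
        Ω.at (e.symm (e (χ z))) (⇑(tmap n e.symm (e (χ z))) ∘ ![a, b]) := rfl
    rw [h1, e.left_inv hz.2, hc]
    rfl
  rw [← this]
  rfl

/-- The one-form `J dψ` in the coordinates of a parametrization. -/
noncomputable def jdhat (J : EndField n M) (ψ : M → ℝ) (χ : OpenPartialHomeomorph E M) (z : E) :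
    E →L[ℝ] ℝ :=
  (fderiv ℝ (ψ ∘ χ) z).comp (jhat J χ z)

theorem IsParam.contDiffOn_comp (hχ : IsParam n χ) {ψ : M → ℝ} {k : ℕ∞}
    (hψ : ContMDiff 𝓘(ℝ, Model n) 𝓘(ℝ, ℝ) k ψ) : ContDiffOn ℝ k (ψ ∘ χ) χ.source := by
  rw [← contMDiffOn_iff_contDiffOn]
  exact hψ.comp_contMDiffOn (hχ.smooth.of_le (by exact_mod_cast le_top))

theorem contDiffOn_jdhat {J : EndField n M} (hJ : J.IsSmooth) (hχ : IsParam n χ) {ψ : M → ℝ}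
    (hψ : ContMDiff 𝓘(ℝ, Model n) 𝓘(ℝ, ℝ) 2 ψ) : ContDiffOn ℝ 1 (jdhat J ψ χ) χ.source := by
  have h2 : ContDiffOn ℝ 2 (ψ ∘ χ) χ.source := hχ.contDiffOn_comp (k := 2) hψ
  have h1 : ContDiffOn ℝ 1 (fderiv ℝ (ψ ∘ χ)) χ.source :=
    h2.fderiv_of_isOpen χ.open_source (by norm_num)
  exact h1.clm_comp ((contDiffOn_jhat hJ hχ).of_le (by exact_mod_cast le_top))

theorem Jd_tmap (J : EndField n M) (hχ : IsParam n χ) {ψ : M → ℝ}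
    (hψ : ContMDiff 𝓘(ℝ, Model n) 𝓘(ℝ, ℝ) 2 ψ) {z : E} (hz : z ∈ χ.source) :
    ((Jd J ψ).at (χ z)).compContinuousLinearMap (tmap n χ z) =
      ContinuousAlternatingMap.ofSubsingletonLIE (𝕜 := ℝ) (E := E) (F := ℝ) (0 : Fin 1)
        (jdhat J ψ χ z) := by
  ext v
  have h := mfderiv_comp z (hψ.mdifferentiableAt (by norm_num) (x := χ z))
    (hχ.mdifferentiableAt hz)
  rw [mfderiv_eq_fderiv] at h
  have h' : ∀ u, fderiv ℝ (ψ ∘ χ) z u =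
      (mfderiv 𝓘(ℝ, Model n) 𝓘(ℝ, ℝ) ψ (χ z) : Model n →L[ℝ] ℝ) (tmap n χ z u) := fun u =>
    congrArg (fun L : E →L[ℝ] ℝ => L u) h
  have h2 : jdhat J ψ χ z (v 0) = (mfderiv 𝓘(ℝ, Model n) 𝓘(ℝ, ℝ) ψ (χ z) : Model n →L[ℝ] ℝ)
      (J.at (χ z) (tmap n χ z (v 0))) := by
    rw [jdhat, ContinuousLinearMap.comp_apply, h', hχ.jhat_tmap J hz]
  exact h2.symm

/-- The exterior derivative of `J dψ` in the coordinates of a parametrization. -/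
theorem pb2_d_Jd {J : EndField n M} (hJ : J.IsSmooth) (hχ : IsParam n χ) {ψ : M → ℝ}
    (hψ : ContMDiff 𝓘(ℝ, Model n) 𝓘(ℝ, ℝ) 2 ψ) {z : E} (hz : z ∈ χ.source) (u v : E) :
    pb2 (Jd J ψ).d χ z u v =
      fderiv ℝ (jdhat J ψ χ) z u v - fderiv ℝ (jdhat J ψ χ) z v u := by
  set p := χ z with hp
  set e := chartAt (Model n) p with he
  set β := Jd J ψ with hβ
  have hpe : p ∈ e.source := mem_chart_source (Model n) p
  have hSo : IsOpen (χ.source ∩ χ ⁻¹' e.source) := isOpen_transition χ p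
  have hzS : z ∈ χ.source ∩ χ ⁻¹' e.source := ⟨hz, hpe⟩
  have hθ : ContDiffAt ℝ ∞ (e ∘ χ) z :=
    (hχ.contDiffOn_transition p).contDiffAt (hSo.mem_nhds hzS)
  have hin : ∀ x ∈ e.target, β.inChart e x =
      ContinuousAlternatingMap.ofSubsingletonLIE (𝕜 := ℝ) (E := Model n) (F := ℝ) (0 : Fin 1)
        (jdhat J ψ e.symm x) := fun x hx => Jd_tmap J (isParam_chartAt_symm p) hψ hx
  have hd : DifferentiableAt ℝ (β.inChart e) (e p) := by
    have h1 : DifferentiableAt ℝ (fun x =>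
        ContinuousAlternatingMap.ofSubsingletonLIE (𝕜 := ℝ) (E := Model n) (F := ℝ) (0 : Fin 1)
        (jdhat J ψ e.symm x)) (e p) := by
      have : DifferentiableAt ℝ (jdhat J ψ e.symm) (e p) :=
        ((contDiffOn_jdhat hJ (isParam_chartAt_symm p) hψ).contDiffAt
          (e.open_target.mem_nhds (e.map_source hpe))).differentiableAt (by norm_num)
      exact (LinearIsometryEquiv.differentiable _).differentiableAt.comp _ this
    refine h1.congr_of_eventuallyEq ?_
    filter_upwards [e.open_target.mem_nhds (e.map_source hpe)] with x hx using hin x hx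
  -- The exterior derivative at p is computed in the chart at p; naturality under the transition map
  -- transfers it to the coordinates of χ.
  have hpull := extDeriv_pullback (x := z) (f := e ∘ χ) hd hθ
    (by rw [minSmoothness_of_isRCLikeNormedField]; exact two_le_infty)
  have hev : (fun x => (β.inChart e ((e ∘ χ) x)).compContinuousLinearMap (fderiv ℝ (e ∘ χ) x))
      =ᶠ[nhds z] fun x => ContinuousAlternatingMap.ofSubsingletonLIE (𝕜 := ℝ) (E := E) (F := ℝ)
        (0 : Fin 1) (jdhat J ψ χ x) := by
    filter_upwards [hSo.mem_nhds hzS] with x hx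
    rw [← Jd_tmap J hχ hψ hx.1]
    ext w
    have h1 : ∀ a : Fin 1 → Model n, β.inChart e (e (χ x)) a =
        (Jd J ψ).at (χ x) (fun i => tmap n e.symm (e (χ x)) (a i)) := fun a => by
      rw [← e.left_inv hx.2, e.right_inv (e.map_source hx.2)]
      rfl
    simp only [Function.comp_apply, ContinuousAlternatingMap.compContinuousLinearMap_apply]
    rw [h1]
    refine congrArg _ ?_
    funext i
    exact hχ.tmap_eq p hx.1 hx.2 (w i)
  rw [hev.extDeriv_eq] at hpull
  have hdj : DifferentiableAt ℝ (jdhat J ψ χ) z :=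
    ((contDiffOn_jdhat hJ hχ hψ).contDiffAt (χ.open_source.mem_nhds hz)).differentiableAt
      (by norm_num)
  have hfd : fderiv ℝ (fun x => ContinuousAlternatingMap.ofSubsingletonLIE (𝕜 := ℝ) (E := E)
      (F := ℝ) (0 : Fin 1) (jdhat J ψ χ x)) z =
      ((ContinuousAlternatingMap.ofSubsingletonLIE (𝕜 := ℝ) (E := E)
      (F := ℝ) (0 : Fin 1)).toContinuousLinearEquiv : (E →L[ℝ] ℝ) →L[ℝ] _).comp
        (fderiv ℝ (jdhat J ψ χ) z) :=
    LinearIsometryEquiv.comp_fderiv _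
  have hL := congrArg (fun L : E [⋀^Fin 2]→L[ℝ] ℝ => L ![u, v]) hpull
  simp only [extDeriv, hfd, ContinuousAlternatingMap.alternatizeUncurryFin_apply] at hL
  have hR : pb2 β.d χ z u v = ((ContinuousAlternatingMap.alternatizeUncurryFin
      (fderiv ℝ (β.inChart e) ((e ∘ χ) z))).compContinuousLinearMap (fderiv ℝ (e ∘ χ) z))
      ![u, v] := by
    have hθ' := hχ.fderiv_transition p hz hpe
    rw [tinv, e.left_inv hpe] at hθ'
    rw [hθ']
    have : (⇑((mfderiv 𝓘(ℝ, Model n) 𝓘(ℝ, Model n) e p : Model n →L[ℝ] Model n).comp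
        (tmap n χ z)) ∘ ![u, v]) = ![(mfderiv 𝓘(ℝ, Model n) 𝓘(ℝ, Model n) e p :
        Model n →L[ℝ] Model n) (tmap n χ z u), (mfderiv 𝓘(ℝ, Model n) 𝓘(ℝ, Model n) e p :
        Model n →L[ℝ] Model n) (tmap n χ z v)] := by
      ext i
      fin_cases i <;> rfl
    have h2 : (⇑(mfderiv 𝓘(ℝ, Model n) 𝓘(ℝ, Model n) e p : Model n →L[ℝ] Model n) ∘
        ![tmap n χ z u, tmap n χ z v]) = ![(mfderiv 𝓘(ℝ, Model n) 𝓘(ℝ, Model n) e p :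
        Model n →L[ℝ] Model n) (tmap n χ z u), (mfderiv 𝓘(ℝ, Model n) 𝓘(ℝ, Model n) e p :
        Model n →L[ℝ] Model n) (tmap n χ z v)] := by
      ext i
      fin_cases i <;> rfl
    exact congrArg (extDeriv (β.inChart e) (e p)) (h2.trans this.symm)
  rw [hR, ← hL]
  simp [sub_eq_add_neg]
  rfl

end Pullback

/-! ### The forms Ω(φ), their linearity in φ, and openness of tameness -/

section Potential

theorem continuousOn_sub_of_normed {X G : Type*} [TopologicalSpace X] [NormedAddCommGroup G]
    {f g : X → G} {s : Set X} (hf : ContinuousOn f s) (hg : ContinuousOn g s) :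
    ContinuousOn (fun x => f x - g x) s := hf.sub hg

theorem continuousOn_add_of_normed {X G : Type*} [TopologicalSpace X] [NormedAddCommGroup G]
    {f g : X → G} {s : Set X} (hf : ContinuousOn f s) (hg : ContinuousOn g s) :
    ContinuousOn (fun x => f x + g x) s := hf.add hg

variable {n : ℕ} {M : Type*} [TopologicalSpace M] [ChartedSpace (Model n) M]
  {E : Type*} [NormedAddCommGroup E] [NormedSpace ℝ E] {χ : OpenPartialHomeomorph E M}

theorem form_add_left (α : DForm n M 2) (p : M) (X X' Y : Tan n p) :
    α p ![X + X', Y] = α p ![X, Y] + α p ![X', Y] :=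
  (α p).vecCons_add _ X X'

theorem form_smul_left (α : DForm n M 2) (p : M) (c : ℝ) (X Y : Tan n p) :
    α p ![c • X, Y] = c * α p ![X, Y] :=
  (α p).vecCons_smul _ c X

theorem form_swap (α : DForm n M 2) (p : M) (X Y : Tan n p) : α p ![X, Y] = - α p ![Y, X] := by
  have h : ∀ Z : Tan n p, α p ![Z, Z] = 0 := fun Z =>
    (α p).map_eq_zero_of_eq ![Z, Z] (i := 0) (j := 1) rfl (by simp)
  have hr : ∀ W Z Z' : Tan n p, α p ![W, Z + Z'] = α p ![W, Z] + α p ![W, Z'] := fun W Z Z' => by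
    have := (α p).map_update_add ![W, Z] 1 Z Z'
    have hu : ∀ T : Tan n p, Function.update ![W, Z] 1 T = ![W, T] := fun T => by
      ext i : 1
      fin_cases i <;> rfl
    rwa [hu, hu, hu] at this
  have := h (X + Y)
  rw [form_add_left, hr, hr, h, h] at this
  linarith

theorem form_smul_right (α : DForm n M 2) (p : M) (c : ℝ) (X Y : Tan n p) :
    α p ![X, c • Y] = c * α p ![X, Y] := by
  rw [form_swap, form_smul_left, form_swap α p Y X]; ring

theorem form_neg_right (α : DForm n M 2) (p : M) (X Y : Tan n p) :
    α p ![X, -Y] = - α p ![X, Y] := by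
  rw [← neg_one_smul ℝ Y, form_smul_right]; ring

theorem form_neg_left (α : DForm n M 2) (p : M) (X Y : Tan n p) :
    α p ![-X, Y] = - α p ![X, Y] := by
  rw [← neg_one_smul ℝ X, form_smul_left]; ring

theorem form_self (α : DForm n M 2) (p : M) (X : Tan n p) : α p ![X, X] = 0 := by
  have := form_swap α p X X; linarith

theorem P11_self {J : EndField n M} (hJ2 : ∀ (p : M) (v : Tan n p), J p (J p v) = -v)
    (α : DForm n M 2) (p : M) (v : Tan n p) : P11 J α p v (J p v) = α p ![v, J p v] := by
  rw [P11, hJ2, form_neg_right, form_swap α p (J p v) v]; ring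

theorem h_self {J : EndField n M} (hJ2 : ∀ (p : M) (v : Tan n p), J p (J p v) = -v)
    (Ω : DForm n M 2) (φ : M → ℝ) (p : M) (v : Tan n p) :
    h J Ω φ p v v = pot J Ω φ p ![v, J p v] := by
  rw [h, H, P11_self hJ2]; ring

/-- The J-anti-invariant part of a two-form vanishes on (v, Jv), so h(φ)(v, v) sees the whole form
Ω(φ). -/
theorem hPos_iff_tames {J : EndField n M} (hJ2 : ∀ (p : M) (v : Tan n p), J p (J p v) = -v)
    (Ω : DForm n M 2) (φ : M → ℝ) : HPos J Ω φ ↔ Tames J (pot J Ω φ) := by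
  simp only [HPos, Tames, h_self hJ2]

variable [IsManifold 𝓘(ℝ, Model n) ∞ M]

theorem IsParam.form_eq_pb2 (hχ : IsParam n χ) (α : DForm n M 2) {z : E} (hz : z ∈ χ.source)
    (X Y : Tan n (χ z)) : α (χ z) ![X, Y] = pb2 α χ z (tinv n χ z X) (tinv n χ z Y) := by
  have h : ∀ W : Tan n (χ z), tmap n χ z (tinv n χ z W) = W := hχ.tmap_tinv hz
  exact congrArg₂ (fun A B : Tan n (χ z) => α (χ z) ![A, B]) (h X).symm (h Y).symm

theorem form_ext {p : M} {α β : Tan n p [⋀^Fin 2]→L[ℝ] ℝ}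
    (h : ∀ X Y, α ![X, Y] = β ![X, Y]) : α = β := by
  ext v
  have : v = ![v 0, v 1] := by
    ext i : 1
    fin_cases i <;> rfl
  rw [this]
  exact h _ _

/-- The two-form `d (J dψ)` in the coordinates of a parametrization. -/
noncomputable def dhat (J : EndField n M) (ψ : M → ℝ) (χ : OpenPartialHomeomorph E M) (z : E) :
    E →L[ℝ] E →L[ℝ] ℝ :=
  fderiv ℝ (jdhat J ψ χ) z - (fderiv ℝ (jdhat J ψ χ) z).flip

variable {J : EndField n M} (hJ : J.IsSmooth)
include hJ

theorem pb2_d_Jd_eq_dhat (hχ : IsParam n χ) {ψ : M → ℝ}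
    (hψ : ContMDiff 𝓘(ℝ, Model n) 𝓘(ℝ, ℝ) 2 ψ) {z : E} (hz : z ∈ χ.source) (u v : E) :
    pb2 (Jd J ψ).d χ z u v = dhat J ψ χ z u v :=
  pb2_d_Jd hJ hχ hψ hz u v

theorem continuousOn_dhat (hχ : IsParam n χ) {ψ : M → ℝ}
    (hψ : ContMDiff 𝓘(ℝ, Model n) 𝓘(ℝ, ℝ) 2 ψ) : ContinuousOn (dhat J ψ χ) χ.source := by
  have h1 : ContinuousOn (fderiv ℝ (jdhat J ψ χ)) χ.source :=
    (contDiffOn_jdhat hJ hχ hψ).continuousOn_fderiv_of_isOpen χ.open_source le_rfl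
  exact continuousOn_sub_of_normed (G := E →L[ℝ] E →L[ℝ] ℝ) h1
    ((contDiff_flip E E).continuous.comp_continuousOn h1)

theorem dhat_add_smul (hχ : IsParam n χ) {φ ψ : M → ℝ}
    (hφ : ContMDiff 𝓘(ℝ, Model n) 𝓘(ℝ, ℝ) 2 φ) (hψ : ContMDiff 𝓘(ℝ, Model n) 𝓘(ℝ, ℝ) 2 ψ)
    (s : ℝ) {z : E} (hz : z ∈ χ.source) :
    dhat J (fun p => φ p + s * ψ p) χ z = dhat J φ χ z + s • dhat J ψ χ z := by
  have hnhds := χ.open_source.mem_nhds hz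
  have hdφ := (hχ.contDiffOn_comp (k := 2) hφ).differentiableOn (by norm_num)
  have hdψ := (hχ.contDiffOn_comp (k := 2) hψ).differentiableOn (by norm_num)
  have hev : jdhat J (fun p => φ p + s * ψ p) χ =ᶠ[nhds z]
      jdhat J φ χ + s • jdhat J ψ χ := by
    filter_upwards [hnhds] with y hy
    have hy' := χ.open_source.mem_nhds hy
    have : fderiv ℝ ((fun p => φ p + s * ψ p) ∘ χ) y =
        fderiv ℝ (φ ∘ χ) y + s • fderiv ℝ (ψ ∘ χ) y := by
      have h1 := ((hdφ.differentiableAt hy').hasFDerivAt.add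
        ((hdψ.differentiableAt hy').hasFDerivAt.const_smul s)).fderiv
      exact h1
    ext u
    simp [jdhat, this]
  have h1 := ((contDiffOn_jdhat hJ hχ hφ).differentiableOn (by norm_num)).differentiableAt hnhds
  have h2 := ((contDiffOn_jdhat hJ hχ hψ).differentiableOn (by norm_num)).differentiableAt hnhds
  have hfd : fderiv ℝ (jdhat J (fun p => φ p + s * ψ p) χ) z =
      fderiv ℝ (jdhat J φ χ) z + s • fderiv ℝ (jdhat J ψ χ) z := by
    rw [hev.fderiv_eq]
    exact (h1.hasFDerivAt.add (h2.hasFDerivAt.const_smul s)).fderiv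
  ext u v
  simp [dhat, hfd]
  ring

theorem d_Jd_add_smul {φ ψ : M → ℝ}
    (hφ : ContMDiff 𝓘(ℝ, Model n) 𝓘(ℝ, ℝ) 2 φ) (hψ : ContMDiff 𝓘(ℝ, Model n) 𝓘(ℝ, ℝ) 2 ψ)
    (s : ℝ) (p : M) :
    (Jd J (fun p => φ p + s * ψ p)).d p = (Jd J φ).d p + s • (Jd J ψ).d p := by
  refine form_ext fun X Y => ?_
  set e := chartAt (Model n) p
  have hp : e p ∈ e.symm.source := e.map_source (mem_chart_source _ p)
  have hpe : e.symm (e p) = p := e.left_inv (mem_chart_source _ p)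
  have hχ := isParam_chartAt_symm (n := n) p
  have hC : ContMDiff 𝓘(ℝ, Model n) 𝓘(ℝ, ℝ) 2 (fun p => φ p + s * ψ p) :=
    hφ.add (contMDiff_const.mul hψ)
  have key : ∀ X Y : Tan n (e.symm (e p)), (Jd J (fun p => φ p + s * ψ p)).d (e.symm (e p)) ![X, Y]
      = ((Jd J φ).d (e.symm (e p)) + s • (Jd J ψ).d (e.symm (e p))) ![X, Y] := by
    intro X Y
    rw [ContinuousAlternatingMap.add_apply, ContinuousAlternatingMap.smul_apply,
      hχ.form_eq_pb2 _ hp, hχ.form_eq_pb2 _ hp, hχ.form_eq_pb2 _ hp,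
      pb2_d_Jd_eq_dhat hJ hχ hC hp, pb2_d_Jd_eq_dhat hJ hχ hφ hp, pb2_d_Jd_eq_dhat hJ hχ hψ hp,
      dhat_add_smul hJ hχ hφ hψ s hp]
    rfl
  rw [hpe] at key
  exact key X Y

theorem pot_add_smul (Ω : DForm n M 2) {φ ψ : M → ℝ}
    (hφ : ContMDiff 𝓘(ℝ, Model n) 𝓘(ℝ, ℝ) 2 φ) (hψ : ContMDiff 𝓘(ℝ, Model n) 𝓘(ℝ, ℝ) 2 ψ)
    (s : ℝ) (p : M) :
    pot J Ω (fun p => φ p + s * ψ p) p = pot J Ω φ p + s • (Jd J ψ).d p := by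
  rw [pot, d_Jd_add_smul hJ hφ hψ, pot, add_assoc]

theorem pot_const (Ω : DForm n M 2) (c : ℝ) (p : M) : pot J Ω (fun _ => c) p = Ω p := by
  have h0 : ContMDiff 𝓘(ℝ, Model n) 𝓘(ℝ, ℝ) 2 (fun _ : M => (c : ℝ)) := contMDiff_const
  -- Linearity with s = -1 expresses d(J d0) as a difference of two equal forms; since J dc = J d0,
  -- it also gives the vanishing for c.
  have := d_Jd_add_smul hJ h0 h0 (-1) p
  have hc : Jd J (fun _ : M => c) = Jd J (fun _ : M => (0 : ℝ)) := by
    funext q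
    simp only [Jd, mfderiv_const]
    rfl
  have h2 : (fun _ : M => c + -1 * c) = fun _ : M => (0 : ℝ) := by funext; ring
  rw [h2, ← hc] at this
  have h3 : (Jd J fun _ : M => c).d p = 0 := by
    rw [this]
    refine form_ext fun X Y => ?_
    change (Jd J fun _ : M => c).d p ![X, Y] + (-1 : ℝ) * (Jd J fun _ : M => c).d p ![X, Y] = 0
    ring
  rw [pot, h3, add_zero]

/-- The amplitude is defined relative to the form Ω(φ); this rewrites it along the line φ + sψ. No
regularity of the base form is needed. -/
theorem pot_pot (Ω : DForm n M 2) {φ ψ : M → ℝ}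
    (hφ : ContMDiff 𝓘(ℝ, Model n) 𝓘(ℝ, ℝ) 2 φ) (hψ : ContMDiff 𝓘(ℝ, Model n) 𝓘(ℝ, ℝ) 2 ψ)
    (s : ℝ) (p : M) :
    pot J (pot J Ω φ) (fun p => s * ψ p) p = pot J Ω (fun p => φ p + s * ψ p) p := by
  have h0 : ContMDiff 𝓘(ℝ, Model n) 𝓘(ℝ, ℝ) 2 (fun _ : M => (0 : ℝ)) := contMDiff_const
  have h1 := pot_add_smul hJ (pot J Ω φ) h0 hψ s p
  rw [pot_const hJ] at h1
  simp only [zero_add] at h1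
  rw [h1, pot_add_smul hJ Ω hφ hψ]

/-- The two-form `Ω(φ)` in the coordinates of a parametrization. -/
noncomputable def ahat (J : EndField n M) (Ω : DForm n M 2) (φ : M → ℝ)
    (χ : OpenPartialHomeomorph E M) (z : E) : E →L[ℝ] E →L[ℝ] ℝ :=
  bhat Ω χ z + dhat J φ χ z

theorem pb2_pot (Ω : DForm n M 2) (hχ : IsParam n χ) {φ : M → ℝ}
    (hφ : ContMDiff 𝓘(ℝ, Model n) 𝓘(ℝ, ℝ) 2 φ) {z : E} (hz : z ∈ χ.source) (u v : E) :
    pb2 (pot J Ω φ) χ z u v = ahat J Ω φ χ z u v := by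
  rw [ahat, add_apply, add_apply, bhat_apply,
    ← pb2_d_Jd_eq_dhat hJ hχ hφ hz]
  rfl

theorem continuousOn_ahat {Ω : DForm n M 2} (hΩ : Ω.IsSmooth) (hχ : IsParam n χ) {φ : M → ℝ}
    (hφ : ContMDiff 𝓘(ℝ, Model n) 𝓘(ℝ, ℝ) 2 φ) : ContinuousOn (ahat J Ω φ χ) χ.source :=
  continuousOn_add_of_normed (G := E →L[ℝ] E →L[ℝ] ℝ) (contDiffOn_bhat hΩ hχ).continuousOn
    (continuousOn_dhat hJ hχ hφ)

/-- Both sides are homogeneous of degree two in v, which reduces taming to a compact set of vectors.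
-/
theorem tames_at_of_sphere (α : DForm n M 2) (hχ : IsParam n χ) {z : E} (hz : z ∈ χ.source)
    (h : ∀ u ∈ Metric.sphere (0 : E) 1, 0 < pb2 α χ z u (jhat J χ z u)) (v : Tan n (χ z))
    (hv : v ≠ 0) : 0 < α (χ z) ![v, J (χ z) v] := by
  set u : E := tinv n χ z v with hu
  have htu : tmap n χ z u = v := hχ.tmap_tinv hz v
  have hu0 : u ≠ 0 := fun h0 => hv (by rw [← htu, h0, map_zero]; rfl)
  have hn : 0 < ‖u‖ := norm_pos_iff.2 hu0
  have h1 := h (‖u‖⁻¹ • u) (by simp [norm_smul, hn.ne'])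
  have h2 : pb2 α χ z (‖u‖⁻¹ • u) (jhat J χ z (‖u‖⁻¹ • u)) =
      ‖u‖⁻¹ * (‖u‖⁻¹ * α (χ z) ![v, J (χ z) v]) := by
    rw [← bhat_apply]
    simp only [map_smul, smul_apply, smul_eq_mul]
    rw [bhat_apply, pb2, hχ.jhat_tmap J hz, htu]
    rfl
  rw [h2] at h1
  have := inv_pos.2 hn
  exact (mul_pos_iff_of_pos_left this).1 ((mul_pos_iff_of_pos_left this).1 h1)

/-- Tameness is an open condition on a closed manifold. -/
theorem eventually_tames [CompactSpace M] {Ω : DForm n M 2} (hΩ : Ω.IsSmooth) {φ ψ : M → ℝ}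
    (hφ : ContMDiff 𝓘(ℝ, Model n) 𝓘(ℝ, ℝ) 2 φ) (hψ : ContMDiff 𝓘(ℝ, Model n) 𝓘(ℝ, ℝ) 2 ψ)
    (hpos : Tames J (pot J Ω φ)) :
    ∀ᶠ s in nhds (0 : ℝ), Tames J (pot J Ω (fun p => φ p + s * ψ p)) := by
  have hmain : ∀ᶠ s in nhds (0 : ℝ), ∀ p ∈ (Set.univ : Set M), ∀ v : Tan n p, v ≠ 0 →
      0 < pot J Ω (fun p => φ p + s * ψ p) p ![v, J p v] := by
    -- Compactness of M, and then of the unit sphere in a chart, reduces uniformity in s to joint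
    -- continuity at one triple (0, q, u).
    refine isCompact_univ.eventually_forall_of_forall_eventually fun q _ => ?_
    set e := chartAt (Model n) q with he
    have hχ : IsParam n e.symm := isParam_chartAt_symm q
    have hqe := mem_chart_source (Model n) q
    have hx₀ : e q ∈ e.symm.source := e.map_source hqe
    have hloc : ∀ᶠ y : ℝ × Model n in nhds (0, e q), ∀ u ∈ Metric.sphere (0 : Model n) 1,
        0 < ahat J Ω φ e.symm y.2 u (jhat J e.symm y.2 u) +
          y.1 * dhat J ψ e.symm y.2 u (jhat J e.symm y.2 u) := by
      refine (isCompact_sphere (0 : Model n) 1).eventually_forall_of_forall_eventually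
        fun u hu => ?_
      have hn := e.symm.open_source.mem_nhds hx₀
      have c1 := (continuousOn_ahat hJ hΩ hχ hφ).continuousAt hn
      have c2 := (continuousOn_dhat hJ hχ hψ).continuousAt hn
      have c3 := (contDiffOn_jhat hJ hχ).continuousOn.continuousAt hn
      have hcont : ContinuousAt (fun y : (ℝ × Model n) × Model n =>
          ahat J Ω φ e.symm y.1.2 y.2 (jhat J e.symm y.1.2 y.2) +
            y.1.1 * dhat J ψ e.symm y.1.2 y.2 (jhat J e.symm y.1.2 y.2)) ((0, e q), u) := by
        have hproj : ContinuousAt (fun y : (ℝ × Model n) × Model n => y.1.2) ((0, e q), u) := by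
          fun_prop
        have d1 : ContinuousAt (fun y : (ℝ × Model n) × Model n => ahat J Ω φ e.symm y.1.2)
          ((0, e q), u) := 
            Filter.Tendsto.comp (f := fun y : (ℝ × Model n) × Model n => y.1.2) c1 hproj
        have d2 : ContinuousAt (fun y : (ℝ × Model n) × Model n => dhat J ψ e.symm y.1.2)
          ((0, e q), u) := 
            Filter.Tendsto.comp (f := fun y : (ℝ × Model n) × Model n => y.1.2) c2 hproj
        have d3 : ContinuousAt (fun y : (ℝ × Model n) × Model n => jhat J e.symm y.1.2)
          ((0, e q), u) := 
            Filter.Tendsto.comp (f := fun y : (ℝ × Model n) × Model n => y.1.2) c3 hproj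
        fun_prop
      refine hcont.eventually (lt_mem_nhds ?_)
      simp only [zero_mul, add_zero]
      rw [← pb2_pot hJ Ω hχ hφ hx₀, pb2, hχ.jhat_tmap J hx₀]
      refine hpos _ _ fun h0 => ?_
      have : u = 0 := by
        rw [← hχ.tinv_tmap hx₀ u]
        exact (congrArg (tinv n e.symm (e q)) h0).trans (map_zero _)
      rw [this] at hu
      simp at hu
    have hpush : ∀ᶠ y : ℝ × M in nhds (0, q), ∀ u ∈ Metric.sphere (0 : Model n) 1,
        0 < ahat J Ω φ e.symm (e y.2) u (jhat J e.symm (e y.2) u) +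
          y.1 * dhat J ψ e.symm (e y.2) u (jhat J e.symm (e y.2) u) := by
      have ht : Filter.Tendsto (fun y : ℝ × M => (y.1, e y.2)) (nhds (0, q)) (nhds (0, e q)) :=
        continuousAt_fst.prodMk
          (ContinuousAt.comp (f := fun y : ℝ × M => y.2) (e.continuousAt hqe) continuousAt_snd)
      exact ht.eventually hloc
    have hsrc : ∀ᶠ y : ℝ × M in nhds (0, q), y.2 ∈ e.source :=
      continuousAt_snd.eventually (e.open_source.mem_nhds hqe)
    filter_upwards [hpush, hsrc] with y hy hys
    have hz : e y.2 ∈ e.symm.source := e.map_source hys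
    have hC : ContMDiff 𝓘(ℝ, Model n) 𝓘(ℝ, ℝ) 2 (fun p => φ p + y.1 * ψ p) :=
      hφ.add (contMDiff_const.mul hψ)
    have := tames_at_of_sphere hJ (pot J Ω (fun p => φ p + y.1 * ψ p)) hχ hz fun u hu => by
      rw [pb2_pot hJ Ω hχ hC hz, ahat, dhat_add_smul hJ hχ hφ hψ _ hz]
      have := hy u hu
      simp only [ahat, add_apply, smul_apply, smul_eq_mul] at this ⊢
      linarith
    rw [e.left_inv hys] at this
    exact this
  exact hmain.mono fun s hs p => hs p trivial

end Potential

/-! ### The positivity amplitude -/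

section Amplitude

variable {n : ℕ} {M : Type*} [TopologicalSpace M] [ChartedSpace (Model n) M]
  {E : Type*} [NormedAddCommGroup E] [NormedSpace ℝ E] {χ : OpenPartialHomeomorph E M}
  [IsManifold 𝓘(ℝ, Model n) ∞ M]

/-- The coordinate expression of `d (J dψ)` in terms of the derivatives of `ψ` and `J`. -/
theorem dhat_apply {J : EndField n M} (hJ : J.IsSmooth) (hχ : IsParam n χ) {ψ : M → ℝ}
    (hψ : ContMDiff 𝓘(ℝ, Model n) 𝓘(ℝ, ℝ) 2 ψ) {z : E} (hz : z ∈ χ.source) (u v : E) :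
    dhat J ψ χ z u v =
      fderiv ℝ (fderiv ℝ (ψ ∘ χ)) z u (jhat J χ z v)
        - fderiv ℝ (fderiv ℝ (ψ ∘ χ)) z v (jhat J χ z u)
        + fderiv ℝ (ψ ∘ χ) z (fderiv ℝ (jhat J χ) z u v - fderiv ℝ (jhat J χ) z v u) := by
  have hn := χ.open_source.mem_nhds hz
  have h1 : DifferentiableAt ℝ (fderiv ℝ (ψ ∘ χ)) z :=
    (((hχ.contDiffOn_comp (k := 2) hψ).fderiv_of_isOpen χ.open_source (m := 1)
      (by norm_num)).contDiffAt hn).differentiableAt (by norm_num)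
  have h2 : DifferentiableAt ℝ (jhat J χ) z :=
    ((contDiffOn_jhat hJ hχ).contDiffAt hn).differentiableAt (by simp)
  have h3 := (h1.hasFDerivAt.clm_comp h2.hasFDerivAt).fderiv
  have h4 : fderiv ℝ (jdhat J ψ χ) z = _ := h3
  simp only [dhat, h4]
  simp
  ring

/-- The basic properties of the positivity amplitude. -/
theorem amplitude_spec [CompactSpace M] {J : EndField n M} (hJ : J.IsSmooth)
    (hJ2 : ∀ (p : M) (v : Tan n p), J p (J p v) = -v) {Ω : DForm n M 2} (hΩ : Ω.IsSmooth)
    {φ ψ : M → ℝ} (hφ : ContMDiff 𝓘(ℝ, Model n) 𝓘(ℝ, ℝ) 2 φ)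
    (hψ : ContMDiff 𝓘(ℝ, Model n) 𝓘(ℝ, ℝ) 2 ψ) (hpos : Tames J (pot J Ω φ))
    (hone : ¬ Tames J (pot J Ω (fun p => φ p + 1 * ψ p))) :
    0 < amplitude J (pot J Ω φ) ψ ∧ amplitude J (pot J Ω φ) ψ ≤ 1 ∧
    (∀ s, 0 ≤ s → s < amplitude J (pot J Ω φ) ψ → Tames J (pot J Ω (fun p => φ p + s * ψ p))) ∧
    ¬ Tames J (pot J Ω (fun p => φ p + amplitude J (pot J Ω φ) ψ * ψ p)) ∧
    ∀ (p : M) (v : Tan n p),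
      0 ≤ pot J Ω (fun p => φ p + amplitude J (pot J Ω φ) ψ * ψ p) p ![v, J p v] := by
  have hmem : ∀ s, HPos J (pot J Ω φ) (fun p => s * ψ p) ↔
      Tames J (pot J Ω (fun p => φ p + s * ψ p)) := fun s => by
    rw [hPos_iff_tames hJ2]
    simp only [Tames, pot_pot hJ Ω hφ hψ]
  have hval : ∀ s (p : M) (v : Tan n p), pot J Ω (fun p => φ p + s * ψ p) p ![v, J p v] =
      pot J Ω φ p ![v, J p v] + s * (Jd J ψ).d p ![v, J p v] := fun s p v => by
    rw [pot_add_smul hJ Ω hφ hψ]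
    rfl
  -- The value at (v, Jv) is affine in s and positive at 0, so the good parameters form an interval
  -- starting at 0.
  have hmono : ∀ s s', 0 ≤ s' → s' ≤ s → Tames J (pot J Ω (fun p => φ p + s * ψ p)) →
      Tames J (pot J Ω (fun p => φ p + s' * ψ p)) := by
    intro s s' h0 hs' hs p v hv
    have h1 := hs p v hv
    have h2 := hpos p v hv
    rw [hval] at h1 ⊢
    rcases le_or_gt 0 ((Jd J ψ).d p ![v, J p v]) with hd | hd
    · have := mul_nonneg h0 hd; linarith
    · have := mul_le_mul_of_nonpos_right hs' hd.le; linarith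
  set S := {s : ℝ | 0 < s ∧ HPos J (pot J Ω φ) (fun p => s * ψ p)} with hS
  have hlt : ∀ s ∈ S, s < 1 := fun s hs => by
    by_contra h
    exact hone (hmono s 1 zero_le_one (not_lt.1 h) ((hmem s).1 hs.2))
  -- Boundedness here, and nonemptiness below from openness of tameness at s = 0, make the supremum
  -- genuine rather than a default value.
  have hbdd : BddAbove S := ⟨1, fun s hs => (hlt s hs).le⟩
  have hpush : ∀ φ' : M → ℝ, ContMDiff 𝓘(ℝ, Model n) 𝓘(ℝ, ℝ) 2 φ' → Tames J (pot J Ω φ') →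
      ∃ s > 0, Tames J (pot J Ω (fun p => φ' p + s * ψ p)) := by
    intro φ' hφ' hp
    have h1 := eventually_tames hJ hΩ hφ' hψ hp
    have h2 : ∀ᶠ s in nhdsWithin (0 : ℝ) (Set.Ioi 0), 0 < s := self_mem_nhdsWithin
    obtain ⟨s, hs1, hs2⟩ := ((h1.filter_mono nhdsWithin_le_nhds).and h2).exists
    exact ⟨s, hs2, hs1⟩
  obtain ⟨s₀, hs₀, hts₀⟩ := hpush φ hφ hpos
  have hs₀S : s₀ ∈ S := ⟨hs₀, (hmem s₀).2 hts₀⟩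
  have ha : amplitude J (pot J Ω φ) ψ = sSup S := rfl
  rw [ha]
  have hbelow : ∀ s, 0 ≤ s → s < sSup S → Tames J (pot J Ω (fun p => φ p + s * ψ p)) := by
    intro s h0 hs
    obtain ⟨s', hs', hss'⟩ := exists_lt_of_lt_csSup ⟨s₀, hs₀S⟩ hs
    exact hmono s' s h0 hss'.le ((hmem s').1 hs'.2)
  have hapos : 0 < sSup S := hs₀.trans_le (le_csSup hbdd hs₀S)
  refine ⟨hapos, csSup_le ⟨s₀, hs₀S⟩ fun s hs => (hlt s hs).le, hbelow, fun hta => ?_,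
    fun p v => ?_⟩
  -- If the form tamed J at the supremum, openness would allow a slightly larger parameter.
  · have hC : ContMDiff 𝓘(ℝ, Model n) 𝓘(ℝ, ℝ) 2 (fun p => φ p + sSup S * ψ p) :=
      hφ.add (contMDiff_const.mul hψ)
    obtain ⟨s, hs, hts⟩ := hpush _ hC hta
    have : s + sSup S ∈ S := by
      refine ⟨by positivity, (hmem _).2 ?_⟩
      have he : (fun p => φ p + (s + sSup S) * ψ p) =
          fun p => φ p + sSup S * ψ p + s * ψ p := by funext p; ring
      rw [he]
      exact hts
    have := le_csSup hbdd this
    linarith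
  · by_cases hv : v = 0
    · subst hv
      rw [map_zero, form_self]
    have hcont : Continuous fun s : ℝ =>
        pot J Ω φ p ![v, J p v] + s * (Jd J ψ).d p ![v, J p v] := by fun_prop
    have htend := (hcont.tendsto (sSup S)).mono_left (nhdsWithin_le_nhds (s := Set.Iio (sSup S)))
    rw [hval]
    refine ge_of_tendsto htend ?_
    filter_upwards [Ioo_mem_nhdsLT hapos] with s hs
    rw [← hval]
    exact (hbelow s hs.1.le hs.2 p v hv).le

end Amplitude

/-! ### The bump ψ_R and its smoothness -/

section CutOff

variable {n : ℕ} {M : Type*} [TopologicalSpace M] [ChartedSpace (Model n) M]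
  [IsManifold 𝓘(ℝ, Model n) ∞ M] {K : AKStructure n M} {hn : 2 ≤ n} {k : ℕ∞}

theorem Data.isParam (D : Data K hn k) : IsParam n D.χ := ⟨D.smooth_χ, D.smooth_χ_symm⟩

theorem isCompact_polydisk (n : ℕ) (r : ℝ) : IsCompact (polydisk n r) := by
  have : polydisk n r = Set.univ.pi fun _ => Metric.closedBall (0 : ℂ) r := by
    ext z
    simp [polydisk]
  rw [this]
  exact isCompact_univ_pi fun _ => isCompact_closedBall 0 r

theorem polydisk_mono {n : ℕ} {r r' : ℝ} (h : r ≤ r') : polydisk n r ⊆ polydisk n r' :=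
  fun _ hz i => (hz i).trans h

/-- The norm is not differentiable at 0, but η is identically 1 near there. -/
theorem Data.contDiff_eta_norm (D : Data K hn k) {c : ℝ} (hc : 0 < c) :
    ContDiff ℝ k fun w : ℂ => D.η (c * ‖w‖) := by
  rw [contDiff_iff_contDiffAt]
  intro w
  by_cases hw : w = 0
  · subst hw
    have : (fun w : ℂ => D.η (c * ‖w‖)) =ᶠ[nhds 0] fun _ => 1 := by
      filter_upwards [Metric.ball_mem_nhds (0 : ℂ) (show 0 < 1 / (2 * c) by positivity)] with w hw
      refine D.η_one _ ?_
      rw [mem_ball_zero_iff, lt_div_iff₀ (by positivity)] at hw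
      linarith
    exact contDiffAt_const.congr_of_eventuallyEq this
  · exact D.contDiff_η.contDiffAt.comp w (contDiffAt_const.mul (contDiffAt_norm ℝ hw))

/-- The radial profile `(l / 2) |w|² η(|w|)`. -/
noncomputable def Data.profile (D : Data K hn k) (l : ℝ) (w : ℂ) : ℝ :=
  l / 2 * ‖w‖ ^ 2 * D.η ‖w‖

theorem Data.contDiff_profile (D : Data K hn k) (l : ℝ) : ContDiff ℝ k (D.profile l) := by
  have h := D.contDiff_eta_norm one_pos
  simp only [one_mul] at h
  exact (contDiff_const.mul (contDiff_norm_sq ℝ)).mul h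

/-- The cut-off function `∏ η(|z_i|)`. -/
noncomputable def Data.cutoff (D : Data K hn k) (z : Fin n → ℂ) : ℝ := ∏ i, D.η ‖z i‖

theorem Data.contDiff_cutoff (D : Data K hn k) : ContDiff ℝ k D.cutoff := by
  have h := D.contDiff_eta_norm one_pos
  simp only [one_mul] at h
  exact contDiff_prod fun i _ => h.comp (contDiff_apply ℝ ℂ i)

/-- `Φ` at scale one. -/
noncomputable def Data.phiOne (D : Data K hn k) (z : Fin n → ℂ) : ℝ :=
  D.profile (D.lam ⟨0, by omega⟩) (z ⟨0, by omega⟩) +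
    D.profile (D.lam ⟨1, by omega⟩) (z ⟨1, by omega⟩)

theorem Data.contDiff_phiOne (D : Data K hn k) : ContDiff ℝ k D.phiOne :=
  ((D.contDiff_profile _).comp (contDiff_apply ℝ ℂ _)).add
    ((D.contDiff_profile _).comp (contDiff_apply ℝ ℂ _))

/-- The function `ψ_R` in coordinates. -/
noncomputable def Data.psiFlat (D : Data K hn k) (R : ℝ) (z : Fin n → ℂ) : ℝ :=
  (R ^ 4)⁻¹ * (D.phiOne (R ^ 2 • z) * D.cutoff (R • z))

/-- The quadratic factor |R² z_i|² releases R⁴, so ψ_R is built from rescalings of two functions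
that do not depend on R. All estimates rest on this form. -/
theorem Data.psiFlat_eq (D : Data K hn k) {R : ℝ} (hR : 0 < R) (z : Fin n → ℂ) :
    D.psiFlat R z = D.Phi R z * ∏ i, D.η (R * ‖z i‖) := by
  have h1 : D.cutoff (R • z) = ∏ i, D.η (R * ‖z i‖) := by
    simp [Data.cutoff, abs_of_pos hR]
  have h2 : D.phiOne (R ^ 2 • z) = R ^ 4 * D.Phi R z := by
    simp only [Data.phiOne, Data.profile, Data.Phi, Pi.smul_apply, norm_smul, norm_pow,
      Real.norm_eq_abs, abs_of_pos hR]
    ring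
  rw [Data.psiFlat, h1, h2]
  field_simp

theorem Data.contDiff_psiFlat (D : Data K hn k) (R : ℝ) : ContDiff ℝ k (D.psiFlat R) :=
  contDiff_const.mul ((D.contDiff_phiOne.comp (contDiff_const_smul _)).mul
    (D.contDiff_cutoff.comp (contDiff_const_smul _)))

theorem Data.psiFlat_eq_zero (D : Data K hn k) {R : ℝ} (hR : 0 < R) {z : Fin n → ℂ}
    (hz : z ∉ polydisk n (1 / R)) : D.psiFlat R z = 0 := by
  simp only [polydisk, Set.mem_ofPred_eq, not_forall, not_le] at hz
  obtain ⟨i, hi⟩ := hz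
  rw [div_lt_iff₀ hR] at hi
  rw [D.psiFlat_eq hR, Finset.prod_eq_zero (Finset.mem_univ i) (D.η_zero _ (by linarith)),
    mul_zero]

theorem Data.psi_apply (D : Data K hn k) {R : ℝ} (hR : 0 < R) {p : M} (hp : p ∈ D.χ.target) :
    D.psi R p = D.psiFlat R (D.χ.symm p) := by
  rw [Data.psi, if_pos hp, D.psiFlat_eq hR]

theorem Data.psi_chi (D : Data K hn k) {R : ℝ} (hR : 0 < R) {z : Fin n → ℂ}
    (hz : z ∈ D.χ.source) : D.psi R (D.χ z) = D.psiFlat R z := by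
  rw [D.psi_apply hR (D.χ.map_source hz), D.χ.left_inv hz]

theorem Data.psi_eq_zero (D : Data K hn k) {R : ℝ} (hR : 0 < R) {p : M}
    (hp : p ∉ D.χ '' polydisk n (1 / R)) : D.psi R p = 0 := by
  by_cases ht : p ∈ D.χ.target
  · rw [D.psi_apply hR ht]
    exact D.psiFlat_eq_zero hR fun h => hp ⟨_, h, D.χ.right_inv ht⟩
  · rw [Data.psi, if_neg ht]

theorem Data.isClosed_image [T2Space M] (D : Data K hn k) {R : ℝ} (hR : 1 ≤ R) :
    IsClosed (D.χ '' polydisk n (1 / R)) :=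
  ((isCompact_polydisk n _).image_of_continuousOn (D.χ.continuousOn.mono
    ((polydisk_mono (by rw [div_le_one (by linarith)]; exact hR)).trans
      D.polydisk_subset))).isClosed

/-- The image of the closed polydisk is compact, hence closed in the Hausdorff space M. Its open
complement, where ψ_R = 0, covers M together with the coordinate patch. -/
theorem Data.contMDiff_psi [T2Space M] (D : Data K hn k) {R : ℝ} (hR : 1 ≤ R) :
    ContMDiff 𝓘(ℝ, Model n) 𝓘(ℝ, ℝ) k (D.psi R) := by
  have hR0 : 0 < R := by linarith
  intro p
  by_cases hp : p ∈ D.χ.target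
  · have h1 : ContMDiffAt 𝓘(ℝ, Model n) 𝓘(ℝ, ℝ) k (D.psiFlat R ∘ D.χ.symm) p :=
      (D.contDiff_psiFlat R).contMDiff.contMDiffAt.comp p
        ((D.smooth_χ_symm.contMDiffAt (D.χ.open_target.mem_nhds hp)).of_le
          (by exact_mod_cast le_top))
    refine h1.congr_of_eventuallyEq ?_
    filter_upwards [D.χ.open_target.mem_nhds hp] with q hq using D.psi_apply hR0 hq
  · have hp' : p ∉ D.χ '' polydisk n (1 / R) := by
      rintro ⟨z, hz, rfl⟩
      exact hp (D.χ.map_source (D.polydisk_subset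
        (polydisk_mono (by rw [div_le_one hR0]; exact hR) hz)))
    refine (contMDiffAt_const (c := (0 : ℝ))).congr_of_eventuallyEq ?_
    filter_upwards [(D.isClosed_image hR).isOpen_compl.mem_nhds hp'] with q hq using
      D.psi_eq_zero hR0 hq

end CutOff

/-! ### Derivatives of rescaled products; limits along ultrafilters -/

section Scaling

theorem hasFDerivAt_comp_smul {E G : Type*} [NormedAddCommGroup E] [NormedSpace ℝ E]
    [NormedAddCommGroup G] [NormedSpace ℝ G] {g : E → G} (c : ℝ) {z : E}
    (hg : DifferentiableAt ℝ g (c • z)) :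
    HasFDerivAt (fun z => g (c • z)) (c • fderiv ℝ g (c • z)) z := by
  have h1 : HasFDerivAt (fun z : E => c • z) (c • ContinuousLinearMap.id ℝ E) z :=
    (hasFDerivAt_id z).const_smul c
  have h2 := HasFDerivAt.comp z hg.hasFDerivAt h1
  have h3 : (fderiv ℝ g (c • z)).comp (c • ContinuousLinearMap.id ℝ E) =
      c • fderiv ℝ g (c • z) := by
    ext u; simp
  rw [h3] at h2
  exact h2

variable {E : Type*} [NormedAddCommGroup E] [NormedSpace ℝ E] {P C : E → ℝ}

theorem hasFDerivAt_scaled (hP : ContDiff ℝ 2 P) (hC : ContDiff ℝ 2 C) {R : ℝ} (hR : 0 < R)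
    (z : E) : HasFDerivAt (fun z => (R ^ 4)⁻¹ * (P (R ^ 2 • z) * C (R • z)))
      (((R ^ 2)⁻¹ * C (R • z)) • fderiv ℝ P (R ^ 2 • z) +
        ((R ^ 3)⁻¹ * P (R ^ 2 • z)) • fderiv ℝ C (R • z)) z := by
  have h1 := hasFDerivAt_comp_smul (R ^ 2) (z := z) (hP.differentiable (by norm_num) _)
  have h2 := hasFDerivAt_comp_smul R (z := z) (hC.differentiable (by norm_num) _)
  have h3 := (h1.mul h2).const_mul (R ^ 4)⁻¹
  refine h3.congr_fderiv ?_
  ext u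
  simp only [add_apply, smul_apply, smul_eq_mul]
  field_simp
  ring

/-- Two derivatives of P(R² ·) produce R⁴ and cancel the prefactor; each derivative falling on C(R
·) instead loses a factor R. Only the first term survives as R → ∞. -/
theorem fderiv_fderiv_scaled (hP : ContDiff ℝ 2 P) (hC : ContDiff ℝ 2 C) {R : ℝ} (hR : 0 < R)
    (z u w : E) :
    fderiv ℝ (fderiv ℝ fun z => (R ^ 4)⁻¹ * (P (R ^ 2 • z) * C (R • z))) z u w =
      C (R • z) * fderiv ℝ (fderiv ℝ P) (R ^ 2 • z) u w +
      R⁻¹ * (fderiv ℝ C (R • z) u * fderiv ℝ P (R ^ 2 • z) w) +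
      R⁻¹ * (fderiv ℝ P (R ^ 2 • z) u * fderiv ℝ C (R • z) w) +
      (R ^ 2)⁻¹ * (P (R ^ 2 • z) * fderiv ℝ (fderiv ℝ C) (R • z) u w) := by
  have hd : fderiv ℝ (fun z => (R ^ 4)⁻¹ * (P (R ^ 2 • z) * C (R • z))) = fun z =>
      ((R ^ 2)⁻¹ * C (R • z)) • fderiv ℝ P (R ^ 2 • z) +
        ((R ^ 3)⁻¹ * P (R ^ 2 • z)) • fderiv ℝ C (R • z) := by
    funext y
    exact (hasFDerivAt_scaled hP hC hR y).fderiv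
  have h1 := hasFDerivAt_comp_smul (R ^ 2) (z := z) (hP.differentiable (by norm_num) _)
  have h2 := hasFDerivAt_comp_smul R (z := z) (hC.differentiable (by norm_num) _)
  have h3 := hasFDerivAt_comp_smul (R ^ 2) (z := z) (g := fderiv ℝ P)
    ((hP.fderiv_right (m := 1) (by norm_num)).differentiable (by norm_num) _)
  have h4 := hasFDerivAt_comp_smul R (z := z) (g := fderiv ℝ C)
    ((hC.fderiv_right (m := 1) (by norm_num)).differentiable (by norm_num) _)
  have h5 := ((h2.const_mul (R ^ 2)⁻¹).smul h3).add ((h1.const_mul (R ^ 3)⁻¹).smul h4)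
  rw [hd]
  have h6 := h5.fderiv
  have h7 : ∀ L : E →L[ℝ] E →L[ℝ] ℝ, fderiv ℝ (fun z =>
      ((R ^ 2)⁻¹ * C (R • z)) • fderiv ℝ P (R ^ 2 • z) +
        ((R ^ 3)⁻¹ * P (R ^ 2 • z)) • fderiv ℝ C (R • z)) z = L →
      fderiv ℝ (fun z =>
      ((R ^ 2)⁻¹ * C (R • z)) • fderiv ℝ P (R ^ 2 • z) +
        ((R ^ 3)⁻¹ * P (R ^ 2 • z)) • fderiv ℝ C (R • z)) z u w = L u w := fun L h => by rw [h]
  rw [h7 _ h6]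
  simp only [add_apply, smul_apply, smul_eq_mul, ContinuousLinearMap.smulRight_apply]
  field_simp
  ring

theorem _root_.Filter.Tendsto.clm_apply {X E F : Type*} [NormedAddCommGroup E] [NormedSpace ℝ E]
    [NormedAddCommGroup F] [NormedSpace ℝ F] {l : Filter X} {f : X → E →L[ℝ] F} {g : X → E}
    {f' : E →L[ℝ] F} {g' : E} (hf : Filter.Tendsto f l (𝓝 f')) (hg : Filter.Tendsto g l (𝓝 g')) :
    Filter.Tendsto (fun x => f x (g x)) l (𝓝 (f' g')) :=
  ((isBoundedBilinearMap_apply (𝕜 := ℝ) (E := E) (F := F)).continuous.tendsto (f', g')).comp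
    (hf.prodMk_nhds hg)

/-- A bounded function converges along an ultrafilter. -/
theorem exists_tendsto_of_bounded {X G : Type*} [NormedAddCommGroup G] [NormedSpace ℝ G]
    [FiniteDimensional ℝ G] (U : Ultrafilter X) (f : X → G) (B : ℝ) (hf : ∀ᶠ x in (U : Filter X), ‖f x‖ ≤ B) :
    ∃ l, Filter.Tendsto f U (𝓝 l) := by
  have := FiniteDimensional.proper ℝ G
  have h : Metric.closedBall (0 : G) B ∈ (U.map f : Filter G) := by
    rw [Ultrafilter.coe_map, Filter.mem_map]
    filter_upwards [hf] with x hx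
    simpa using hx
  obtain ⟨l, -, hl⟩ := (isCompact_closedBall (0 : G) B).ultrafilter_le_nhds (U.map f)
    (Filter.le_principal_iff.2 h)
  exact ⟨l, hl⟩

theorem exists_bound_of_zero_outside {X G : Type*} [TopologicalSpace X] [NormedAddCommGroup G]
    {f : X → G} (hf : Continuous f) {S : Set X} (hS : IsCompact S) (h0 : ∀ x ∉ S, f x = 0) :
    ∃ B, ∀ x, ‖f x‖ ≤ B := by
  obtain ⟨B, hB⟩ := hS.exists_bound_of_continuousOn hf.continuousOn
  refine ⟨max B 0, fun x => ?_⟩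
  by_cases hx : x ∈ S
  · exact (hB x hx).trans (le_max_left _ _)
  · rw [h0 x hx, norm_zero]; exact le_max_right _ _

end Scaling

/-! ### Limits of the derivatives of ψ_R on the shrinking polydisks -/

section Limits

variable {n : ℕ} {M : Type*} [TopologicalSpace M] [ChartedSpace (Model n) M]
  [IsManifold 𝓘(ℝ, Model n) ∞ M] {K : AKStructure n M} {hn : 2 ≤ n} {k : ℕ∞}

/-- The filter of the pairs `(R, z)` with `R → ∞` and `z` in the polydisk of radius `1 / R`. -/
def shrinking (n : ℕ) : Filter (ℝ × (Fin n → ℂ)) :=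
  Filter.comap Prod.fst Filter.atTop ⊓ Filter.principal {x | x.2 ∈ polydisk n (1 / x.1)}

theorem shrinking_fst (n : ℕ) : Filter.Tendsto Prod.fst (shrinking n) Filter.atTop :=
  Filter.tendsto_comap.mono_left inf_le_left

theorem shrinking_mem (n : ℕ) : ∀ᶠ x in shrinking n, x.2 ∈ polydisk n (1 / x.1) :=
  Filter.eventually_inf_principal.2 (Filter.Eventually.of_forall fun _ h => h)

theorem shrinking_snd (n : ℕ) : Filter.Tendsto Prod.snd (shrinking n) (𝓝 0) := by
  rw [tendsto_pi_nhds]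
  intro i
  refine squeeze_zero_norm' (a := fun x : ℝ × (Fin n → ℂ) => 1 / x.1) ?_ ?_
  · filter_upwards [shrinking_mem n] with x hx using hx i
  · simpa [Function.comp_def] using (tendsto_inv_atTop_zero.comp (shrinking_fst n))

theorem exists_of_eventually_shrinking {n : ℕ} {p : ℝ → (Fin n → ℂ) → Prop}
    (h : ∀ᶠ x in shrinking n, p x.1 x.2) :
    ∃ R₂ : ℝ, ∀ R ≥ R₂, ∀ z ∈ polydisk n (1 / R), p R z := by
  rw [shrinking, Filter.eventually_inf_principal, Filter.eventually_comap] at h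
  obtain ⟨R₂, hR₂⟩ := Filter.eventually_atTop.1 h
  exact ⟨R₂, fun R hR z hz => hR₂ R hR (R, z) rfl hz⟩

theorem two_le_coe {k : ℕ∞} (hk : 2 ≤ k) : (2 : WithTop ℕ∞) ≤ k := by
  change ((2 : ℕ∞) : WithTop ℕ∞) ≤ _
  exact WithTop.coe_le_coe.2 hk

theorem Data.contDiff_two_profile (D : Data K hn k) (hk : 2 ≤ k) (l : ℝ) :
    ContDiff ℝ 2 (D.profile l) := (D.contDiff_profile l).of_le (two_le_coe hk)

theorem Data.contDiff_two_cutoff (D : Data K hn k) (hk : 2 ≤ k) :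
    ContDiff ℝ 2 D.cutoff := D.contDiff_cutoff.of_le (two_le_coe hk)

theorem Data.contDiff_two_phiOne (D : Data K hn k) (hk : 2 ≤ k) :
    ContDiff ℝ 2 D.phiOne := D.contDiff_phiOne.of_le (two_le_coe hk)

theorem Data.profile_eventually_zero (D : Data K hn k) (l : ℝ) {w : ℂ}
    (hw : w ∉ Metric.closedBall (0 : ℂ) 1) : D.profile l =ᶠ[𝓝 w] fun _ => 0 := by
  filter_upwards [Metric.isClosed_closedBall.isOpen_compl.mem_nhds hw] with y hy
  have : 1 < ‖y‖ := by simpa using hy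
  rw [Data.profile, D.η_zero _ this.le, mul_zero]

/-- The profile vanishes outside the unit disk. Bounds on all of ℂ are needed because R² z is
unbounded for z in the polydisk of radius 1/R. -/
theorem Data.profile_bounds (D : Data K hn k) (hk : 2 ≤ k) (l : ℝ) :
    ∃ B, ∀ w, ‖D.profile l w‖ ≤ B ∧ ‖fderiv ℝ (D.profile l) w‖ ≤ B ∧
      ‖fderiv ℝ (fderiv ℝ (D.profile l)) w‖ ≤ B := by
  have hC := D.contDiff_two_profile hk l
  have h1 : ContDiff ℝ 1 (fderiv ℝ (D.profile l)) := hC.fderiv_right (by norm_num)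
  have hS := isCompact_closedBall (0 : ℂ) 1
  obtain ⟨B0, hB0⟩ := exists_bound_of_zero_outside hC.continuous hS
    fun w hw => (D.profile_eventually_zero l hw).self_of_nhds
  have hz : ∀ w ∉ Metric.closedBall (0 : ℂ) 1, fderiv ℝ (D.profile l) w = 0 := fun w hw => by
    rw [(D.profile_eventually_zero l hw).fderiv_eq, fderiv_fun_const]; rfl
  obtain ⟨B1, hB1⟩ := exists_bound_of_zero_outside h1.continuous hS hz
  obtain ⟨B2, hB2⟩ := exists_bound_of_zero_outside (G := ℂ →L[ℝ] ℂ →L[ℝ] ℝ)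
    (h1.continuous_fderiv (by norm_num)) hS fun w hw => by
      have hev : fderiv ℝ (D.profile l) =ᶠ[𝓝 w] fun _ => 0 := by
        filter_upwards [Metric.isClosed_closedBall.isOpen_compl.mem_nhds hw] with y hy
          using hz y hy
      rw [hev.fderiv_eq, fderiv_fun_const]; rfl
  exact ⟨max B0 (max B1 B2), fun w => ⟨(hB0 w).trans (le_max_left _ _),
    (hB1 w).trans ((le_max_left _ _).trans (le_max_right _ _)),
    (hB2 w).trans ((le_max_right _ _).trans (le_max_right _ _))⟩⟩

theorem Data.fderiv_phiOne (D : Data K hn k) (hk : 2 ≤ k) (z u : Fin n → ℂ) :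
    fderiv ℝ D.phiOne z u =
      fderiv ℝ (D.profile (D.lam ⟨0, by omega⟩)) (z ⟨0, by omega⟩) (u ⟨0, by omega⟩) +
      fderiv ℝ (D.profile (D.lam ⟨1, by omega⟩)) (z ⟨1, by omega⟩) (u ⟨1, by omega⟩) := by
  have h : ∀ (l : ℝ) (i : Fin n), HasFDerivAt (fun z : Fin n → ℂ => D.profile l (z i))
      ((fderiv ℝ (D.profile l) (z i)).comp (ContinuousLinearMap.proj i)) z := fun l i =>
    HasFDerivAt.comp z ((D.contDiff_two_profile hk l).differentiable
      (by norm_num) _).hasFDerivAt (hasFDerivAt_apply i z)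
  have := ((h (D.lam ⟨0, by omega⟩) ⟨0, by omega⟩).add
    (h (D.lam ⟨1, by omega⟩) ⟨1, by omega⟩)).fderiv
  exact congrArg (fun L : (Fin n → ℂ) →L[ℝ] ℝ => L u) this

theorem Data.fderiv_fderiv_phiOne (D : Data K hn k) (hk : 2 ≤ k) (z u w : Fin n → ℂ) :
    fderiv ℝ (fderiv ℝ D.phiOne) z u w =
      fderiv ℝ (fderiv ℝ (D.profile (D.lam ⟨0, by omega⟩))) (z ⟨0, by omega⟩) (u ⟨0, by omega⟩)
        (w ⟨0, by omega⟩) +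
      fderiv ℝ (fderiv ℝ (D.profile (D.lam ⟨1, by omega⟩))) (z ⟨1, by omega⟩) (u ⟨1, by omega⟩)
        (w ⟨1, by omega⟩) := by
  have hd : DifferentiableAt ℝ (fderiv ℝ D.phiOne) z :=
    ((D.contDiff_two_phiOne hk).fderiv_right (m := 1) (by norm_num)).differentiable
      (by norm_num) _
  have h1 : HasFDerivAt (fun y => fderiv ℝ D.phiOne y w)
      ((fderiv ℝ (fderiv ℝ D.phiOne) z).flip w) z := by
    have := hd.hasFDerivAt.clm_apply (hasFDerivAt_const w z)
    simpa using this
  have h : ∀ (l : ℝ) (i : Fin n), HasFDerivAt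
      (fun y : Fin n → ℂ => fderiv ℝ (D.profile l) (y i) (w i))
      (((fderiv ℝ (fderiv ℝ (D.profile l)) (z i)).flip (w i)).comp
        (ContinuousLinearMap.proj i)) z := fun l i => by
    have h2 : DifferentiableAt ℝ (fderiv ℝ (D.profile l)) (z i) :=
      ((D.contDiff_two_profile hk l).fderiv_right (m := 1) (by norm_num)).differentiable
        (by norm_num) _
    have h3 : HasFDerivAt (fun y => fderiv ℝ (D.profile l) y (w i))
        ((fderiv ℝ (fderiv ℝ (D.profile l)) (z i)).flip (w i)) (z i) := by
      have := h2.hasFDerivAt.clm_apply (hasFDerivAt_const (w i) (z i))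
      simpa using this
    exact HasFDerivAt.comp (f := fun y : Fin n → ℂ => y i)
      (g := fun y => fderiv ℝ (D.profile l) y (w i)) z h3 (hasFDerivAt_apply i z)
  have h4 := (h (D.lam ⟨0, by omega⟩) ⟨0, by omega⟩).add (h (D.lam ⟨1, by omega⟩) ⟨1, by omega⟩)
  have h5 : (fun y => fderiv ℝ D.phiOne y w) = fun y : Fin n → ℂ => _ :=
    funext fun y => D.fderiv_phiOne hk y w
  rw [h5] at h1
  exact congrArg (fun L : (Fin n → ℂ) →L[ℝ] ℝ => L u) (h1.unique h4)

/-- The points R z stay in the unit polydisk, where C and its derivatives are bounded, and the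
profiles are bounded everywhere; so each factor converges along the ultrafilter. The limiting
Hessian inherits the splitting of P: it involves only the first two coordinates, separately. The
weight a(x) is meant to be the amplitude, which is bounded but need not converge. -/
theorem Data.exists_limits (D : Data K hn k) (hk : 2 ≤ k) (U : Ultrafilter (ℝ × (Fin n → ℂ)))
    (hU : (U : Filter (ℝ × (Fin n → ℂ))) ≤ shrinking n) (a : ℝ × (Fin n → ℂ) → ℝ)
    (ha : ∀ᶠ x in (U : Filter (ℝ × (Fin n → ℂ))), ‖a x‖ ≤ 1) :
    ∃ q₀ q₁ : ℂ →L[ℝ] ℂ →L[ℝ] ℝ,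
      (∀ (u w : ℝ × (Fin n → ℂ) → Fin n → ℂ) (u' w' : Fin n → ℂ),
        Filter.Tendsto u U (𝓝 u') → Filter.Tendsto w U (𝓝 w') →
        Filter.Tendsto (fun x => a x * fderiv ℝ (fderiv ℝ (D.psiFlat x.1)) x.2 (u x) (w x)) U
          (𝓝 (q₀ (u' ⟨0, by omega⟩) (w' ⟨0, by omega⟩) +
            q₁ (u' ⟨1, by omega⟩) (w' ⟨1, by omega⟩)))) ∧
      ∀ (w : ℝ × (Fin n → ℂ) → Fin n → ℂ) (w' : Fin n → ℂ), Filter.Tendsto w U (𝓝 w') →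
        Filter.Tendsto (fun x => a x * fderiv ℝ (D.psiFlat x.1) x.2 (w x)) U (𝓝 0) := by
  have hRpos : ∀ᶠ x in (U : Filter (ℝ × (Fin n → ℂ))), 0 < x.1 :=
    ((shrinking_fst n).mono_left hU).eventually (Filter.eventually_gt_atTop 0)
  have hscaled : ∀ᶠ x in (U : Filter (ℝ × (Fin n → ℂ))), x.1 • x.2 ∈ polydisk n 1 := by
    filter_upwards [hRpos, hU (shrinking_mem n)] with x hx hx2 i
    have := hx2 i
    rw [le_div_iff₀ hx] at this
    simpa [norm_smul, abs_of_pos hx, mul_comm] using this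
  have hRinv : Filter.Tendsto (fun x : ℝ × (Fin n → ℂ) => x.1⁻¹) U (𝓝 0) :=
    tendsto_inv_atTop_zero.comp ((shrinking_fst n).mono_left hU)
  have hC := D.contDiff_two_cutoff hk
  have hC1 : ContDiff ℝ 1 (fderiv ℝ D.cutoff) := hC.fderiv_right (by norm_num)
  have hS := isCompact_polydisk n 1
  obtain ⟨a', ha'⟩ := exists_tendsto_of_bounded U a 1 ha
  obtain ⟨B0, hB0⟩ := hS.exists_bound_of_continuousOn hC.continuous.continuousOn
  obtain ⟨B1, hB1⟩ := hS.exists_bound_of_continuousOn hC1.continuous.continuousOn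
  obtain ⟨B2, hB2⟩ := IsCompact.exists_bound_of_continuousOn
    (E := (Fin n → ℂ) →L[ℝ] (Fin n → ℂ) →L[ℝ] ℝ) hS
    (hC1.continuous_fderiv (by norm_num)).continuousOn
  obtain ⟨c0, hc0⟩ := exists_tendsto_of_bounded U (fun x => D.cutoff (x.1 • x.2)) B0
    (hscaled.mono fun x hx => hB0 _ hx)
  obtain ⟨c1, hc1⟩ := exists_tendsto_of_bounded U (fun x => fderiv ℝ D.cutoff (x.1 • x.2)) B1
    (hscaled.mono fun x hx => hB1 _ hx)
  obtain ⟨c2, hc2⟩ := exists_tendsto_of_bounded (G := (Fin n → ℂ) →L[ℝ] (Fin n → ℂ) →L[ℝ] ℝ) U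
    (fun x => fderiv ℝ (fderiv ℝ D.cutoff) (x.1 • x.2)) B2 (hscaled.mono fun x hx => hB2 _ hx)
  have hprof : ∀ (l : ℝ) (i : Fin n), ∃ (f0 : ℝ) (f1 : ℂ →L[ℝ] ℝ) (f2 : ℂ →L[ℝ] ℂ →L[ℝ] ℝ),
      Filter.Tendsto (fun x : ℝ × (Fin n → ℂ) => D.profile l ((x.1 ^ 2 • x.2) i)) U (𝓝 f0) ∧
      Filter.Tendsto (fun x : ℝ × (Fin n → ℂ) => fderiv ℝ (D.profile l) ((x.1 ^ 2 • x.2) i)) U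
        (𝓝 f1) ∧
      Filter.Tendsto (fun x : ℝ × (Fin n → ℂ) =>
        fderiv ℝ (fderiv ℝ (D.profile l)) ((x.1 ^ 2 • x.2) i)) U (𝓝 f2) := by
    intro l i
    obtain ⟨B, hB⟩ := D.profile_bounds hk l
    obtain ⟨f0, hf0⟩ := exists_tendsto_of_bounded U
      (fun x : ℝ × (Fin n → ℂ) => D.profile l ((x.1 ^ 2 • x.2) i)) B
      (Filter.Eventually.of_forall fun x => (hB _).1)
    obtain ⟨f1, hf1⟩ := exists_tendsto_of_bounded U
      (fun x : ℝ × (Fin n → ℂ) => fderiv ℝ (D.profile l) ((x.1 ^ 2 • x.2) i)) B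
      (Filter.Eventually.of_forall fun x => (hB _).2.1)
    obtain ⟨f2, hf2⟩ := exists_tendsto_of_bounded (G := ℂ →L[ℝ] ℂ →L[ℝ] ℝ) U
      (fun x : ℝ × (Fin n → ℂ) => fderiv ℝ (fderiv ℝ (D.profile l)) ((x.1 ^ 2 • x.2) i)) B
      (Filter.Eventually.of_forall fun x => (hB _).2.2)
    exact ⟨f0, f1, f2, hf0, hf1, hf2⟩
  obtain ⟨f0, f1, f2, hf0, hf1, hf2⟩ := hprof (D.lam ⟨0, by omega⟩) ⟨0, by omega⟩
  obtain ⟨g0, g1, g2, hg0, hg1, hg2⟩ := hprof (D.lam ⟨1, by omega⟩) ⟨1, by omega⟩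
  have hP := D.contDiff_two_phiOne hk
  have hcoord : ∀ {w : ℝ × (Fin n → ℂ) → Fin n → ℂ} {w' : Fin n → ℂ} (i : Fin n),
      Filter.Tendsto w U (𝓝 w') → Filter.Tendsto (fun x => w x i) U (𝓝 (w' i)) :=
    fun i hw => (tendsto_pi_nhds.1 hw) i
  have hDP : ∀ {w : ℝ × (Fin n → ℂ) → Fin n → ℂ} {w' : Fin n → ℂ}, Filter.Tendsto w U (𝓝 w') →
      Filter.Tendsto (fun x => fderiv ℝ D.phiOne (x.1 ^ 2 • x.2) (w x)) U
        (𝓝 (f1 (w' ⟨0, by omega⟩) + g1 (w' ⟨1, by omega⟩))) := by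
    intro w w' hw
    simp only [D.fderiv_phiOne hk]
    exact (hf1.clm_apply (hcoord _ hw)).add (hg1.clm_apply (hcoord _ hw))
  have hP0 : Filter.Tendsto (fun x : ℝ × (Fin n → ℂ) => D.phiOne (x.1 ^ 2 • x.2)) U
      (𝓝 (f0 + g0)) := hf0.add hg0
  refine ⟨(a' * c0) • f2, (a' * c0) • g2, fun u w u' w' hu hw => ?_, fun w w' hw => ?_⟩
  · have h1 : Filter.Tendsto (fun x => fderiv ℝ (fderiv ℝ D.phiOne) (x.1 ^ 2 • x.2) (u x) (w x)) U
        (𝓝 (f2 (u' ⟨0, by omega⟩) (w' ⟨0, by omega⟩) +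
          g2 (u' ⟨1, by omega⟩) (w' ⟨1, by omega⟩))) := by
      simp only [D.fderiv_fderiv_phiOne hk]
      exact ((hf2.clm_apply (hcoord _ hu)).clm_apply (hcoord _ hw)).add
        ((hg2.clm_apply (hcoord _ hu)).clm_apply (hcoord _ hw))
    have h2 := (((hc0.mul h1).add (hRinv.mul ((hc1.clm_apply hu).mul (hDP hw)))).add
      (hRinv.mul ((hDP hu).mul (hc1.clm_apply hw)))).add
      ((hRinv.pow 2).mul (hP0.mul ((hc2.clm_apply hu).clm_apply hw)))
    have h3 := ha'.mul h2
    have h4 : a' * (c0 * (f2 (u' ⟨0, by omega⟩) (w' ⟨0, by omega⟩) +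
          g2 (u' ⟨1, by omega⟩) (w' ⟨1, by omega⟩)) +
        0 * (c1 u' * (f1 (w' ⟨0, by omega⟩) + g1 (w' ⟨1, by omega⟩))) +
        0 * ((f1 (u' ⟨0, by omega⟩) + g1 (u' ⟨1, by omega⟩)) * c1 w') +
        0 ^ 2 * ((f0 + g0) * c2 u' w')) =
        ((a' * c0) • f2) (u' ⟨0, by omega⟩) (w' ⟨0, by omega⟩) +
          ((a' * c0) • g2) (u' ⟨1, by omega⟩) (w' ⟨1, by omega⟩) := by
      simp only [smul_apply, smul_eq_mul]
      ring
    rw [h4] at h3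
    refine h3.congr' ?_
    filter_upwards [hRpos] with x hx
    have := fderiv_fderiv_scaled hP hC hx x.2 (u x) (w x)
    simp only [inv_pow]
    rw [← this]
    rfl
  · have h2 := (((hRinv.pow 2).mul hc0).mul (hDP hw)).add
      (((hRinv.pow 3).mul hP0).mul (hc1.clm_apply hw))
    have h3 := ha'.mul h2
    have h4 : a' * (0 ^ 2 * c0 * (f1 (w' ⟨0, by omega⟩) + g1 (w' ⟨1, by omega⟩)) +
        0 ^ 3 * (f0 + g0) * c1 w') = 0 := by ring
    rw [h4] at h3
    refine h3.congr' ?_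
    filter_upwards [hRpos] with x hx
    have := congrArg (fun L : (Fin n → ℂ) →L[ℝ] ℝ => L (w x))
      (hasFDerivAt_scaled hP hC hx x.2).fderiv
    simp only [add_apply, smul_apply, smul_eq_mul] at this
    simp only [inv_pow]
    rw [← this]
    rfl

end Limits

/-! ### Types of two-forms on ℂⁿ -/

section FlatForms

variable {n : ℕ}

/-- The `(1,1)`-part of a two-form on a vector space with a complex structure. -/
noncomputable def p11 {E : Type*} (B : E → E → ℝ) (j : E → E) (u v : E) : ℝ :=
  (B u v + B (j u) (j v)) / 2

/-- The `(2,0)`-part of a two-form on a vector space with a complex structure. -/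
noncomputable def p20 {E : Type*} (B : E → E → ℝ) (j : E → E) (u v : E) : ℂ :=
  (((B u v - B (j u) (j v) : ℝ) : ℂ) - Complex.I * ((B (j u) v + B u (j v) : ℝ) : ℂ)) / 4

/-- `areaForm` as a bilinear map. -/
noncomputable def areaL {n : ℕ} (α : Fin n) : (Fin n → ℂ) →ₗ[ℝ] (Fin n → ℂ) →ₗ[ℝ] ℝ :=
  LinearMap.mk₂ ℝ (areaForm α)
    (fun a b c => by simp [areaForm]; ring)
    (fun r a b => by simp [areaForm]; ring)
    (fun a b c => by simp [areaForm]; ring)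
    (fun r a b => by simp [areaForm]; ring)

theorem areaL_apply {n : ℕ} (α : Fin n) (u v : Fin n → ℂ) : areaL α u v = areaForm α u v := rfl

theorem areaForm_I {n : ℕ} (α : Fin n) (u v : Fin n → ℂ) :
    areaForm α (Complex.I • u) (Complex.I • v) = areaForm α u v := by
  simp [areaForm]

theorem areaForm_self_I {n : ℕ} (α : Fin n) (u : Fin n → ℂ) :
    areaForm α u (Complex.I • u) = ‖u α‖ ^ 2 := by
  rw [← Complex.normSq_eq_norm_sq]
  simp [areaForm, Complex.normSq_apply]

theorem areaForm_self {n : ℕ} (α : Fin n) (u : Fin n → ℂ) : areaForm α u u = 0 := by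
  simp [areaForm]; ring

/-- An invariant bilinear form on `ℂⁿ` which is diagonal on the standard basis. -/
theorem eq_sum_area (G : (Fin n → ℂ) →ₗ[ℝ] (Fin n → ℂ) →ₗ[ℝ] ℝ)
    (hI : ∀ u v, G (Complex.I • u) (Complex.I • v) = G u v) (t : Fin n → ℝ)
    (h1 : ∀ a b, G (Pi.single a 1) (Pi.single b 1) = 0)
    (h2 : ∀ a b, G (Pi.single a 1) (Pi.single b Complex.I) = if a = b then t a else 0)
    (u v : Fin n → ℂ) : G u v = ∑ a, t a * areaForm a u v := by
  have hs : ∀ a : Fin n, (Pi.single a Complex.I : Fin n → ℂ) = Complex.I • Pi.single a 1 :=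
    fun a => by rw [← Pi.single_smul]; simp
  have hs' : ∀ a : Fin n, (Complex.I • Pi.single a Complex.I : Fin n → ℂ) = -Pi.single a 1 :=
    fun a => by rw [hs, smul_smul, Complex.I_mul_I, neg_one_smul]
  have h3 : ∀ a b, G (Pi.single a Complex.I) (Pi.single b Complex.I) = 0 := fun a b => by
    rw [hs, hs, hI, h1]
  have h4 : ∀ a b, G (Pi.single a Complex.I) (Pi.single b 1) = - if a = b then t a else 0 :=
    fun a b => by
      rw [← hI, hs', ← hs, map_neg, LinearMap.neg_apply, h2]
  -- Invariance determines the values on pairs involving ∂y from those on the two kinds of pairs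
  -- given, so the two bilinear maps agree on a basis.
  have hG : G = ∑ a, t a • areaL a := by
    refine (cbasis n).ext fun i => (cbasis n).ext fun j => ?_
    obtain ⟨⟨a, s⟩, rfl⟩ := (pairEquiv n).surjective i
    obtain ⟨⟨b, r⟩, rfl⟩ := (pairEquiv n).surjective j
    simp only [cbasis_apply, LinearMap.coe_sum, Finset.sum_apply, LinearMap.smul_apply, smul_eq_mul,
      areaL_apply]
    rw [Finset.sum_eq_single a]
    · by_cases hab : a = b
      · subst hab
        fin_cases s <;> fin_cases r <;> simp [h1, h2, h3, h4, areaForm]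
      · have hba : ¬ b = a := fun h => hab h.symm
        fin_cases s <;> fin_cases r <;> simp [h1, h2, h3, h4, areaForm, hab]
    · intro c _ hc
      simp [areaForm, hc]
    · simp
  rw [hG]
  simp [areaL_apply]

/-- A complex bilinear form on `ℂⁿ` in coordinates. -/
theorem eq_sum_coeff (T : (Fin n → ℂ) →ₗ[ℝ] (Fin n → ℂ) →ₗ[ℝ] ℂ)
    (hl : ∀ u v, T (Complex.I • u) v = Complex.I * T u v)
    (hr : ∀ u v, T u (Complex.I • v) = Complex.I * T u v) (u v : Fin n → ℂ) :
    T u v = ∑ a, ∑ b, T (Pi.single a 1) (Pi.single b 1) * u a * v b := by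
  have hs : ∀ a : Fin n, (Pi.single a Complex.I : Fin n → ℂ) = Complex.I • Pi.single a 1 :=
    fun a => by rw [← Pi.single_smul]; simp
  have hdec : ∀ u : Fin n → ℂ, u = ∑ a, ((u a).re • (Pi.single a 1 : Fin n → ℂ) +
      (u a).im • (Pi.single a Complex.I : Fin n → ℂ)) := by
    intro u
    funext c
    simp only [Finset.sum_apply, Pi.add_apply, Pi.smul_apply, Pi.single_apply]
    rw [Finset.sum_eq_single c]
    · simp
    · intro b _ hb
      simp [hb.symm]
    · simp
  have hu : ∀ w, T u w = ∑ a, u a * T (Pi.single a 1) w := fun w => by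
    conv_lhs => rw [hdec u]
    simp only [map_sum, map_add, map_smul, LinearMap.coe_sum, Finset.sum_apply,
      LinearMap.add_apply, LinearMap.smul_apply, hs, hl]
    refine Finset.sum_congr rfl fun a _ => ?_
    conv_rhs => rw [← Complex.re_add_im (u a)]
    simp only [Complex.real_smul]
    ring
  have hv : ∀ w, T w v = ∑ b, v b * T w (Pi.single b 1) := fun w => by
    conv_lhs => rw [hdec v]
    simp only [map_sum, map_add, map_smul, hs, hr]
    refine Finset.sum_congr rfl fun a _ => ?_
    conv_rhs => rw [← Complex.re_add_im (v a)]
    simp only [Complex.real_smul]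
    ring
  rw [hu]
  refine Finset.sum_congr rfl fun a _ => ?_
  rw [hv, Finset.mul_sum]
  exact Finset.sum_congr rfl fun b _ => by ring

/-- The `(2,0)`-part as a bilinear map. -/
noncomputable def p20L {E : Type*} [AddCommGroup E] [Module ℝ E] (B : E →ₗ[ℝ] E →ₗ[ℝ] ℝ)
    (j : E →ₗ[ℝ] E) : E →ₗ[ℝ] E →ₗ[ℝ] ℂ :=
  LinearMap.mk₂ ℝ (p20 (fun u v => B u v) j)
    (fun a b c => by simp [p20]; ring)
    (fun r a b => by simp [p20]; ring)
    (fun a b c => by simp [p20]; ring)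
    (fun r a b => by simp [p20]; ring)

/-- The complex conjugate of the `(2,0)`-part as a bilinear map. -/
noncomputable def p20conjL {E : Type*} [AddCommGroup E] [Module ℝ E] (B : E →ₗ[ℝ] E →ₗ[ℝ] ℝ)
    (j : E →ₗ[ℝ] E) : E →ₗ[ℝ] E →ₗ[ℝ] ℂ :=
  LinearMap.mk₂ ℝ (fun u v => starRingEnd ℂ (p20 (fun u v => B u v) j u v))
    (fun a b c => by rw [← map_add]; exact congrArg _ ((p20L B j).map_add₂ a b c))
    (fun r a b => by
      have : p20 (fun u v => B u v) j (r • a) b = r • p20 (fun u v => B u v) j a b :=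
        (p20L B j).map_smul₂ r a b
      rw [this]; simp)
    (fun a b c => by rw [← map_add]; exact congrArg _ ((p20L B j a).map_add b c))
    (fun r a b => by
      have : p20 (fun u v => B u v) j a (r • b) = r • p20 (fun u v => B u v) j a b :=
        (p20L B j a).map_smul r b
      rw [this]; simp)

/-- The `(1,1)`-part as a bilinear map. -/
noncomputable def p11L {E : Type*} [AddCommGroup E] [Module ℝ E] (B : E →ₗ[ℝ] E →ₗ[ℝ] ℝ)
    (j : E →ₗ[ℝ] E) : E →ₗ[ℝ] E →ₗ[ℝ] ℝ :=
  LinearMap.mk₂ ℝ (p11 (fun u v => B u v) j)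
    (fun a b c => by simp [p11]; ring)
    (fun r a b => by simp [p11]; ring)
    (fun a b c => by simp [p11]; ring)
    (fun r a b => by simp [p11]; ring)

/-- A real bilinear form with complex values. -/
noncomputable def toComplexL {E : Type*} [AddCommGroup E] [Module ℝ E]
    (B : E →ₗ[ℝ] E →ₗ[ℝ] ℝ) : E →ₗ[ℝ] E →ₗ[ℝ] ℂ :=
  LinearMap.mk₂ ℝ (fun u v => (B u v : ℂ))
    (fun a b c => by simp) (fun r a b => by simp) (fun a b c => by simp) (fun r a b => by simp)

end FlatForms

/-! ### The function F in coordinates -/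

section Coordinates

variable {n : ℕ} {M : Type*} [TopologicalSpace M] [ChartedSpace (Model n) M]
  {E : Type*} [NormedAddCommGroup E] [NormedSpace ℝ E] {χ : OpenPartialHomeomorph E M}
  [IsManifold 𝓘(ℝ, Model n) ∞ M]

/-- The standard basis of the model space. -/
noncomputable def stdBasis (n : ℕ) : Module.Basis (Fin (2 * n)) ℝ (Model n) :=
  (EuclideanSpace.basisFun (Fin (2 * n)) ℝ).toBasis

theorem stdBasis_apply (i : Fin (2 * n)) : stdBasis n i = EuclideanSpace.single i (1 : ℝ) := by
  simp [stdBasis]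

/-- A two-form at a point as a bilinear form on the model space. -/
noncomputable def DForm.bilAt (α : DForm n M 2) (p : M) : Model n →ₗ[ℝ] Model n →ₗ[ℝ] ℝ :=
  LinearMap.mk₂ ℝ (fun X Y => bil (Model n) (α.at p) X Y)
    (fun a b c => by simp) (fun r a b => by simp) (fun a b c => by simp) (fun r a b => by simp)

theorem DForm.bilAt_apply (α : DForm n M 2) (p : M) (X Y : Tan n p) :
    α.bilAt p X Y = α p ![X, Y] := bil_apply (α.at p) X Y

/-- A ratio of two top-degree forms does not depend on the basis, so the standard frame may be
replaced by the image of any basis under the derivative of the parametrization. -/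
theorem F_eq_coord (J : EndField n M) (Ω : DForm n M 2) (φ : M → ℝ) (hχ : IsParam n χ)
    {z : E} (hz : z ∈ χ.source) (b : Module.Basis (Fin (2 * n)) ℝ E) :
    F J Ω φ (χ z) = wedge (fun _ : Fin n => pb2 (pot J Ω φ) χ z) b /
      wedge (fun _ : Fin n => pb2 Ω χ z) b := by
  have h := wedge_div_wedge_basis (n := n) (fun _ => (pot J Ω φ).bilAt (χ z))
    (fun _ => Ω.bilAt (χ z)) (b.map (hχ.tequiv hz)) (stdBasis n)
  have h1 : ∀ α : DForm n M 2, wedge (fun _ : Fin n => fun X Y : Tan n (χ z) =>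
      α (χ z) ![X, Y]) (stdFrame (χ z)) =
      wedge (fun _ : Fin n => fun x y => α.bilAt (χ z) x y) (stdBasis n) := fun α => by
    have : (stdBasis n : Fin (2 * n) → Model n) = stdFrame (χ z) :=
      funext fun i => stdBasis_apply i
    rw [this]
    have h2 : (fun x y : Model n => α.bilAt (χ z) x y) = fun X Y : Tan n (χ z) =>
        α (χ z) ![X, Y] := by
      funext X Y
      exact α.bilAt_apply (χ z) X Y
    rw [h2]
    rfl
  have h3 : ∀ α : DForm n M 2, wedge (fun _ : Fin n => fun x y => α.bilAt (χ z) x y)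
      (b.map (hχ.tequiv hz)) = wedge (fun _ : Fin n => pb2 α χ z) b := fun α => by
    simp only [wedge, Module.Basis.map_apply]
    congr 1
    refine Finset.sum_congr rfl fun σ _ => congrArg _ (Finset.prod_congr rfl fun i _ => ?_)
    exact α.bilAt_apply (χ z) _ _
  rw [F, h1, h1, h, h3, h3]

end Coordinates

/-! ### The functions F_j in coordinates -/

section Coordinates

variable {n : ℕ} {M : Type*} [TopologicalSpace M] [ChartedSpace (Model n) M]
  {E : Type*} [NormedAddCommGroup E] [NormedSpace ℝ E] {χ : OpenPartialHomeomorph E M}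
  [IsManifold 𝓘(ℝ, Model n) ∞ M]

theorem P11_tmap (J : EndField n M) (α : DForm n M 2) (hχ : IsParam n χ) {z : E}
    (hz : z ∈ χ.source) (u v : E) :
    P11 J α (χ z) (tmap n χ z u) (tmap n χ z v) = p11 (pb2 α χ z) (jhat J χ z) u v := by
  simp only [p11, pb2, hχ.jhat_tmap J hz]
  rfl

theorem P20_tmap (J : EndField n M) (α : DForm n M 2) (hχ : IsParam n χ) {z : E}
    (hz : z ∈ χ.source) (u v : E) :
    P20 J α (χ z) (tmap n χ z u) (tmap n χ z v) = p20 (pb2 α χ z) (jhat J χ z) u v := by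
  simp only [p20, pb2, hχ.jhat_tmap J hz]
  rfl

/-- The forms in the definition of `Fj`. -/
noncomputable def tauForms {n : ℕ} {E : Type*} (B : E → E → ℝ) (j : E → E) (m : ℕ) (i : Fin n)
    (u v : E) : ℂ :=
  if (i : ℕ) < 2 * m then (if (i : ℕ) % 2 = 0 then p20 B j u v else starRingEnd ℂ (p20 B j u v))
  else (p11 B j u v : ℂ)

/-- The forms in the definition of `Fj` as bilinear maps. -/
noncomputable def tauFormsL {n : ℕ} {E : Type*} [AddCommGroup E] [Module ℝ E]
    (B : E →ₗ[ℝ] E →ₗ[ℝ] ℝ) (j : E →ₗ[ℝ] E) (m : ℕ) (i : Fin n) : E →ₗ[ℝ] E →ₗ[ℝ] ℂ :=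
  if (i : ℕ) < 2 * m then (if (i : ℕ) % 2 = 0 then p20L B j else p20conjL B j)
  else toComplexL (p11L B j)

theorem tauFormsL_apply {n : ℕ} {E : Type*} [AddCommGroup E] [Module ℝ E]
    (B : E →ₗ[ℝ] E →ₗ[ℝ] ℝ) (j : E →ₗ[ℝ] E) (m : ℕ) (i : Fin n) (u v : E) :
    tauFormsL B j m i u v = tauForms (fun u v => B u v) j m i u v := by
  unfold tauFormsL tauForms
  split_ifs <;> rfl

theorem Fj_eq_coord (J : EndField n M) (Ω : DForm n M 2) (m : ℕ) (φ : M → ℝ) (hχ : IsParam n χ)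
    {z : E} (hz : z ∈ χ.source) (b : Module.Basis (Fin (2 * n)) ℝ E) :
    Fj J Ω m φ (χ z) = ((n.factorial : ℂ) / ((m.factorial : ℂ) ^ 2 * ((n - 2 * m).factorial : ℂ)) *
      wedge (fun i : Fin n => tauForms (pb2 (pot J Ω φ) χ z) (jhat J χ z) m i) b /
      wedge (fun _ : Fin n => fun u v => (pb2 Ω χ z u v : ℂ)) b).re := by
  have h := wedge_div_wedge_basis (n := n)
    (fun i => tauFormsL ((pot J Ω φ).bilAt (χ z)) (J.at (χ z)).toLinearMap m i)
    (fun _ => toComplexL (Ω.bilAt (χ z))) (b.map (hχ.tequiv hz)) (stdBasis n)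
  have hb : (stdBasis n : Fin (2 * n) → Model n) = stdFrame (χ z) :=
    funext fun i => stdBasis_apply i
  have hB : (fun x y : Model n => (pot J Ω φ).bilAt (χ z) x y) = fun X Y : Tan n (χ z) =>
        pot J Ω φ (χ z) ![X, Y] := by
    funext X Y
    exact (pot J Ω φ).bilAt_apply (χ z) X Y
  have h1 : wedge (fun i : Fin n => fun X Y : Tan n (χ z) =>
      if (i : ℕ) < 2 * m then
        (if (i : ℕ) % 2 = 0 then tau J Ω φ (χ z) X Y else (starRingEnd ℂ) (tau J Ω φ (χ z) X Y))
      else (H J Ω φ (χ z) X Y : ℂ)) (stdFrame (χ z)) = wedge (fun i : Fin n => fun x y =>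
        tauFormsL ((pot J Ω φ).bilAt (χ z)) (J.at (χ z)).toLinearMap m i x y) (stdBasis n) := by
    rw [hb]
    simp only [tauFormsL_apply, hB]
    rfl
  have h2 : wedge (fun _ : Fin n => fun X Y : Tan n (χ z) => (Ω (χ z) ![X, Y] : ℂ))
      (stdFrame (χ z)) =
      wedge (fun _ : Fin n => fun x y => toComplexL (Ω.bilAt (χ z)) x y) (stdBasis n) := by
    rw [hb]
    have : (fun x y : Model n => toComplexL (Ω.bilAt (χ z)) x y) = fun X Y : Tan n (χ z) =>
        (Ω (χ z) ![X, Y] : ℂ) := by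
      funext X Y
      exact congrArg Complex.ofReal (Ω.bilAt_apply (χ z) X Y)
    rw [this]
    rfl
  have h3 : wedge (fun i : Fin n => fun x y =>
        tauFormsL ((pot J Ω φ).bilAt (χ z)) (J.at (χ z)).toLinearMap m i x y)
        (b.map (hχ.tequiv hz)) =
        wedge (fun i : Fin n => tauForms (pb2 (pot J Ω φ) χ z) (jhat J χ z) m i) b := by
    simp only [wedge, Module.Basis.map_apply]
    congr 1
    refine Finset.sum_congr rfl fun σ _ => congrArg _ (Finset.prod_congr rfl fun i _ => ?_)
    rw [tauFormsL_apply, hB]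
    have e20 := P20_tmap J (pot J Ω φ) hχ hz (b (σ ⟨2 * i, by omega⟩)) (b (σ ⟨2 * i + 1, by omega⟩))
    have e11 := P11_tmap J (pot J Ω φ) hχ hz (b (σ ⟨2 * i, by omega⟩)) (b (σ ⟨2 * i + 1, by omega⟩))
    unfold tauForms
    rw [← e20, ← e11]
    rfl
  have h4 : wedge (fun _ : Fin n => fun x y => toComplexL (Ω.bilAt (χ z)) x y)
      (b.map (hχ.tequiv hz)) = wedge (fun _ : Fin n => fun u v => (pb2 Ω χ z u v : ℂ)) b := by
    simp only [wedge, Module.Basis.map_apply]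
    congr 1
    refine Finset.sum_congr rfl fun σ _ => congrArg _ (Finset.prod_congr rfl fun i _ => ?_)
    exact congrArg Complex.ofReal (Ω.bilAt_apply (χ z) _ _)
  rw [Fj, h1, h2, mul_div_assoc, h, h3, h4, mul_div_assoc]

end Coordinates

/-! ### The data at the centre p₀ -/

section Centre

variable {n : ℕ} {M : Type*} [TopologicalSpace M] [ChartedSpace (Model n) M]
  [IsManifold 𝓘(ℝ, Model n) ∞ M] {K : AKStructure n M} {hn : 2 ≤ n} {k : ℕ∞}

theorem Data.zero_mem (D : Data K hn k) : (0 : Fin n → ℂ) ∈ D.χ.source :=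
  D.polydisk_subset fun i => by simp

/-- The frame at the centre, in the model space. -/
noncomputable def Data.frameZero (D : Data K hn k) (α : Fin n) : Model n := D.ε α (D.χ 0)

theorem Data.tmap_re (D : Data K hn k) (α : Fin n) :
    tmap n D.χ 0 (Pi.single α (1 : ℂ)) = Real.sqrt 2 • D.frameZero α := D.coord_re α

theorem Data.tmap_im (D : Data K hn k) (α : Fin n) :
    tmap n D.χ 0 (Pi.single α Complex.I) =
      Real.sqrt 2 • K.J.at (D.χ 0) (D.frameZero α) := D.coord_im α

theorem AKStructure.sq_at (K : AKStructure n M) (p : M) (v : Model n) :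
    K.J.at p (K.J.at p v) = -v := K.sq_J p v

theorem jhat_jhat {E : Type*} [NormedAddCommGroup E] [NormedSpace ℝ E]
    {χ : OpenPartialHomeomorph E M} (K : AKStructure n M) (hχ : IsParam n χ) {z : E}
    (hz : z ∈ χ.source) (u : E) : jhat K.J χ z (jhat K.J χ z u) = -u := by
  rw [← hχ.tinv_tmap hz (jhat K.J χ z (jhat K.J χ z u)), hχ.jhat_tmap _ hz, hχ.jhat_tmap _ hz,
    K.sq_at, map_neg, hχ.tinv_tmap hz]

theorem single_I {n : ℕ} (a : Fin n) :
    (Pi.single a Complex.I : Fin n → ℂ) = Complex.I • Pi.single a 1 := by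
  rw [← Pi.single_smul]; simp

/-- At the centre the almost complex structure is the standard one. -/
theorem Data.jhat_zero (D : Data K hn k) (v : Fin n → ℂ) :
    jhat K.J D.χ 0 v = Complex.I • v := by
  have hχ := D.isParam
  have h1 : ∀ α : Fin n, jhat K.J D.χ 0 (Pi.single α 1) = Pi.single α Complex.I := fun α => by
    rw [← hχ.tinv_tmap D.zero_mem (jhat K.J D.χ 0 (Pi.single α 1)), hχ.jhat_tmap _ D.zero_mem,
      D.tmap_re, map_smul, ← D.tmap_im, hχ.tinv_tmap D.zero_mem]
  have h2 : ∀ α : Fin n, jhat K.J D.χ 0 (Pi.single α Complex.I) = -Pi.single α 1 := fun α => by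
    rw [← h1, jhat_jhat K hχ D.zero_mem]
  have : (jhat K.J D.χ 0).toLinearMap =
      (LinearMap.lsmul ℂ (Fin n → ℂ) Complex.I).restrictScalars ℝ := by
    refine (cbasis n).ext fun i => ?_
    obtain ⟨⟨a, s⟩, rfl⟩ := (pairEquiv n).surjective i
    rw [cbasis_apply]
    fin_cases s
    · simpa [← single_I] using h1 a
    · have : Complex.I • (Pi.single a Complex.I : Fin n → ℂ) = -Pi.single a 1 := by
        rw [single_I, smul_smul, Complex.I_mul_I, neg_one_smul]
      simpa [this] using h2 a
  exact congrArg (fun L : (Fin n → ℂ) →ₗ[ℝ] (Fin n → ℂ) => L v) this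

/-- The vectors ∂/∂x_a and ∂/∂y_a are √2 times the orthonormal frame, hence the factor 2. -/
theorem Data.bhat_zero (D : Data K hn k) (u v : Fin n → ℂ) :
    bhat K.Ω D.χ 0 u v = ∑ a, 2 * areaForm a u v := by
  have hχ := D.isParam
  have h2 : Real.sqrt 2 * Real.sqrt 2 = 2 := Real.mul_self_sqrt (by norm_num)
  have hmem : D.χ 0 ∈ D.χ.target := D.χ.map_source D.zero_mem
  refine eq_sum_area ((bhat K.Ω D.χ 0).toLinearMap₁₂) ?_ (fun _ => 2) ?_ ?_ u v
  · intro u v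
    change bhat K.Ω D.χ 0 _ _ = bhat K.Ω D.χ 0 _ _
    rw [← D.jhat_zero, ← D.jhat_zero, bhat_apply, bhat_apply, pb2, hχ.jhat_tmap _ D.zero_mem,
      hχ.jhat_tmap _ D.zero_mem]
    exact K.invariant _ _ _
  · intro a b
    change bhat K.Ω D.χ 0 _ _ = _
    rw [bhat_apply, pb2, D.tmap_re, D.tmap_re]
    have h := (D.orthonormal _ hmem a b).2
    rw [AKStructure.g, K.sq_J, form_neg_right, neg_eq_zero] at h
    change K.Ω (D.χ 0) ![Real.sqrt 2 • D.ε a (D.χ 0), Real.sqrt 2 • D.ε b (D.χ 0)] = 0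
    rw [form_smul_left, form_smul_right, h]
    ring
  · intro a b
    change bhat K.Ω D.χ 0 _ _ = _
    rw [bhat_apply, pb2, D.tmap_re, D.tmap_im]
    have h := (D.orthonormal _ hmem a b).1
    rw [AKStructure.g] at h
    change K.Ω (D.χ 0) ![Real.sqrt 2 • D.ε a (D.χ 0),
      Real.sqrt 2 • K.J (D.χ 0) (D.ε b (D.χ 0))] = _
    rw [form_smul_left, form_smul_right, h, ← mul_assoc, h2]
    split_ifs <;> ring

theorem Data.H_zero (D : Data K hn k) (u v : Fin n → ℂ) :
    H K.J K.Ω D.φ (D.χ 0) (tmap n D.χ 0 u) (tmap n D.χ 0 v) =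
      p11 (pb2 (pot K.J K.Ω D.φ) D.χ 0) (jhat K.J D.χ 0) u v :=
  P11_tmap K.J _ D.isParam D.zero_mem u v

theorem Data.two_le_smooth (D : Data K hn k) : ContMDiff 𝓘(ℝ, Model n) 𝓘(ℝ, ℝ) 2 D.φ :=
  D.smooth_φ.of_le two_le_infty

/-- The form `Ω(φ)` in the coordinates, at the centre. -/
noncomputable def Data.formZero (D : Data K hn k) : (Fin n → ℂ) →ₗ[ℝ] (Fin n → ℂ) →ₗ[ℝ] ℝ :=
  (ahat K.J K.Ω D.φ D.χ 0).toLinearMap₁₂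

theorem Data.formZero_apply (D : Data K hn k) (u v : Fin n → ℂ) :
    D.formZero u v = pb2 (pot K.J K.Ω D.φ) D.χ 0 u v :=
  (pb2_pot K.smooth_J K.Ω D.isParam D.two_le_smooth D.zero_mem u v).symm

/-- Multiplication by the imaginary unit. -/
noncomputable def mulI (n : ℕ) : (Fin n → ℂ) →ₗ[ℝ] (Fin n → ℂ) :=
  (LinearMap.lsmul ℂ (Fin n → ℂ) Complex.I).restrictScalars ℝ

theorem mulI_apply (v : Fin n → ℂ) : mulI n v = Complex.I • v := rfl

theorem mulI_mulI (v : Fin n → ℂ) : mulI n (mulI n v) = -v := by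
  rw [mulI_apply, mulI_apply, smul_smul, Complex.I_mul_I, neg_one_smul]

theorem p11L_apply {E : Type*} [AddCommGroup E] [Module ℝ E] (B : E →ₗ[ℝ] E →ₗ[ℝ] ℝ)
    (j : E →ₗ[ℝ] E) (u v : E) : p11L B j u v = (B u v + B (j u) (j v)) / 2 := rfl

theorem p20L_apply {E : Type*} [AddCommGroup E] [Module ℝ E] (B : E →ₗ[ℝ] E →ₗ[ℝ] ℝ)
    (j : E →ₗ[ℝ] E) (u v : E) : p20L B j u v =
      (((B u v - B (j u) (j v) : ℝ) : ℂ) - Complex.I * ((B (j u) v + B u (j v) : ℝ) : ℂ)) / 4 := rfl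

theorem p20L_left (B : (Fin n → ℂ) →ₗ[ℝ] (Fin n → ℂ) →ₗ[ℝ] ℝ) (u v : Fin n → ℂ) :
    p20L B (mulI n) (Complex.I • u) v = Complex.I * p20L B (mulI n) u v := by
  rw [← mulI_apply, p20L_apply, p20L_apply, mulI_mulI]
  simp only [map_neg, LinearMap.neg_apply]
  push_cast
  linear_combination ((B u (mulI n v) : ℂ) + B (mulI n u) v) / 4 * Complex.I_mul_I

theorem p20L_right (B : (Fin n → ℂ) →ₗ[ℝ] (Fin n → ℂ) →ₗ[ℝ] ℝ) (u v : Fin n → ℂ) :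
    p20L B (mulI n) u (Complex.I • v) = Complex.I * p20L B (mulI n) u v := by
  rw [← mulI_apply, p20L_apply, p20L_apply, mulI_mulI]
  simp only [map_neg]
  push_cast
  linear_combination ((B u (mulI n v) : ℂ) + B (mulI n u) v) / 4 * Complex.I_mul_I

theorem p11L_I (B : (Fin n → ℂ) →ₗ[ℝ] (Fin n → ℂ) →ₗ[ℝ] ℝ) (u v : Fin n → ℂ) :
    p11L B (mulI n) (Complex.I • u) (Complex.I • v) = p11L B (mulI n) u v := by
  rw [← mulI_apply, ← mulI_apply, p11L_apply, p11L_apply, mulI_mulI, mulI_mulI]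
  simp only [map_neg, LinearMap.neg_apply]
  ring

/-- The pairs encode (∂_x ∓ i ∂_y)/2: one half of √2 is 1/√2. -/
theorem Data.cext_smul_tmap (D : Data K hn k) (a : Fin n) :
    (eVec K (D.ε a (D.χ 0)) : Model n × Model n) =
      (tmap n D.χ 0 ((2 : ℝ)⁻¹ • Pi.single a 1),
        tmap n D.χ 0 (-((2 : ℝ)⁻¹ • mulI n (Pi.single a 1)))) ∧
    (eBar K (D.ε a (D.χ 0)) : Model n × Model n) =
      (tmap n D.χ 0 ((2 : ℝ)⁻¹ • Pi.single a 1),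
        tmap n D.χ 0 ((2 : ℝ)⁻¹ • mulI n (Pi.single a 1))) := by
  have h2 : (2 : ℝ)⁻¹ * Real.sqrt 2 = (Real.sqrt 2)⁻¹ := by
    rw [← Real.sqrt_div_self]; ring
  rw [mulI_apply, ← single_I]
  simp only [map_neg, map_smul, D.tmap_re, D.tmap_im, smul_smul, h2]
  exact ⟨rfl, rfl⟩

/-- For a J-invariant form G, the value on (∂/∂z_a, ∂/∂z̄_b) is (G(∂x_a, ∂x_b) + i G(∂x_a, ∂y_b))/2.
The diagonality in the data therefore gives both families of values by real and imaginary parts. -/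
theorem Data.p11_formZero (D : Data K hn k) (u v : Fin n → ℂ) :
    p11L D.formZero (mulI n) u v = ∑ a, 2 * D.lam a * areaForm a u v := by
  have hH : ∀ u v : Fin n → ℂ, H K.J K.Ω D.φ (D.χ 0) (tmap n D.χ 0 u) (tmap n D.χ 0 v) =
      p11L D.formZero (mulI n) u v := fun u v => by
    rw [D.H_zero, p11L_apply, p11]
    simp only [D.formZero_apply, D.jhat_zero, mulI_apply]
  set G := p11L D.formZero (mulI n) with hG
  have hI : ∀ u v, G (Complex.I • u) (Complex.I • v) = G u v := p11L_I _
  have key : ∀ a b, ((G (Pi.single a 1) (Pi.single b 1) : ℝ) : ℂ) +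
      Complex.I * (G (Pi.single a 1) (Pi.single b Complex.I) : ℝ) =
      2 * if a = b then Complex.I * (D.lam a : ℂ) else 0 := fun a b => by
    rw [← D.diag a b]
    have e1 : eVec K (D.ε a (D.χ 0)) = _ := (D.cext_smul_tmap a).1
    have e2 : eBar K (D.ε b (D.χ 0)) = _ := (D.cext_smul_tmap b).2
    rw [e1, e2]
    have h3 : ∀ u v : Fin n → ℂ, G (mulI n u) v = - G u (mulI n v) := fun u v => by
      have := hI u (mulI n v)
      rw [← mulI_apply, ← mulI_apply, mulI_mulI, map_neg] at this
      linarith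
    simp only [cext]
    erw [hH, hH, hH, hH]
    simp only [map_neg, map_smul, LinearMap.neg_apply, LinearMap.smul_apply, h3, mulI_mulI, smul_eq_mul]
    rw [single_I b, ← mulI_apply]
    push_cast
    ring
  refine eq_sum_area G hI (fun a => 2 * D.lam a) ?_ ?_ u v
  · intro a b
    have := congrArg Complex.re (key a b)
    split_ifs at this <;> simpa using this
  · intro a b
    have := congrArg Complex.im (key a b)
    split_ifs at this ⊢ <;> simpa using this

/-- By complex bilinearity the value of τ(φ) on (e₁, e₂) is determined by its value on (∂/∂x₁,
∂/∂x₂), and the former is bounded away from 0 at z = 0. -/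
theorem Data.p20_formZero_ne (D : Data K hn k) :
    p20L D.formZero (mulI n) (Pi.single ⟨0, by omega⟩ 1) (Pi.single ⟨1, by omega⟩ 1) ≠ 0 := by
  have hH : ∀ u v : Fin n → ℂ, tau K.J K.Ω D.φ (D.χ 0) (tmap n D.χ 0 u) (tmap n D.χ 0 v) =
      p20L D.formZero (mulI n) u v := fun u v => by
    rw [p20L_apply]
    refine (P20_tmap K.J _ D.isParam D.zero_mem u v).trans ?_
    simp only [p20, D.formZero_apply, D.jhat_zero, mulI_apply]
  obtain ⟨e, he, h⟩ := D.tau_12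
  have h0 := h 0 fun i => by simp
  intro hz
  have e1 : eVec K (D.ε ⟨0, by omega⟩ (D.χ 0)) = _ := (D.cext_smul_tmap _).1
  have e2 : eVec K (D.ε ⟨1, by omega⟩ (D.χ 0)) = _ := (D.cext_smul_tmap _).1
  rw [e1, e2] at h0
  have hl : ∀ u v, p20L D.formZero (mulI n) (mulI n u) v = Complex.I * p20L D.formZero (mulI n) u v :=
    p20L_left _
  have hr : ∀ u v, p20L D.formZero (mulI n) u (mulI n v) = Complex.I * p20L D.formZero (mulI n) u v :=
    p20L_right _
  simp only [cext] at h0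
  erw [hH, hH, hH, hH] at h0
  simp only [map_neg, map_smul, LinearMap.neg_apply, LinearMap.smul_apply, hl, hr, hz] at h0
  simp at h0
  linarith

theorem Data.formZero_pos (D : Data K hn k) {u : Fin n → ℂ} (hu : u ≠ 0) :
    0 < D.formZero u (Complex.I • u) := by
  have h := (hPos_iff_tames K.sq_J K.Ω D.φ).1 D.hpos (D.χ 0) (tmap n D.χ 0 u) fun h => hu (by
    rw [← D.isParam.tinv_tmap D.zero_mem u]
    exact (congrArg (tinv n D.χ 0) h).trans (map_zero _))
  rw [D.formZero_apply, ← D.jhat_zero, pb2, D.isParam.jhat_tmap _ D.zero_mem]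
  exact h

theorem p11L_self_I (B : (Fin n → ℂ) →ₗ[ℝ] (Fin n → ℂ) →ₗ[ℝ] ℝ) (hB : ∀ u, B u u = 0)
    (u : Fin n → ℂ) : p11L B (mulI n) u (Complex.I • u) = B u (Complex.I • u) := by
  have h := hB (u + Complex.I • u)
  simp only [map_add, LinearMap.add_apply, hB] at h
  rw [← mulI_apply] at h ⊢
  rw [p11L_apply, mulI_mulI, map_neg]
  linarith

theorem Data.formZero_self (D : Data K hn k) (u : Fin n → ℂ) : D.formZero u u = 0 := by
  rw [D.formZero_apply]
  exact form_self _ _ _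

/-- The value of Ω(φ) on (∂x_a, J ∂x_a) at p₀ is 2 λ_a. -/
theorem Data.lam_pos (D : Data K hn k) (a : Fin n) : 0 < D.lam a := by
  have h := D.formZero_pos (u := Pi.single a 1) (by simp)
  rw [← p11L_self_I _ D.formZero_self, D.p11_formZero, Finset.sum_eq_single a] at h
  · rw [areaForm_self_I] at h
    simp at h
    exact h
  · intro b _ hb
    simp [areaForm, hb]
  · simp

end Centre

/-! ### Degeneration at the centre for s = 1 -/

section Degeneracy

variable {n : ℕ} {M : Type*} [TopologicalSpace M] [ChartedSpace (Model n) M]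
  [IsManifold 𝓘(ℝ, Model n) ∞ M] {K : AKStructure n M} {hn : 2 ≤ n} {k : ℕ∞}

theorem Data.contMDiff_two_psi [T2Space M] (D : Data K hn k) (hk : 2 ≤ k) {R : ℝ} (hR : 1 ≤ R) :
    ContMDiff 𝓘(ℝ, Model n) 𝓘(ℝ, ℝ) 2 (D.psi R) :=
  (D.contMDiff_psi hR).of_le (two_le_coe hk)

theorem Data.dhat_psi [T2Space M] (D : Data K hn k) (hk : 2 ≤ k) {R : ℝ} (hR : 1 ≤ R)
    {z : Fin n → ℂ} (hz : z ∈ D.χ.source) (u v : Fin n → ℂ) :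
    dhat K.J (D.psi R) D.χ z u v =
      fderiv ℝ (fderiv ℝ (D.psiFlat R)) z u (jhat K.J D.χ z v)
        - fderiv ℝ (fderiv ℝ (D.psiFlat R)) z v (jhat K.J D.χ z u)
        + fderiv ℝ (D.psiFlat R) z
          (fderiv ℝ (jhat K.J D.χ) z u v - fderiv ℝ (jhat K.J D.χ) z v u) := by
  have h : D.psi R ∘ D.χ =ᶠ[𝓝 z] D.psiFlat R := by
    filter_upwards [D.χ.open_source.mem_nhds hz] with y hy
    exact D.psi_chi (one_pos.trans_le hR) hy
  rw [dhat_apply K.smooth_J D.isParam (D.contMDiff_two_psi hk hR) hz, h.fderiv.fderiv_eq,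
    h.fderiv_eq]

theorem Data.ahat_add [T2Space M] (D : Data K hn k) (hk : 2 ≤ k) {R : ℝ} (hR : 1 ≤ R) (s : ℝ)
    {z : Fin n → ℂ} (hz : z ∈ D.χ.source) (u v : Fin n → ℂ) :
    ahat K.J K.Ω (fun p => D.φ p + s * D.psi R p) D.χ z u v =
      ahat K.J K.Ω D.φ D.χ z u v + s * dhat K.J (D.psi R) D.χ z u v := by
  simp only [ahat]
  rw [dhat_add_smul K.smooth_J D.isParam D.two_le_smooth (D.contMDiff_two_psi hk hR) s hz]
  simp only [add_apply, smul_apply, smul_eq_mul]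
  ring

theorem Data.profile_eventuallyEq (D : Data K hn k) (l : ℝ) :
    fderiv ℝ (D.profile l) =ᶠ[𝓝 0] (l • innerSL ℝ : ℂ →L[ℝ] ℂ →L[ℝ] ℝ) := by
  have h : D.profile l =ᶠ[𝓝 0] fun w => l / 2 * ‖w‖ ^ 2 := by
    filter_upwards [Metric.ball_mem_nhds (0 : ℂ) (show (0 : ℝ) < 1 / 2 by norm_num)] with w hw
    rw [Data.profile, D.η_one _ (by simpa using (mem_ball_zero_iff.1 hw).le), mul_one]
  filter_upwards [h.fderiv (𝕜 := ℝ)] with w hw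
  have h2 : HasFDerivAt (fun w : ℂ => ‖w‖ ^ 2) (2 • innerSL ℝ w) w :=
    (hasStrictFDerivAt_norm_sq w).hasFDerivAt
  rw [hw, (h2.const_mul (l / 2)).fderiv]
  ext v
  simp
  ring

theorem Data.fderiv_profile_zero (D : Data K hn k) (l : ℝ) : fderiv ℝ (D.profile l) 0 = 0 := by
  rw [(D.profile_eventuallyEq l).eq_of_nhds]
  exact map_zero _

theorem Data.fderiv_fderiv_profile_zero (D : Data K hn k) (l : ℝ) (u v : ℂ) :
    fderiv ℝ (fderiv ℝ (D.profile l)) 0 u v = l * (starRingEnd ℂ u * v).re := by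
  rw [(D.profile_eventuallyEq l).fderiv_eq, ContinuousLinearMap.fderiv]
  change l * inner ℝ u v = _
  rw [Complex.inner, mul_comm v]

/-- All cut-offs are 1 near the centre, so there ψ_R is the quadratic ∑ (λ_i/2)|z_i|². Its gradient
vanishes at 0, which removes the term with the derivative of J, and ∂x₁ and ∂y₁ each contribute -λ₁.
-/
theorem Data.dhat_psi_zero [T2Space M] (D : Data K hn k) (hk : 2 ≤ k) {R : ℝ} (hR : 1 ≤ R) :
    dhat K.J (D.psi R) D.χ 0 (Pi.single ⟨0, by omega⟩ 1)
      (Complex.I • Pi.single ⟨0, by omega⟩ 1) = - (2 * D.lam ⟨0, by omega⟩) := by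
  have hR0 : 0 < R := one_pos.trans_le hR
  have hP : fderiv ℝ D.phiOne 0 = 0 := by
    ext w
    rw [D.fderiv_phiOne hk]
    simp [D.fderiv_profile_zero]
  have hP0 : D.phiOne 0 = 0 := by simp [Data.phiOne, Data.profile]
  have hC0 : D.cutoff 0 = 1 := by
    rw [Data.cutoff]
    exact Finset.prod_eq_one fun i _ => by rw [D.η_one]; simp
  have hD1 : fderiv ℝ (D.psiFlat R) 0 = 0 := by
    have := (hasFDerivAt_scaled (D.contDiff_two_phiOne hk) (D.contDiff_two_cutoff hk) hR0 0).fderiv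
    refine Eq.trans this ?_
    simp [hP, hP0]
  have hD2 : ∀ u w, fderiv ℝ (fderiv ℝ (D.psiFlat R)) 0 u w =
      fderiv ℝ (fderiv ℝ D.phiOne) 0 u w := fun u w => by
    refine (fderiv_fderiv_scaled (D.contDiff_two_phiOne hk) (D.contDiff_two_cutoff hk) hR0
      0 u w).trans ?_
    simp [hP, hP0, hC0]
  have h10 : (⟨1, by omega⟩ : Fin n) ≠ ⟨0, by omega⟩ := by simp
  rw [D.dhat_psi hk hR D.zero_mem, D.jhat_zero, D.jhat_zero, hD1, hD2, hD2,
    D.fderiv_fderiv_phiOne hk, D.fderiv_fderiv_phiOne hk]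
  simp [D.fderiv_fderiv_profile_zero, h10]
  ring

theorem areaForm_single_self (a : Fin n) :
    areaForm a (Pi.single a 1) (Complex.I • Pi.single a 1) = 1 := by
  rw [areaForm_self_I]; simp

theorem sum_areaForm_single (t : Fin n → ℝ) (a : Fin n) :
    ∑ b, t b * areaForm b (Pi.single a 1) (Complex.I • Pi.single a 1) = t a := by
  rw [Finset.sum_eq_single a]
  · rw [areaForm_single_self, mul_one]
  · intro b _ hb
    simp [areaForm, hb]
  · simp

/-- At p₀, in the direction ∂x₁, the value 2λ₁ of Ω(φ) is cancelled exactly by -2λ₁. -/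
theorem Data.not_tames_one [T2Space M] (D : Data K hn k) (hk : 2 ≤ k) {R : ℝ} (hR : 1 ≤ R) :
    ¬ Tames K.J (pot K.J K.Ω (fun p => D.φ p + 1 * D.psi R p)) := by
  intro h
  have hsm : ContMDiff 𝓘(ℝ, Model n) 𝓘(ℝ, ℝ) 2 (fun p => D.φ p + 1 * D.psi R p) :=
    D.two_le_smooth.add (contMDiff_const.mul (D.contMDiff_two_psi hk hR))
  set x : Fin n → ℂ := Pi.single ⟨0, by omega⟩ 1 with hx
  have hne : tmap n D.χ 0 x ≠ 0 := fun h0 => by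
    have := D.isParam.tinv_tmap D.zero_mem x
    rw [h0, map_zero] at this
    simpa [hx] using congrFun this ⟨0, by omega⟩
  have h1 : 0 < pb2 (pot K.J K.Ω (fun p => D.φ p + 1 * D.psi R p)) D.χ 0 x
      (jhat K.J D.χ 0 x) := by
    rw [pb2, D.isParam.jhat_tmap _ D.zero_mem]
    exact h (D.χ 0) (tmap n D.χ 0 x) hne
  rw [pb2_pot K.smooth_J K.Ω D.isParam hsm D.zero_mem, D.ahat_add hk hR 1 D.zero_mem,
    D.jhat_zero, D.dhat_psi_zero hk hR] at h1
  have h2 : ahat K.J K.Ω D.φ D.χ 0 x (Complex.I • x) = 2 * D.lam ⟨0, by omega⟩ := by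
    change D.formZero x (Complex.I • x) = _
    rw [← p11L_self_I _ D.formZero_self, D.p11_formZero, hx, sum_areaForm_single]
  rw [h2] at h1
  linarith

theorem Data.amp_spec [T2Space M] [CompactSpace M] (D : Data K hn k) (hk : 2 ≤ k) {R : ℝ}
    (hR : 1 ≤ R) :
    0 < D.amp R ∧ D.amp R ≤ 1 ∧
    (∀ s, 0 ≤ s → s < D.amp R → Tames K.J (pot K.J K.Ω (fun p => D.φ p + s * D.psi R p))) ∧
    ¬ Tames K.J (pot K.J K.Ω (D.phiR R)) ∧
    ∀ (p : M) (v : Tan n p), 0 ≤ pot K.J K.Ω (D.phiR R) p ![v, K.J p v] :=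
  amplitude_spec K.smooth_J K.sq_J K.smooth_Ω D.two_le_smooth (D.contMDiff_two_psi hk hR)
    ((hPos_iff_tames K.sq_J K.Ω D.φ).1 D.hpos) (D.not_tames_one hk hR)

end Degeneracy

/-! ### The limiting two-form -/

section Limit

variable {n : ℕ} {M : Type*} [TopologicalSpace M] [ChartedSpace (Model n) M]
  [IsManifold 𝓘(ℝ, Model n) ∞ M] {K : AKStructure n M} {hn : 2 ≤ n} {k : ℕ∞}

/-- The left side is alternating on a real plane, hence a multiple of the area form; the factor is
the value at (1, i). -/
theorem hessian_area (q : ℂ →L[ℝ] ℂ →L[ℝ] ℝ) (u v : ℂ) :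
    q u (Complex.I * v) - q v (Complex.I * u) =
      (-(q 1 1) - q Complex.I Complex.I) * (starRingEnd ℂ u * v).im := by
  have hd : ∀ w : ℂ, w = w.re • (1 : ℂ) + w.im • Complex.I := fun w => by
    simp [Complex.re_add_im]
  have hI : ∀ w : ℂ, Complex.I * w = (-w.im) • (1 : ℂ) + w.re • Complex.I := fun w => by
    apply Complex.ext <;> simp
  rw [hI, hI]
  conv_lhs => rw [hd u, hd v]
  simp only [map_add, map_smul, add_apply, smul_apply, smul_eq_mul]
  simp
  ring

/-- In the limit J becomes i and the gradient term disappears, so each limiting Hessian in one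
variable contributes a multiple of dx_i ∧ dy_i. The correction is thus diagonal of type (1,1) and
confined to the first two directions. The arguments u, w may vary, so that vectors J(z)u can be
inserted. -/
theorem Data.exists_limit_form [T2Space M] (D : Data K hn k) (hk : 2 ≤ k)
    (U : Ultrafilter (ℝ × (Fin n → ℂ)))
    (hU : (U : Filter (ℝ × (Fin n → ℂ))) ≤ shrinking n) (a : ℝ × (Fin n → ℂ) → ℝ)
    (ha : ∀ᶠ x in (U : Filter (ℝ × (Fin n → ℂ))), ‖a x‖ ≤ 1) :
    ∃ c : Fin n → ℝ, (∀ i : Fin n, 2 ≤ (i : ℕ) → c i = 0) ∧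
      ∀ (u w : ℝ × (Fin n → ℂ) → Fin n → ℂ) (u' w' : Fin n → ℂ),
        Filter.Tendsto u U (𝓝 u') → Filter.Tendsto w U (𝓝 w') →
        Filter.Tendsto (fun x => ahat K.J K.Ω (fun p => D.φ p + a x * D.psi x.1 p) D.χ x.2
          (u x) (w x)) U (𝓝 (D.formZero u' w' + ∑ i, c i * areaForm i u' w')) := by
  obtain ⟨q₀, q₁, h2, h1⟩ := D.exists_limits hk U hU a ha
  have h01 : (⟨0, by omega⟩ : Fin n) ≠ ⟨1, by omega⟩ := by simp
  let c : Fin n → ℝ := fun i => if i = ⟨0, by omega⟩ then -(q₀ 1 1) - q₀ Complex.I Complex.I else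
    if i = ⟨1, by omega⟩ then -(q₁ 1 1) - q₁ Complex.I Complex.I else 0
  refine ⟨c, ?_, ?_⟩
  · intro i hi
    have e0 : i ≠ ⟨0, by omega⟩ := fun h => by rw [h] at hi; simp at hi
    have e1 : i ≠ ⟨1, by omega⟩ := fun h => by rw [h] at hi; simp at hi
    simp [c, e0, e1]
  intro u w u' w' hu hw
  have hz : Filter.Tendsto (fun x : ℝ × (Fin n → ℂ) => x.2) U (𝓝 0) :=
    (shrinking_snd n).mono_left hU
  have hsrc := D.χ.open_source.mem_nhds D.zero_mem
  have hj := contDiffOn_jhat K.smooth_J D.isParam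
  have hjt : Filter.Tendsto (fun x : ℝ × (Fin n → ℂ) => jhat K.J D.χ x.2) U
      (𝓝 (jhat K.J D.χ 0)) := (hj.continuousOn.continuousAt hsrc).tendsto.comp hz
  have hdjt : Filter.Tendsto (fun x : ℝ × (Fin n → ℂ) => fderiv ℝ (jhat K.J D.χ) x.2) U
      (𝓝 (fderiv ℝ (jhat K.J D.χ) 0)) :=
    ((hj.continuousOn_fderiv_of_isOpen D.χ.open_source (by simp)).continuousAt hsrc).tendsto.comp hz
  have hat : Filter.Tendsto (fun x : ℝ × (Fin n → ℂ) => ahat K.J K.Ω D.φ D.χ x.2) U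
      (𝓝 (ahat K.J K.Ω D.φ D.χ 0)) :=
    ((continuousOn_ahat K.smooth_J K.smooth_Ω D.isParam D.two_le_smooth).continuousAt
      hsrc).tendsto.comp hz
  have hju := hjt.clm_apply hu
  have hjw := hjt.clm_apply hw
  have t1 := (hat.clm_apply hu).clm_apply hw
  have t2 := h2 u _ u' _ hu hjw
  have t3 := h2 w _ w' _ hw hju
  have t4 := h1 _ _ (((hdjt.clm_apply hu).clm_apply hw).sub ((hdjt.clm_apply hw).clm_apply hu))
  have ht := t1.add ((t2.sub t3).add t4)
  have hlim : ahat K.J K.Ω D.φ D.χ 0 u' w' +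
      ((q₀ (u' ⟨0, by omega⟩) (jhat K.J D.χ 0 w' ⟨0, by omega⟩) +
        q₁ (u' ⟨1, by omega⟩) (jhat K.J D.χ 0 w' ⟨1, by omega⟩)) -
      (q₀ (w' ⟨0, by omega⟩) (jhat K.J D.χ 0 u' ⟨0, by omega⟩) +
        q₁ (w' ⟨1, by omega⟩) (jhat K.J D.χ 0 u' ⟨1, by omega⟩)) + 0) =
      D.formZero u' w' + ∑ i, c i * areaForm i u' w' := by
    have e0 := hessian_area q₀ (u' ⟨0, by omega⟩) (w' ⟨0, by omega⟩)
    have e1 := hessian_area q₁ (u' ⟨1, by omega⟩) (w' ⟨1, by omega⟩)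
    have hsum : ∑ i, c i * areaForm i u' w' =
        c ⟨0, by omega⟩ * areaForm ⟨0, by omega⟩ u' w' +
        c ⟨1, by omega⟩ * areaForm ⟨1, by omega⟩ u' w' := by
      refine Fintype.sum_eq_add _ _ h01 fun i hi => ?_
      simp [c, hi.1, hi.2]
    have hc0 : c ⟨0, by omega⟩ = -(q₀ 1 1) - q₀ Complex.I Complex.I := by simp [c]
    have hc1 : c ⟨1, by omega⟩ = -(q₁ 1 1) - q₁ Complex.I Complex.I := by simp [c]
    have hA : ahat K.J K.Ω D.φ D.χ 0 u' w' = D.formZero u' w' := rfl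
    rw [hsum, D.jhat_zero, D.jhat_zero, hc0, hc1, hA, areaForm, areaForm]
    simp only [Pi.smul_apply, smul_eq_mul]
    linarith
  rw [hlim] at ht
  refine ht.congr' ?_
  have hR := ((shrinking_fst n).mono_left hU).eventually (Filter.eventually_ge_atTop 1)
  filter_upwards [hR, hz hsrc] with x hx hx2
  rw [D.ahat_add hk hx _ hx2, D.dhat_psi hk hx hx2]
  ring

end Limit

/-! ### Positivity for semidefinite forms with nonzero (2,0)-part -/

section LinearAlgebra

variable {n : ℕ}

theorem eq_p11_add_p20 {E : Type*} [AddCommGroup E] [Module ℝ E] (B : E →ₗ[ℝ] E →ₗ[ℝ] ℝ)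
    (j : E →ₗ[ℝ] E) (u v : E) : B u v = p11L B j u v + 2 * (p20L B j u v).re := by
  rw [p11L_apply, p20L_apply]
  simp
  ring

theorem p20L_swap {E : Type*} [AddCommGroup E] [Module ℝ E] (B : E →ₗ[ℝ] E →ₗ[ℝ] ℝ)
    (hB : ∀ u, B u u = 0) (j : E →ₗ[ℝ] E) (u v : E) : p20L B j u v = - p20L B j v u := by
  have h : ∀ u v, B u v = - B v u := fun u v => by
    have := hB (u + v)
    simp only [map_add, LinearMap.add_apply, hB] at this
    linarith
  rw [p20L_apply, p20L_apply, h u v, h (j u) (j v), h (j u) v, h u (j v)]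
  push_cast
  ring

theorem p20L_smul_left (B : (Fin n → ℂ) →ₗ[ℝ] (Fin n → ℂ) →ₗ[ℝ] ℝ) (c : ℂ) (u v : Fin n → ℂ) :
    p20L B (mulI n) (c • u) v = c * p20L B (mulI n) u v := by
  have h : c • u = c.re • u + c.im • (Complex.I • u) := by
    funext a
    simp only [Pi.add_apply, Pi.smul_apply, smul_eq_mul, Complex.real_smul]
    linear_combination (-u a) * Complex.re_add_im c
  rw [h, map_add, map_smul, map_smul, LinearMap.add_apply, LinearMap.smul_apply,
    LinearMap.smul_apply, p20L_left]
  conv_rhs => rw [← Complex.re_add_im c]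
  simp only [Complex.real_smul]
  ring

/-- A two-form on `ℂⁿ` with diagonal nonnegative `(1,1)`-part, degenerate at most in the first two
coordinate directions, and with nonzero `(2,0)`-part in these directions, has a positive top
power. -/
theorem wedge_pos_of_tau_ne (hn : 2 ≤ n) (B : (Fin n → ℂ) →ₗ[ℝ] (Fin n → ℂ) →ₗ[ℝ] ℝ)
    (hB : ∀ u, B u u = 0) (t : Fin n → ℝ) (ht : ∀ i, 0 ≤ t i)
    (ht' : ∀ i : Fin n, 2 ≤ (i : ℕ) → 0 < t i)
    (h11 : ∀ u v, p11L B (mulI n) u v = ∑ a, t a * areaForm a u v)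
    (h20 : p20L B (mulI n) (Pi.single ⟨0, by omega⟩ 1) (Pi.single ⟨1, by omega⟩ 1) ≠ 0) :
    0 < wedge (fun _ : Fin n => fun u v => B u v) (cbasis n) /
      wedge (fun _ : Fin n => fun u v => ∑ a, 2 * areaForm a u v) (cbasis n) := by
  have hB2 : (fun u v : Fin n → ℂ => ∑ a, 2 * areaForm a u v) =
      fun u v => (∑ a : Fin n, (2 : ℝ) • areaL a : (Fin n → ℂ) →ₗ[ℝ] (Fin n → ℂ) →ₗ[ℝ] ℝ) u v := by
    funext u v
    simp [areaL_apply]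
  rw [hB2]
  refine wedge_div_wedge_pos (cbasis n) B _ hB (fun u => by simp [areaL_apply, areaForm_self])
    fun s hs u hu => ?_
  have hsum : ∀ v, (1 - s) * B u v + s * ∑ a, 2 * areaForm a u v = 0 := fun v => by
    have := congrArg (fun L : (Fin n → ℂ) →ₗ[ℝ] ℝ => L v) hu
    simpa [areaL_apply] using this
  have h0 := hsum (Complex.I • u)
  rw [← p11L_self_I B hB, h11, Finset.mul_sum, Finset.mul_sum, ← Finset.sum_add_distrib] at h0
  simp only [areaForm_self_I] at h0
  -- Evaluating the kernel condition on (u, iu) leaves a sum of nonnegative terms, so each vanishes.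
  have hterm : ∀ a, (1 - s) * (t a * ‖u a‖ ^ 2) + s * (2 * ‖u a‖ ^ 2) = 0 := fun a => by
    refine (Finset.sum_eq_zero_iff_of_nonneg fun a _ => ?_).1 h0 a (Finset.mem_univ a)
    have := mul_nonneg (sub_nonneg.2 hs.2) (mul_nonneg (ht a) (sq_nonneg ‖u a‖))
    have := mul_nonneg hs.1 (mul_nonneg (zero_le_two (α := ℝ)) (sq_nonneg ‖u a‖))
    linarith
  have hcases : ∀ a, u a = 0 ∨ (1 - s) * t a + s * 2 = 0 := fun a => by
    have h : ((1 - s) * t a + s * 2) * ‖u a‖ ^ 2 = 0 := by linarith [hterm a]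
    rcases mul_eq_zero.1 h with h | h
    · exact Or.inr h
    · exact Or.inl (by simpa using h)
  -- At the end s = 0 the kernel of B itself is at stake: the (1,1)-part kills u, hence Re τ(u, ·) =
  -- 0, and replacing v by iv gives τ(u, ·) = 0. As u lies in the first two directions, τ₁₂ ≠ 0
  -- forces u = 0. For s > 0 the standard form makes the sum definite.
  rcases hs.1.eq_or_lt with rfl | hspos
  · have h11u : ∀ v, p11L B (mulI n) u v = 0 := fun v => by
      rw [h11]
      refine Finset.sum_eq_zero fun a _ => ?_
      rcases hcases a with h | h
      · simp [areaForm, h]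
      · have : t a = 0 := by linarith
        simp [this]
    have hre : ∀ v, (p20L B (mulI n) u v).re = 0 := fun v => by
      have h1 := eq_p11_add_p20 B (mulI n) u v
      have h2 := hsum v
      rw [h11u] at h1
      linarith
    have hT : ∀ v, p20L B (mulI n) u v = 0 := fun v => by
      have h1 := hre (Complex.I • v)
      rw [p20L_right] at h1
      apply Complex.ext
      · exact hre v
      · simpa using h1
    have hu2 : ∀ a : Fin n, 2 ≤ (a : ℕ) → u a = 0 := fun a ha => by
      rcases hcases a with h | h
      · exact h
      · exact absurd h (by have := ht' a ha; linarith)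
    have h01 : (⟨0, by omega⟩ : Fin n) ≠ ⟨1, by omega⟩ := by simp
    have hdecomp : u = u ⟨0, by omega⟩ • (Pi.single ⟨0, by omega⟩ 1 : Fin n → ℂ) +
        u ⟨1, by omega⟩ • (Pi.single ⟨1, by omega⟩ 1 : Fin n → ℂ) := by
      funext a
      by_cases ha0 : a = ⟨0, by omega⟩
      · subst ha0; simp
      · by_cases ha1 : a = ⟨1, by omega⟩
        · subst ha1; simp
        · rw [hu2 a]
          · simp [ha0, ha1]
          · have h0 : (a : ℕ) ≠ 0 := fun h => ha0 (Fin.ext h)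
            have h1 : (a : ℕ) ≠ 1 := fun h => ha1 (Fin.ext h)
            omega
    have hexp : ∀ v, p20L B (mulI n) u v =
        u ⟨0, by omega⟩ * p20L B (mulI n) (Pi.single ⟨0, by omega⟩ 1) v +
        u ⟨1, by omega⟩ * p20L B (mulI n) (Pi.single ⟨1, by omega⟩ 1) v := fun v => by
      conv_lhs => rw [hdecomp]
      rw [map_add, LinearMap.add_apply, p20L_smul_left, p20L_smul_left]
    have hskew : ∀ w, p20L B (mulI n) w w = 0 := fun w => by
      have := p20L_swap B hB (mulI n) w w
      exact self_eq_neg.1 this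
    have e1 := hexp (Pi.single ⟨1, by omega⟩ 1)
    have e0 := hexp (Pi.single ⟨0, by omega⟩ 1)
    rw [hT, hskew, mul_zero, add_zero] at e1
    rw [hT, hskew, mul_zero, zero_add, p20L_swap B hB] at e0
    have u0 : u ⟨0, by omega⟩ = 0 := (mul_eq_zero.1 e1.symm).resolve_right h20
    have u1 : u ⟨1, by omega⟩ = 0 :=
      (mul_eq_zero.1 e0.symm).resolve_right (neg_ne_zero.2 h20)
    rw [hdecomp, u0, u1]
    simp
  · funext a
    rcases hcases a with h | h
    · exact h
    · have := mul_nonneg (sub_nonneg.2 hs.2) (ht a)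
      linarith

/-- The factorials and the denominator n! 2ⁿ are positive reals, so only the sign of τ ∧ conj τ ∧
Hⁿ⁻² matters, with T_ab the values of the (2,0)-part on the vectors ∂x_a. -/
theorem re_wedge_tauForms_pos (hn : 2 ≤ n) (B : (Fin n → ℂ) →ₗ[ℝ] (Fin n → ℂ) →ₗ[ℝ] ℝ)
    (hB : ∀ u, B u u = 0) (t : Fin n → ℝ) (ht : ∀ i, 0 ≤ t i)
    (ht' : ∀ i : Fin n, 2 ≤ (i : ℕ) → 0 < t i)
    (h11 : ∀ u v, p11L B (mulI n) u v = ∑ a, t a * areaForm a u v)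
    (h20 : p20L B (mulI n) (Pi.single ⟨0, by omega⟩ 1) (Pi.single ⟨1, by omega⟩ 1) ≠ 0) :
    0 < ((n.factorial : ℂ) / (((1 : ℕ).factorial : ℂ) ^ 2 * ((n - 2 * 1).factorial : ℂ)) *
      wedge (fun i : Fin n => tauForms (fun u v => B u v) (mulI n) 1 i) (cbasis n) /
      wedge (fun _ : Fin n => fun u v => ((∑ a, 2 * areaForm a u v : ℝ) : ℂ)) (cbasis n)).re := by
  have h1 : (fun i : Fin n => tauForms (fun u v => B u v) (mulI n) 1 i) = fun (i : Fin n) u v =>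
      if (i : ℕ) < 2 * 1 then
        (if (i : ℕ) % 2 = 0 then ∑ a, ∑ b, p20L B (mulI n) (Pi.single a 1) (Pi.single b 1) * u a * v b
          else starRingEnd ℂ
            (∑ a, ∑ b, p20L B (mulI n) (Pi.single a 1) (Pi.single b 1) * u a * v b))
      else ((∑ a, t a * areaForm a u v : ℝ) : ℂ) := by
    funext i u v
    rw [← h11, ← eq_sum_coeff (p20L B (mulI n)) (p20L_left B) (p20L_right B) u v]
    rfl
  have hpos := re_wedge_tau_pos hn (fun a b => p20L B (mulI n) (Pi.single a 1) (Pi.single b 1))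
    (fun a b => p20L_swap B hB _ _ _) h20 t ht ht'
  rw [h1, wedge_area_eq (fun _ => 2)]
  set W := wedge (fun (i : Fin n) (u v : Fin n → ℂ) =>
      if (i : ℕ) < 2 * 1 then
        (if (i : ℕ) % 2 = 0 then ∑ a, ∑ b, p20L B (mulI n) (Pi.single a 1) (Pi.single b 1) * u a * v b
          else starRingEnd ℂ
            (∑ a, ∑ b, p20L B (mulI n) (Pi.single a 1) (Pi.single b 1) * u a * v b))
      else ((∑ a, t a * areaForm a u v : ℝ) : ℂ)) (cbasis n) with hW
  have h2 : (n.factorial : ℂ) / (((1 : ℕ).factorial : ℂ) ^ 2 * ((n - 2 * 1).factorial : ℂ)) *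
      W / ((n.factorial * ∏ _a : Fin n, (2 : ℝ) : ℝ) : ℂ) =
      ((n.factorial / ((n - 2 * 1).factorial * (n.factorial * ∏ _a : Fin n, (2 : ℝ))) : ℝ) : ℂ)
        * W := by
    push_cast [Nat.factorial_one]
    have : ((n - 2 * 1).factorial : ℂ) ≠ 0 := Nat.cast_ne_zero.2 (Nat.factorial_ne_zero _)
    have h3 : (n.factorial : ℂ) ≠ 0 := Nat.cast_ne_zero.2 (Nat.factorial_ne_zero _)
    field_simp
  rw [h2, Complex.re_ofReal_mul]
  refine mul_pos ?_ hpos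
  positivity

theorem tendsto_wedge {𝕂 V ι : Type*} [NormedField 𝕂] {l : Filter ι}
    (α : ι → Fin n → V → V → 𝕂) (β : Fin n → V → V → 𝕂)
    (h : ∀ i u v, Filter.Tendsto (fun x => α x i u v) l (𝓝 (β i u v))) (b : Fin (2 * n) → V) :
    Filter.Tendsto (fun x => wedge (α x) b) l (𝓝 (wedge β b)) :=
  (tendsto_finsetSum _ fun _ _ =>
    (tendsto_finsetProd _ fun i _ => h i _ _).const_mul _).div_const _

theorem wedge_area_ne_zero : wedge (fun _ : Fin n => fun u v : Fin n → ℂ =>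
    ((∑ a, 2 * areaForm a u v : ℝ) : ℂ)) (cbasis n) ≠ 0 := by
  rw [wedge_area_eq (fun _ => 2)]
  refine Complex.ofReal_ne_zero.2 (mul_ne_zero (Nat.cast_ne_zero.2 (Nat.factorial_ne_zero _)) ?_)
  simp

theorem ofReal_wedge {V : Type*} (α : Fin n → V → V → ℝ) (b : Fin (2 * n) → V) :
    ((wedge α b : ℝ) : ℂ) = wedge (fun i u v => (α i u v : ℂ)) b := by
  simp [wedge]

theorem wedge_area_ne_zero' : wedge (fun _ : Fin n => fun u v : Fin n → ℂ =>
    ∑ a, 2 * areaForm a u v) (cbasis n) ≠ 0 := fun h => by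
  have h1 := wedge_area_ne_zero (n := n)
  rw [← ofReal_wedge (fun _ : Fin n => fun u v : Fin n → ℂ => ∑ a, 2 * areaForm a u v), h] at h1
  simp at h1

end LinearAlgebra

/-! ### Positivity of F and F₁ for large R -/

section Positivity

variable {n : ℕ} {M : Type*} [TopologicalSpace M] [ChartedSpace (Model n) M]
  [IsManifold 𝓘(ℝ, Model n) ∞ M] {K : AKStructure n M} {hn : 2 ≤ n} {k : ℕ∞}

theorem Data.contMDiff_phiR [T2Space M] (D : Data K hn k) (hk : 2 ≤ k) {R : ℝ} (hR : 1 ≤ R) :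
    ContMDiff 𝓘(ℝ, Model n) 𝓘(ℝ, ℝ) 2 (D.phiR R) :=
  D.two_le_smooth.add (contMDiff_const.mul (D.contMDiff_two_psi hk hR))

-- A property holds eventually if it holds along every finer ultrafilter. Along one of these, F and
-- F₁ converge to the corresponding quantities of the limiting form, which are strictly positive by
-- linear algebra.
set_option maxHeartbeats 1000000 in
theorem Data.eventually_pos [T2Space M] [CompactSpace M] (D : Data K hn k) (hk : 2 ≤ k) :
    ∀ᶠ x in shrinking n, 0 < F K.J K.Ω (D.phiR x.1) (D.χ x.2) ∧
      0 < Fj K.J K.Ω 1 (D.phiR x.1) (D.χ x.2) := by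
  refine Filter.mem_iff_ultrafilter.2 fun U hU => ?_
  have hR := ((shrinking_fst n).mono_left hU).eventually (Filter.eventually_ge_atTop 1)
  have hz : Filter.Tendsto (fun x : ℝ × (Fin n → ℂ) => x.2) U (𝓝 0) :=
    (shrinking_snd n).mono_left hU
  have hsrc := D.χ.open_source.mem_nhds D.zero_mem
  obtain ⟨c, hc, hlim⟩ := D.exists_limit_form hk U hU (fun x => D.amp x.1) (by
    filter_upwards [hR] with x hx
    have := D.amp_spec hk hx
    rw [Real.norm_eq_abs, abs_of_pos this.1]
    exact this.2.1)
  set B : (Fin n → ℂ) →ₗ[ℝ] (Fin n → ℂ) →ₗ[ℝ] ℝ := D.formZero + ∑ i, c i • areaL i with hBdef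
  have hBv : ∀ u v, B u v = D.formZero u v + ∑ i, c i * areaForm i u v := fun u v => by
    simp [hBdef, areaL_apply]
  have hB : ∀ u, B u u = 0 := fun u => by
    rw [hBv, D.formZero_self]
    simp [areaForm_self]
  have hjt : Filter.Tendsto (fun x : ℝ × (Fin n → ℂ) => jhat K.J D.χ x.2) U
      (𝓝 (jhat K.J D.χ 0)) :=
    ((contDiffOn_jhat K.smooth_J D.isParam).continuousOn.continuousAt hsrc).tendsto.comp hz
  have hj : ∀ u : Fin n → ℂ, Filter.Tendsto (fun x : ℝ × (Fin n → ℂ) => jhat K.J D.χ x.2 u) U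
      (𝓝 (mulI n u)) := fun u => by
    rw [mulI_apply, ← D.jhat_zero]
    exact hjt.clm_apply tendsto_const_nhds
  have hA : ∀ (u w : ℝ × (Fin n → ℂ) → Fin n → ℂ) (u' w' : Fin n → ℂ),
        Filter.Tendsto u U (𝓝 u') → Filter.Tendsto w U (𝓝 w') →
        Filter.Tendsto (fun x => pb2 (pot K.J K.Ω (D.phiR x.1)) D.χ x.2 (u x) (w x)) U
          (𝓝 (B u' w')) := fun u w u' w' hu hw => by
    rw [hBv]
    refine (hlim u w u' w' hu hw).congr' ?_
    filter_upwards [hR, hz hsrc] with x hx hx2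
    exact (pb2_pot K.smooth_J K.Ω D.isParam (D.contMDiff_phiR hk hx) hx2 _ _).symm
  have hO : ∀ u w : Fin n → ℂ, Filter.Tendsto (fun x : ℝ × (Fin n → ℂ) => pb2 K.Ω D.χ x.2 u w) U
      (𝓝 (∑ a, 2 * areaForm a u w)) := fun u w => by
    have h1 : Filter.Tendsto (fun x : ℝ × (Fin n → ℂ) => bhat K.Ω D.χ x.2) U
        (𝓝 (bhat K.Ω D.χ 0)) :=
      ((contDiffOn_bhat K.smooth_Ω D.isParam).continuousOn.continuousAt hsrc).tendsto.comp hz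
    have h2 := (h1.clm_apply (tendsto_const_nhds (x := u))).clm_apply (tendsto_const_nhds (x := w))
    rw [D.bhat_zero] at h2
    simpa only [bhat_apply] using h2
  -- At the amplitude the forms Ω(φ_R) are semidefinite, and semidefiniteness passes to the limit.
  have hnn : ∀ u, 0 ≤ B u (Complex.I • u) := fun u => by
    refine ge_of_tendsto (hA (fun _ => u) (fun x => jhat K.J D.χ x.2 u) u (mulI n u)
      tendsto_const_nhds (hj u)) ?_
    filter_upwards [hR, hz hsrc] with x hx hx2
    rw [pb2, D.isParam.jhat_tmap _ hx2]
    exact (D.amp_spec hk hx).2.2.2.2 _ _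
  set t : Fin n → ℝ := fun a => 2 * D.lam a + c a with ht
  have h11 : ∀ u v, p11L B (mulI n) u v = ∑ a, t a * areaForm a u v := fun u v => by
    have h1 : p11L B (mulI n) u v = p11L D.formZero (mulI n) u v + ∑ i, c i * areaForm i u v := by
      rw [p11L_apply, p11L_apply, hBv, hBv]
      simp only [mulI_apply, areaForm_I]
      ring
    rw [h1, D.p11_formZero, ← Finset.sum_add_distrib]
    exact Finset.sum_congr rfl fun a _ => by rw [ht]; ring
  -- The correction is of type (1,1), so the (2,0)-part is still that of Ω(φ) at p₀.
  have h20 : p20L B (mulI n) (Pi.single ⟨0, by omega⟩ 1) (Pi.single ⟨1, by omega⟩ 1) ≠ 0 := by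
    have h1 : ∀ u v, p20L B (mulI n) u v = p20L D.formZero (mulI n) u v := fun u v => by
      have h2 : ∀ i, areaForm i (Complex.I • u) v = - areaForm i u (Complex.I • v) := fun i => by
        simp [areaForm]; ring
      rw [p20L_apply, p20L_apply, hBv, hBv, hBv, hBv]
      simp only [mulI_apply, areaForm_I, h2, mul_neg, Finset.sum_neg_distrib]
      push_cast
      ring
    rw [h1]
    exact D.p20_formZero_ne
  have htn : ∀ i, 0 ≤ t i := fun i => by
    have := hnn (Pi.single i 1)
    rwa [← p11L_self_I B hB, h11, sum_areaForm_single] at this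
  have htp : ∀ i : Fin n, 2 ≤ (i : ℕ) → 0 < t i := fun i hi => by
    rw [ht]
    simp only [hc i hi, add_zero]
    exact mul_pos two_pos (D.lam_pos i)
  have hF : Filter.Tendsto (fun x : ℝ × (Fin n → ℂ) => F K.J K.Ω (D.phiR x.1) (D.χ x.2)) U
      (𝓝 (wedge (fun _ : Fin n => fun u v => B u v) (cbasis n) /
      wedge (fun _ : Fin n => fun u v => ∑ a, 2 * areaForm a u v) (cbasis n))) := by
    have w1 := tendsto_wedge (l := (U : Filter (ℝ × (Fin n → ℂ))))
      (fun x => fun _ : Fin n => pb2 (pot K.J K.Ω (D.phiR x.1)) D.χ x.2)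
      (fun _ => fun u v => B u v)
      (fun _ u v => hA (fun _ => u) (fun _ => v) u v tendsto_const_nhds tendsto_const_nhds)
      (cbasis n)
    have w2 := tendsto_wedge (l := (U : Filter (ℝ × (Fin n → ℂ))))
      (fun x => fun _ : Fin n => pb2 K.Ω D.χ x.2) (fun _ => fun u v => ∑ a, 2 * areaForm a u v)
      (fun _ u v => hO u v) (cbasis n)
    refine (w1.div w2 wedge_area_ne_zero').congr' ?_
    filter_upwards [hz hsrc] with x hx2
    exact (F_eq_coord K.J K.Ω _ D.isParam hx2 _).symm
  have hp20 : ∀ u v : Fin n → ℂ, Filter.Tendsto (fun x : ℝ × (Fin n → ℂ) =>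
      p20 (pb2 (pot K.J K.Ω (D.phiR x.1)) D.χ x.2) (jhat K.J D.χ x.2) u v) U
      (𝓝 (p20 (fun u v => B u v) (mulI n) u v)) := fun u v => by
    have cu : Filter.Tendsto (fun _ : ℝ × (Fin n → ℂ) => u) U (𝓝 u) := tendsto_const_nhds
    have cv : Filter.Tendsto (fun _ : ℝ × (Fin n → ℂ) => v) U (𝓝 v) := tendsto_const_nhds
    have hre : ∀ {f : ℝ × (Fin n → ℂ) → ℝ} {y : ℝ}, Filter.Tendsto f U (𝓝 y) →
        Filter.Tendsto (fun x => (f x : ℂ)) U (𝓝 (y : ℂ)) :=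
      fun h => (Complex.continuous_ofReal.tendsto _).comp h
    have a1 := hA (fun _ => u) (fun _ => v) u v cu cv
    have a2 := hA _ _ _ _ (hj u) (hj v)
    have a3 := hA _ (fun _ => v) _ v (hj u) cv
    have a4 := hA (fun _ => u) _ u _ cu (hj v)
    exact ((hre (a1.sub a2)).sub ((hre (a3.add a4)).const_mul Complex.I)).div_const 4
  have hp11 : ∀ u v : Fin n → ℂ, Filter.Tendsto (fun x : ℝ × (Fin n → ℂ) =>
      p11 (pb2 (pot K.J K.Ω (D.phiR x.1)) D.χ x.2) (jhat K.J D.χ x.2) u v) U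
      (𝓝 (p11 (fun u v => B u v) (mulI n) u v)) := fun u v =>
    ((hA (fun _ => u) (fun _ => v) u v tendsto_const_nhds tendsto_const_nhds).add
      (hA _ _ _ _ (hj u) (hj v))).div_const 2
  have hF1 : Filter.Tendsto (fun x : ℝ × (Fin n → ℂ) => Fj K.J K.Ω 1 (D.phiR x.1) (D.χ x.2)) U
      (𝓝 (((n.factorial : ℂ) / (((1 : ℕ).factorial : ℂ) ^ 2 * ((n - 2 * 1).factorial : ℂ)) *
      wedge (fun i : Fin n => tauForms (fun u v => B u v) (mulI n) 1 i) (cbasis n) /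
      wedge (fun _ : Fin n => fun u v => ((∑ a, 2 * areaForm a u v : ℝ) : ℂ)) (cbasis n)).re)) := by
    have w0 : ∀ (i : Fin n) (u v : Fin n → ℂ), Filter.Tendsto (fun x : ℝ × (Fin n → ℂ) =>
        tauForms (pb2 (pot K.J K.Ω (D.phiR x.1)) D.χ x.2) (jhat K.J D.χ x.2) 1 i u v) U
        (𝓝 (tauForms (fun u v => B u v) (mulI n) 1 i u v)) := fun i u v => by
      unfold tauForms
      split_ifs
      · exact hp20 u v
      · exact (Complex.continuous_conj.tendsto _).comp (hp20 u v)
      · exact (Complex.continuous_ofReal.tendsto _).comp (hp11 u v)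
    have w1 := tendsto_wedge (l := (U : Filter (ℝ × (Fin n → ℂ))))
      (fun x => fun i : Fin n => tauForms (pb2 (pot K.J K.Ω (D.phiR x.1)) D.χ x.2)
        (jhat K.J D.χ x.2) 1 i) (fun i : Fin n => tauForms (fun u v => B u v) (mulI n) 1 i)
        w0 (cbasis n)
    have w2 := tendsto_wedge (l := (U : Filter (ℝ × (Fin n → ℂ))))
      (fun x => fun _ : Fin n => fun u v => (pb2 K.Ω D.χ x.2 u v : ℂ))
      (fun _ => fun u v => ((∑ a, 2 * areaForm a u v : ℝ) : ℂ))
      (fun _ u v => (Complex.continuous_ofReal.tendsto _).comp (hO u v)) (cbasis n)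
    refine ((Complex.continuous_re.tendsto _).comp
      ((w1.const_mul _).div w2 wedge_area_ne_zero)).congr' ?_
    filter_upwards [hz hsrc] with x hx2
    exact (Fj_eq_coord K.J K.Ω 1 _ D.isParam hx2 _).symm
  have r1 := hF.eventually (lt_mem_nhds (wedge_pos_of_tau_ne hn B hB t htn htp h11 h20))
  have r2 := hF1.eventually (lt_mem_nhds (re_wedge_tauForms_pos hn B hB t htn htp h11 h20))
  exact r1.and r2

/-- A form taming `J` defines the same orientation as `Ω`. -/
theorem F_pos_of_tames (K : AKStructure n M) {φ : M → ℝ} {p : M}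
    (h : ∀ v : Tan n p, v ≠ 0 → 0 < pot K.J K.Ω φ p ![v, K.J p v]) : 0 < F K.J K.Ω φ p := by
  have hb : (stdBasis n : Fin (2 * n) → Model n) = stdFrame p := funext fun i => stdBasis_apply i
  have h1 : ∀ α : DForm n M 2, wedge (fun _ : Fin n => fun X Y : Tan n p =>
      α p ![X, Y]) (stdFrame p) =
      wedge (fun _ : Fin n => fun x y => α.bilAt p x y) (stdBasis n) := fun α => by
    rw [hb]
    have h2 : (fun x y : Model n => α.bilAt p x y) = fun X Y : Tan n p => α p ![X, Y] := by
      funext X Y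
      exact α.bilAt_apply p X Y
    rw [h2]
    rfl
  rw [F, h1, h1]
  -- Convex combinations of two forms taming J tame J, so the segment consists of nondegenerate
  -- forms.
  refine wedge_div_wedge_pos _ _ _ (fun u => ?_) (fun u => ?_) fun s hs u hu => ?_
  · exact (DForm.bilAt_apply _ p u u).trans (form_self _ _ _)
  · exact (DForm.bilAt_apply _ p u u).trans (form_self _ _ _)
  · by_contra hne
    have e := congrArg (fun L : Model n →ₗ[ℝ] ℝ => L (K.J.at p u)) hu
    simp only [LinearMap.add_apply, LinearMap.smul_apply, LinearMap.zero_apply, smul_eq_mul] at e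
    have e1 : (pot K.J K.Ω φ).bilAt p u (K.J.at p u) = pot K.J K.Ω φ p ![u, K.J p u] :=
      DForm.bilAt_apply _ p u _
    have e2 : K.Ω.bilAt p u (K.J.at p u) = K.Ω p ![u, K.J p u] := DForm.bilAt_apply _ p u _
    rw [e1, e2] at e
    have p1 := h u hne
    have p2 := K.tames p u hne
    have q1 := mul_nonneg (sub_nonneg.2 hs.2) p1.le
    have q2 := mul_nonneg hs.1 p2.le
    rcases hs.1.eq_or_lt with h0 | h0
    · rw [← h0] at e
      linarith
    · have := mul_pos h0 p2
      linarith

/-- The complement of the closed polydisk is open and ψ_R vanishes on it, so Ω(φ_R) = Ω(φ) at p, and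
this form tames J. -/
theorem Data.F_pos_outside [T2Space M] (D : Data K hn k) (hk : 2 ≤ k) {R : ℝ} (hR : 1 ≤ R)
    {p : M} (hp : p ∉ D.χ '' polydisk n (1 / R)) : 0 < F K.J K.Ω (D.phiR R) p := by
  refine F_pos_of_tames K fun v hv => ?_
  have hev : D.psi R =ᶠ[𝓝 p] fun _ => 0 := by
    filter_upwards [(D.isClosed_image hR).isOpen_compl.mem_nhds hp] with q hq
    exact D.psi_eq_zero (one_pos.trans_le hR) hq
  have hd : (Jd K.J (D.psi R)).d p = 0 := by
    have h0 := pot_const K.smooth_J K.Ω 0 p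
    rw [pot, add_eq_left] at h0
    rw [← h0, DForm.d, DForm.d]
    have hp' : chartAt (Model n) p p ∈ (chartAt (Model n) p).target := mem_chart_target _ _
    have hcont : Filter.Tendsto (chartAt (Model n) p).symm (𝓝 (chartAt (Model n) p p)) (𝓝 p) := by
      have := (chartAt (Model n) p).continuousAt_symm hp'
      rwa [ContinuousAt, (chartAt (Model n) p).left_inv (mem_chart_source _ p)] at this
    have hJ : (Jd K.J (D.psi R)).inChart (chartAt (Model n) p) =ᶠ[𝓝 (chartAt (Model n) p p)]
        (Jd K.J (fun _ : M => (0 : ℝ))).inChart (chartAt (Model n) p) := by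
      filter_upwards [hcont.eventually hev.eventually_nhds] with x hx
      have : mfderiv 𝓘(ℝ, Model n) 𝓘(ℝ, ℝ) (D.psi R) ((chartAt (Model n) p).symm x) =
          mfderiv 𝓘(ℝ, Model n) 𝓘(ℝ, ℝ) (fun _ : M => (0 : ℝ)) ((chartAt (Model n) p).symm x) :=
        Filter.EventuallyEq.mfderiv_eq hx
      have hJd : Jd K.J (D.psi R) ((chartAt (Model n) p).symm x) =
          Jd K.J (fun _ : M => (0 : ℝ)) ((chartAt (Model n) p).symm x) := by
        simp only [Jd]
        rw [this]
        rfl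
      simp only [DForm.inChart]
      rw [hJd]
    rw [hJ.extDeriv_eq]
  have := pot_add_smul K.smooth_J K.Ω D.two_le_smooth (D.contMDiff_two_psi hk hR) (D.amp R) p
  rw [hd, smul_zero, add_zero] at this
  change 0 < (pot K.J K.Ω (fun p => D.φ p + D.amp R * D.psi R p)) p ![v, K.J p v]
  rw [this]
  exact (hPos_iff_tames K.sq_J K.Ω D.φ).1 D.hpos p v hv

end Positivity

/-! ### The integral over M: linearity and positivity -/

section Integral

variable {n : ℕ} {M : Type*} [TopologicalSpace M] [ChartedSpace (Model n) M]
  [IsManifold 𝓘(ℝ, Model n) ∞ M]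

theorem inChart_eq_bhat (Ω : DForm n M 2) (e : OpenPartialHomeomorph M (Model n)) (x X Y : Model n) :
    Ω.inChart e x ![X, Y] = bhat Ω e.symm x X Y := by
  rw [bhat_apply, pb2]
  change Ω (e.symm x) (_ ∘ ![X, Y]) = _
  congr 1
  ext i : 1
  fin_cases i <;> rfl

/-- The density of the volume form `Ωⁿ` in a chart. -/
noncomputable def density (Ω : DForm n M 2) (q : M) (x : Model n) : ℝ :=
  |wedge (fun _ : Fin n => fun X Y : Model n => Ω.inChart (chartAt (Model n) q) x ![X, Y])
    (fun i => EuclideanSpace.single i (1 : ℝ))|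

theorem continuousOn_density {Ω : DForm n M 2} (hΩ : Ω.IsSmooth) (q : M) :
    ContinuousOn (density Ω q) (chartAt (Model n) q).target := by
  intro x hx
  have hb : Filter.Tendsto (bhat Ω (chartAt (Model n) q).symm) (𝓝[(chartAt (Model n) q).target] x)
      (𝓝 (bhat Ω (chartAt (Model n) q).symm x)) :=
    (contDiffOn_bhat hΩ (isParam_chartAt_symm q)).continuousOn x hx
  refine Filter.Tendsto.abs (tendsto_wedge _ _ (fun _ X Y => ?_) _)
  simp only [inChart_eq_bhat]
  exact (hb.clm_apply tendsto_const_nhds).clm_apply tendsto_const_nhds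

/-- A taming form is nondegenerate, so its top power has no zero. -/
theorem density_pos (K : AKStructure n M) (q : M) {x : Model n}
    (hx : x ∈ (chartAt (Model n) q).target) : 0 < density K.Ω q x := by
  refine abs_pos.2 ?_
  have hχ := isParam_chartAt_symm (n := n) q
  have h : wedge (fun _ : Fin n => fun X Y : Model n =>
      K.Ω.inChart (chartAt (Model n) q) x ![X, Y]) (fun i => EuclideanSpace.single i (1 : ℝ)) =
      wedge (fun _ : Fin n => fun X Y : Model n =>
        (bhat K.Ω (chartAt (Model n) q).symm x).toLinearMap₁₂ X Y) (stdBasis n) := by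
    have hb : (stdBasis n : Fin (2 * n) → Model n) = fun i => EuclideanSpace.single i (1 : ℝ) :=
      funext fun i => stdBasis_apply i
    rw [hb]
    simp only [inChart_eq_bhat]
    rfl
  rw [h]
  refine wedge_ne_zero_of_nondegenerate _ _ (fun u => ?_) fun u hu => ?_
  · change bhat K.Ω (chartAt (Model n) q).symm x u u = 0
    rw [bhat_apply]
    exact form_self _ _ _
  · by_contra hne
    have h1 : bhat K.Ω (chartAt (Model n) q).symm x u (jhat K.J (chartAt (Model n) q).symm x u) = 0 :=
      congrArg (fun L : Model n →ₗ[ℝ] ℝ => L (jhat K.J (chartAt (Model n) q).symm x u)) hu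
    rw [bhat_apply, pb2, hχ.jhat_tmap _ hx] at h1
    refine (K.tames _ (tmap n (chartAt (Model n) q).symm x u) fun h0 => hne ?_).ne' h1
    rw [← hχ.tinv_tmap hx u]
    exact (congrArg (tinv n _ x) h0).trans (map_zero _)

variable [CompactSpace M] [T2Space M]

theorem partition_subordinate (n : ℕ) (M : Type*) [TopologicalSpace M] [ChartedSpace (Model n) M]
    [IsManifold 𝓘(ℝ, Model n) ∞ M] [CompactSpace M] [T2Space M] (q : M) :
    tsupport (partition n M q) ⊆ (chartAt (Model n) q).source :=
  Classical.choose_spec (exists_partition n M) q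

/-- The integrand of the integral over `M` in a chart. -/
noncomputable def integrand (K : AKStructure n M) (f : M → ℝ) (q : M) (x : Model n) : ℝ :=
  partition n M q ((chartAt (Model n) q).symm x) * f ((chartAt (Model n) q).symm x) *
    density K.Ω q x

/-- The contribution of a chart to the integral over `M`. -/
noncomputable def chartIntegral (K : AKStructure n M) (f : M → ℝ) (q : M) : ℝ :=
  ∫ x in (chartAt (Model n) q).target, integrand K f q x

theorem integral_eq (K : AKStructure n M) (f : M → ℝ) :
    integral K f = ∑ᶠ q : M, chartIntegral K f q := rfl

theorem continuousOn_integrand (K : AKStructure n M) {f : M → ℝ} (hf : Continuous f) (q : M) :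
    ContinuousOn (integrand K f q) (chartAt (Model n) q).target := by
  have hs := (chartAt (Model n) q).continuousOn_symm
  exact (((partition n M q).2.continuous.comp_continuousOn hs).mul
    (hf.comp_continuousOn hs)).mul (continuousOn_density K.smooth_Ω q)

/-- The density need not be integrable up to the edge of the chart, but the partition function has
compact support inside it. -/
theorem integrableOn_integrand (K : AKStructure n M) {f : M → ℝ} (hf : Continuous f) (q : M) :
    MeasureTheory.IntegrableOn (integrand K f q) (chartAt (Model n) q).target := by
  set e := chartAt (Model n) q with he
  set C : Set (Model n) := e '' tsupport (partition n M q) with hC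
  have hsub := partition_subordinate n M q
  have hCt : C ⊆ e.target := by
    rintro _ ⟨p, hp, rfl⟩
    exact e.map_source (hsub hp)
  have hCc : IsCompact C :=
    ((isClosed_tsupport _).isCompact).image_of_continuousOn (e.continuousOn.mono hsub)
  refine MeasureTheory.IntegrableOn.of_forall_sdiff_eq_zero
    (((continuousOn_integrand K hf q).mono hCt).integrableOn_compact hCc)
    e.open_target.measurableSet fun x hx => ?_
  have h0 : partition n M q (e.symm x) = 0 := by
    by_contra hne
    exact hx.2 ⟨e.symm x, subset_tsupport _ hne, e.right_inv hx.1⟩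
  rw [integrand, ← he, h0]
  ring

theorem hasFiniteSupport_chartIntegral (K : AKStructure n M) (f : M → ℝ) :
    Function.HasFiniteSupport (chartIntegral K f) := by
  refine ((partition n M).locallyFinite.finite_nonempty_of_compact).subset fun q hq => ?_
  by_contra h
  refine hq ?_
  have h0 : ∀ p, partition n M q p = 0 := fun p => by
    by_contra hne
    exact h ⟨p, hne⟩
  simp [chartIntegral, integrand, h0]

theorem chartIntegral_add_smul (K : AKStructure n M) {f g : M → ℝ} (hf : Continuous f)
    (hg : Continuous g) (s : ℝ) (q : M) :
    chartIntegral K (fun p => f p + s * g p) q = chartIntegral K f q + s * chartIntegral K g q := by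
  have h : integrand K (fun p => f p + s * g p) q =
      fun x => integrand K f q x + s * integrand K g q x := by
    funext x
    simp only [integrand]
    ring
  rw [chartIntegral, h, MeasureTheory.integral_add (integrableOn_integrand K hf q)
      ((integrableOn_integrand K hg q).const_mul s), MeasureTheory.integral_const_mul]
  rfl

theorem integral_add_smul (K : AKStructure n M) {f g : M → ℝ} (hf : Continuous f)
    (hg : Continuous g) (s : ℝ) :
    integral K (fun p => f p + s * g p) = integral K f + s * integral K g := by
  simp only [integral_eq, chartIntegral_add_smul K hf hg s]
  have h := smul_finsum s (chartIntegral K g)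
  simp only [smul_eq_mul] at h
  rw [h, finsum_add_distrib (hasFiniteSupport_chartIntegral K f)]
  refine (hasFiniteSupport_chartIntegral K g).subset fun q hq hq' => hq ?_
  change s * chartIntegral K g q = 0
  rw [hq', mul_zero]

/-- Some partition function is nonzero at p, so one nonnegative integrand is positive on a nonempty
open set. This total volume is what means are divided by. -/
theorem integral_one_pos (K : AKStructure n M) (p : M) : 0 < integral K fun _ => 1 := by
  have hnn : ∀ q, ∀ x ∈ (chartAt (Model n) q).target, 0 ≤ integrand K (fun _ => 1) q x :=
    fun q x _ => mul_nonneg (mul_nonneg ((partition n M).nonneg q _) zero_le_one) (abs_nonneg _)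
  rw [integral_eq]
  refine finsum_pos (fun q => ?_) ?_ (hasFiniteSupport_chartIntegral K _)
  · exact MeasureTheory.setIntegral_nonneg (chartAt (Model n) q).open_target.measurableSet (hnn q)
  obtain ⟨q, hq⟩ : ∃ q, partition n M q p ≠ 0 := by
    by_contra! h
    have := (partition n M).sum_eq_one (Set.mem_univ p)
    simp [h] at this
  refine ⟨q, ?_⟩
  rw [chartIntegral, MeasureTheory.setIntegral_pos_iff_support_of_nonneg_ae
    (MeasureTheory.ae_restrict_of_forall_mem (chartAt (Model n) q).open_target.measurableSet (hnn q))
    (integrableOn_integrand K continuous_const q)]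
  have hps : p ∈ (chartAt (Model n) q).source :=
    partition_subordinate n M q (subset_tsupport _ hq)
  have hopen : IsOpen ((chartAt (Model n) q).target ∩
      integrand K (fun _ => 1) q ⁻¹' {0}ᶜ) :=
    (continuousOn_integrand K continuous_const q).isOpen_inter_preimage
      (chartAt (Model n) q).open_target isOpen_compl_singleton
  refine (hopen.measure_pos _ ⟨chartAt (Model n) q p, (chartAt (Model n) q).map_source hps, ?_⟩).trans_le
    (MeasureTheory.measure_mono fun x hx => ⟨hx.2, hx.1⟩)
  have hd := density_pos K q ((chartAt (Model n) q).map_source hps)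
  have : integrand K (fun _ => 1) q (chartAt (Model n) q p) ≠ 0 := by
    rw [integrand, (chartAt (Model n) q).left_inv hps]
    exact mul_ne_zero (mul_ne_zero hq one_ne_zero) hd.ne'
  exact this

end Integral

/-! ### Lines in the C^k topology -/

section Topology

variable {n : ℕ} {M : Type*} [TopologicalSpace M] [ChartedSpace (Model n) M]

/-- The affine line `g₀ + s g₁` in the space of functions. -/
noncomputable def affineLine {k : ℕ∞} (g₀ g₁ : C^k⟮𝓘(ℝ, Model n), M; 𝓘(ℝ, ℝ), ℝ⟯) (s : ℝ) :
    C^k⟮𝓘(ℝ, Model n), M; 𝓘(ℝ, ℝ), ℝ⟯ :=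
  ⟨fun p => g₀ p + s * g₁ p, g₀.contMDiff.add (contMDiff_const.mul g₁.contMDiff)⟩

variable [IsManifold 𝓘(ℝ, Model n) ∞ M]

/-- Each derivative is affine in s, so on a compact set two of them differ by at most |s₀ - s| times
a bound for the derivative of g₁. -/
theorem continuous_affineLine {k : ℕ∞} (g₀ g₁ : C^k⟮𝓘(ℝ, Model n), M; 𝓘(ℝ, ℝ), ℝ⟯) :
    Continuous (affineLine g₀ g₁) := by
  refine continuous_iInf_rng.2 fun e => continuous_iInf_rng.2 fun j => continuous_induced_rng.2 ?_
  have hC : ∀ g : C^k⟮𝓘(ℝ, Model n), M; 𝓘(ℝ, ℝ), ℝ⟯,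
      ContDiffOn ℝ k (fun x => g (e.1.symm x)) e.1.target := fun g => by
    rw [← contMDiffOn_iff_contDiffOn]
    have he : ContMDiffOn 𝓘(ℝ, Model n) 𝓘(ℝ, Model n) ∞ e.1.symm e.1.target :=
      contMDiffOn_symm_of_mem_maximalAtlas (IsManifold.subset_maximalAtlas e.2)
    exact g.contMDiff.comp_contMDiffOn (he.of_le (by exact_mod_cast le_top))
  have hj : ((j.1 : ℕ) : WithTop ℕ∞) ≤ k := by exact_mod_cast j.2
  have hd : ∀ (g : C^k⟮𝓘(ℝ, Model n), M; 𝓘(ℝ, ℝ), ℝ⟯) (x) (_ : x ∈ e.1.target),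
      ContDiffAt ℝ j.1 (fun x => g (e.1.symm x)) x := fun g x hx =>
    ((hC g).contDiffAt (e.1.open_target.mem_nhds hx)).of_le hj
  rw [continuous_iff_continuousAt]
  intro s₀
  refine UniformOnFun.tendsto_iff_tendstoUniformlyOn.2 fun C hCm => ?_
  obtain ⟨hCc, hCt⟩ := hCm
  have hval : ∀ s, ∀ x ∈ e.1.target, iteratedFDeriv ℝ j.1 (fun x => affineLine g₀ g₁ s (e.1.symm x)) x =
      iteratedFDeriv ℝ j.1 (fun x => g₀ (e.1.symm x)) x +
        s • iteratedFDeriv ℝ j.1 (fun x => g₁ (e.1.symm x)) x := fun s x hx => by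
    have h1 : (fun x => affineLine g₀ g₁ s (e.1.symm x)) =
        (fun x => g₀ (e.1.symm x)) + s • fun x => g₁ (e.1.symm x) := rfl
    rw [h1, iteratedFDeriv_add_apply (hd g₀ x hx) (g := s • fun x => g₁ (e.1.symm x))
      ((hd g₁ x hx).const_smul s),
      iteratedFDeriv_const_smul_apply (hd g₁ x hx)]
  have hcont : ContinuousOn (iteratedFDeriv ℝ j.1 (fun x => g₁ (e.1.symm x))) C := by
    refine ContinuousOn.mono ?_ hCt
    exact ((hC g₁).continuousOn_iteratedFDerivWithin hj e.1.open_target.uniqueDiffOn).congr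
      fun x hx => (iteratedFDerivWithin_of_isOpen j.1 e.1.open_target hx).symm
  obtain ⟨b, hb⟩ := hCc.exists_bound_of_continuousOn hcont
  rw [Metric.tendstoUniformlyOn_iff]
  intro ε hε
  have hlim : Filter.Tendsto (fun s : ℝ => ‖s₀ - s‖ * |b|) (𝓝 s₀) (𝓝 0) := by
    have : Continuous fun s : ℝ => ‖s₀ - s‖ * |b| := by fun_prop
    simpa using this.tendsto s₀
  filter_upwards [hlim.eventually (gt_mem_nhds hε)] with s hs x hx
  change dist (iteratedFDeriv ℝ j.1 (fun x => affineLine g₀ g₁ s₀ (e.1.symm x)) x)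
    (iteratedFDeriv ℝ j.1 (fun x => affineLine g₀ g₁ s (e.1.symm x)) x) < ε
  rw [hval _ x (hCt hx), hval _ x (hCt hx), dist_add_left, dist_eq_norm, ← sub_smul, norm_smul]
  exact (mul_le_mul_of_nonneg_left ((hb x hx).trans (le_abs_self b)) (norm_nonneg _)).trans_lt hs

end Topology

/-! ### The boundary of A₊ and the choice of the radius -/

section Frontier

variable {n : ℕ} {M : Type*} [TopologicalSpace M] [ChartedSpace (Model n) M]
  [IsManifold 𝓘(ℝ, Model n) ∞ M] [CompactSpace M] [T2Space M]

theorem pot_add_const {J : EndField n M} (hJ : J.IsSmooth) (Ω : DForm n M 2) {φ : M → ℝ}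
    (hφ : ContMDiff 𝓘(ℝ, Model n) 𝓘(ℝ, ℝ) 2 φ) (c : ℝ) (p : M) :
    pot J Ω (fun p => φ p + c) p = pot J Ω φ p := by
  have h := pot_add_smul hJ Ω hφ (contMDiff_const (c := c)) 1 p
  have h0 := pot_const hJ Ω c p
  rw [pot, add_eq_left] at h0
  rw [h0, smul_zero, add_zero] at h
  simpa only [one_mul] using h

/-- If the forms `Ω(φ + s ψ)` tame `J` for `s < a` but not for `s = a`, then `φ + a ψ` is, up to a
constant, a boundary point of `A₊`. -/
theorem exists_mem_frontier (K : AKStructure n M) [Nonempty M] {k : ℕ∞} (hk : 2 ≤ k) {φ ψ : M → ℝ}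
    (hφ : ContMDiff 𝓘(ℝ, Model n) 𝓘(ℝ, ℝ) k φ) (hψ : ContMDiff 𝓘(ℝ, Model n) 𝓘(ℝ, ℝ) k ψ)
    {a : ℝ} (ha : 0 < a)
    (h1 : ∀ s, 0 ≤ s → s < a → Tames K.J (pot K.J K.Ω (fun p => φ p + s * ψ p)))
    (h2 : ¬ Tames K.J (pot K.J K.Ω (fun p => φ p + a * ψ p))) :
    ∃ f ∈ frontier (APlus K k), ∃ c : ℝ, ∀ p : M, f.1 p = φ p + a * ψ p + c := by
  have hI := integral_one_pos K (Classical.arbitrary M)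
  set I := integral K fun _ => 1 with hIdef
  -- Both functions are corrected by constants to have mean zero; constants do not affect the forms
  -- Ω(φ).
  set c₀ := -(integral K φ / I) with hc₀
  set c₁ := -(integral K ψ / I) with hc₁
  let g₀ : C^k⟮𝓘(ℝ, Model n), M; 𝓘(ℝ, ℝ), ℝ⟯ :=
    ⟨fun p => φ p + c₀, hφ.add contMDiff_const⟩
  let g₁ : C^k⟮𝓘(ℝ, Model n), M; 𝓘(ℝ, ℝ), ℝ⟯ :=
    ⟨fun p => ψ p + c₁, hψ.add contMDiff_const⟩
  have hg : ∀ {θ : M → ℝ}, Continuous θ →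
      integral K (fun p => θ p + -(integral K θ / I)) = 0 := fun {θ} hθ => by
    have := integral_add_smul K hθ (continuous_const (y := (1 : ℝ))) (-(integral K θ / I))
    simp only [mul_one] at this
    rw [this, ← hIdef]
    field_simp
    ring
  have hmem : ∀ s, affineLine g₀ g₁ s ∈ A K k := fun s => by
    have := integral_add_smul K g₀.contMDiff.continuous g₁.contMDiff.continuous s
    have e0 : integral K g₀ = 0 := hg hφ.continuous
    have e1 : integral K g₁ = 0 := hg hψ.continuous
    rw [e0, e1, mul_zero, add_zero] at this
    exact this
  let γ : ℝ → A K k := fun s => ⟨affineLine g₀ g₁ s, hmem s⟩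
  have hγ : Continuous γ := (continuous_affineLine g₀ g₁).subtype_mk hmem
  have hval : ∀ s p, (γ s).1 p = φ p + s * ψ p + (c₀ + s * c₁) := fun s p => by
    change (φ p + c₀) + s * (ψ p + c₁) = _
    ring
  have hφ2 := hφ.of_le (two_le_coe hk)
  have hψ2 := hψ.of_le (two_le_coe hk)
  have hiff : ∀ s, γ s ∈ APlus K k ↔ Tames K.J (pot K.J K.Ω (fun p => φ p + s * ψ p)) := fun s => by
    have hfun : ((γ s).1 : M → ℝ) = fun p => (φ p + s * ψ p) + (c₀ + s * c₁) :=
      funext fun p => hval s p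
    change Tames K.J (pot K.J K.Ω ((γ s).1 : M → ℝ)) ↔ _
    rw [hfun]
    have hpot := pot_add_const K.smooth_J K.Ω (φ := fun p => φ p + s * ψ p)
      (hφ2.add (contMDiff_const.mul hψ2)) (c₀ + s * c₁)
    simp only [Tames, hpot]
  refine ⟨γ a, ⟨?_, fun h => h2 ((hiff a).1 (interior_subset h))⟩, c₀ + a * c₁, hval a⟩
  -- The endpoint s = a is a limit of points s < a of the line, which lie in A₊.
  refine mem_closure_of_tendsto (hγ.continuousAt.tendsto.mono_left nhdsWithin_le_nhds)
    (b := 𝓝[<] a) ?_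
  filter_upwards [Ioo_mem_nhdsLT ha] with s hs
  exact (hiff s).2 (h1 s hs.1.le hs.2)

variable {K : AKStructure n M} {hn : 2 ≤ n} {k : ℕ∞}

/-- Beyond some R₂ the limiting argument applies uniformly on the polydisk; outside it every R ≥ 1
works. The radius is the larger of R₁ and R₂. -/
theorem Data.exists_radius (D : Data K hn k) (hk : 2 ≤ k) (R₁ : ℝ) (hR₁ : 2 < R₁) :
    ∃ R₀ : ℝ, R₁ ≤ R₀ ∧ 0 < D.amp R₀ ∧ D.amp R₀ ≤ 1 ∧
      (∃ f ∈ frontier (APlus K k), ∃ c : ℝ, ∀ p : M, f.1 p = D.phiR R₀ p + c) ∧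
      (∀ p ∈ D.χ '' polydisk n (1 / R₀), 0 < Fj K.J K.Ω 1 (D.phiR R₀) p) ∧
      ∀ p : M, 0 < F K.J K.Ω (D.phiR R₀) p := by
  obtain ⟨R₂, hR₂⟩ := exists_of_eventually_shrinking (n := n)
    (p := fun R z => 0 < F K.J K.Ω (D.phiR R) (D.χ z) ∧ 0 < Fj K.J K.Ω 1 (D.phiR R) (D.χ z))
    (D.eventually_pos hk)
  set R := max R₁ R₂
  have hR : 1 ≤ R := by linarith [le_max_left R₁ R₂]
  obtain ⟨h0, h1, hlt, hnot, -⟩ := D.amp_spec hk hR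
  have : Nonempty M := ⟨D.χ 0⟩
  refine ⟨R, le_max_left _ _, h0, h1, ?_, ?_, ?_⟩
  · exact exists_mem_frontier K hk (D.smooth_φ.of_le (by exact_mod_cast le_top))
      (D.contMDiff_psi hR) h0 hlt hnot
  · rintro _ ⟨z, hz, rfl⟩
    exact (hR₂ R (le_max_right _ _) z hz).2
  · intro p
    by_cases hp : p ∈ D.χ '' polydisk n (1 / R)
    · obtain ⟨z, hz, rfl⟩ := hp
      exact (hR₂ R (le_max_right _ _) z hz).1
    · exact D.F_pos_outside hk hR hp

end Frontier

/-! ### The Nijenhuis tensor in coordinates -/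

section Nijenhuis

variable {n : ℕ} {M : Type*} [TopologicalSpace M] [ChartedSpace (Model n) M]
  {E : Type*} [NormedAddCommGroup E] [NormedSpace ℝ E] {χ : OpenPartialHomeomorph E M}

/-- The value of a vector field in the model space. -/
noncomputable def fieldAt (X : (p : M) → Tan n p) (p : M) : Model n := X p

/-- A vector field in the coordinates of a parametrization. -/
noncomputable def fieldHat (X : (p : M) → Tan n p) (χ : OpenPartialHomeomorph E M) (z : E) : E :=
  tinv n χ z (fieldAt X (χ z))

variable [IsManifold 𝓘(ℝ, Model n) ∞ M]

theorem fieldHat_J (J : EndField n M) (hχ : IsParam n χ) (X : (p : M) → Tan n p) {z : E}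
    (hz : z ∈ χ.source) :
    fieldHat (fun q => J q (X q)) χ z = jhat J χ z (fieldHat X χ z) := by
  simp only [jhat, fieldHat, ContinuousLinearMap.comp_apply, hχ.tmap_tinv hz]
  rfl

/-- The pull-back of a vector field by the inverse of a chart. -/
noncomputable def chartPullback (X : (p : M) → Tan n p) (p : M) : Model n → Model n :=
  VectorField.mpullbackWithin 𝓘(ℝ, Model n) 𝓘(ℝ, Model n) (extChartAt 𝓘(ℝ, Model n) p).symm X
    (Set.range 𝓘(ℝ, Model n))

theorem chartPullback_eq (X : (p : M) → Tan n p) (p : M) {x : Model n}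
    (hx : x ∈ (chartAt (Model n) p).target) :
    chartPullback X p x = fieldHat X (chartAt (Model n) p).symm x := by
  have hχ := isParam_chartAt_symm (n := n) p
  rw [chartPullback, VectorField.mpullbackWithin_apply, ModelWithCorners.range_eq_univ,
    mfderivWithin_univ]
  have hinv : (tmap n (chartAt (Model n) p).symm x).inverse =
      tinv n (chartAt (Model n) p).symm x := by
    refine ContinuousLinearMap.inverse_eq ?_ ?_
    · ext w : 1
      exact hχ.tmap_tinv hx w
    · ext w : 1
      exact hχ.tinv_tmap hx w
  exact congrArg (fun L : Model n →L[ℝ] Model n => L (fieldAt X ((chartAt (Model n) p).symm x))) hinv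

theorem chartPullback_eventuallyEq (X : (p : M) → Tan n p) (p : M) :
    chartPullback X p =ᶠ[𝓝 (chartAt (Model n) p p)] fieldHat X (chartAt (Model n) p).symm := by
  filter_upwards [(chartAt (Model n) p).open_target.mem_nhds (mem_chart_target _ p)] with x hx
  exact chartPullback_eq X p hx

theorem mlieBracket_chart (X Y : (p : M) → Tan n p) (p : M) :
    VectorField.mlieBracket 𝓘(ℝ, Model n) X Y p =
      tmap n (chartAt (Model n) p).symm (chartAt (Model n) p p)
        (VectorField.lieBracket ℝ (fieldHat X (chartAt (Model n) p).symm)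
          (fieldHat Y (chartAt (Model n) p).symm) (chartAt (Model n) p p)) := by
  have hχ := isParam_chartAt_symm (n := n) p
  have hp : chartAt (Model n) p p ∈ (chartAt (Model n) p).target := mem_chart_target _ p
  have hinv : (tinv n (chartAt (Model n) p).symm (chartAt (Model n) p p)).inverse =
      tmap n (chartAt (Model n) p).symm (chartAt (Model n) p p) := by
    refine ContinuousLinearMap.inverse_eq ?_ ?_
    · ext w : 1
      exact hχ.tinv_tmap hp w
    · ext w : 1
      exact hχ.tmap_tinv hp w
  rw [tinv, (chartAt (Model n) p).left_inv (mem_chart_source _ p)] at hinv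
  have hb : VectorField.lieBracketWithin ℝ (chartPullback X p) (chartPullback Y p)
      ((extChartAt 𝓘(ℝ, Model n) p).symm ⁻¹' Set.univ ∩ Set.range 𝓘(ℝ, Model n))
      (chartAt (Model n) p p) =
      VectorField.lieBracket ℝ (fieldHat X (chartAt (Model n) p).symm)
          (fieldHat Y (chartAt (Model n) p).symm) (chartAt (Model n) p p) := by
    rw [Set.preimage_univ, Set.univ_inter, ModelWithCorners.range_eq_univ,
      VectorField.lieBracketWithin_univ]
    exact Filter.EventuallyEq.lieBracket_vectorField_eq (chartPullback_eventuallyEq X p)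
      (chartPullback_eventuallyEq Y p)
  exact congrArg₂ (fun (L : Model n →L[ℝ] Model n) w => L w) hinv hb

theorem differentiableAt_fieldHat {X : (p : M) → Tan n p} (hX : IsSmoothField X Set.univ) (p : M) :
    DifferentiableAt ℝ (fieldHat X (chartAt (Model n) p).symm) (chartAt (Model n) p p) := by
  have : IsManifold 𝓘(ℝ, Model n) 2 M := IsManifold.of_le (n := ∞) two_le_infty
  have h : DifferentiableWithinAt ℝ (chartPullback X p)
      ((extChartAt 𝓘(ℝ, Model n) p).symm ⁻¹' Set.univ ∩ Set.range 𝓘(ℝ, Model n))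
      (chartAt (Model n) p p) := ((hX p (Set.mem_univ p)).mdifferentiableWithinAt
    (by simp)).differentiableWithinAt_mpullbackWithin_vectorField
  rw [Set.preimage_univ, Set.univ_inter, ModelWithCorners.range_eq_univ,
    differentiableWithinAt_univ] at h
  exact h.congr_of_eventuallyEq (chartPullback_eventuallyEq X p).symm

/-- The coordinate expression of the Nijenhuis tensor. -/
noncomputable def nhat (J : EndField n M) (χ : OpenPartialHomeomorph E M) (z u v : E) : E :=
  fderiv ℝ (jhat J χ) z (jhat J χ z u) v - fderiv ℝ (jhat J χ) z (jhat J χ z v) u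
    - jhat J χ z (fderiv ℝ (jhat J χ) z u v) + jhat J χ z (fderiv ℝ (jhat J χ) z v u)

/-- Expanding the four brackets by the product rule, the derivatives of the vector fields cancel
because J² = -1; what remains depends only on the values of the fields and the derivative of J. -/
theorem nijenhuis_chart (K : AKStructure n M) {X Y : (p : M) → Tan n p}
    (hX : IsSmoothField X Set.univ) (hY : IsSmoothField Y Set.univ) (p : M) :
    K.nijenhuis X Y p = tmap n (chartAt (Model n) p).symm (chartAt (Model n) p p)
      (nhat K.J (chartAt (Model n) p).symm (chartAt (Model n) p p)
        (fieldHat X (chartAt (Model n) p).symm (chartAt (Model n) p p))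
        (fieldHat Y (chartAt (Model n) p).symm (chartAt (Model n) p p))) := by
  set χ := (chartAt (Model n) p).symm with hχdef
  set z := chartAt (Model n) p p with hz
  have hχ : IsParam n χ := isParam_chartAt_symm (n := n) p
  have hzs : z ∈ χ.source := mem_chart_target _ p
  have hpz : χ z = p := (chartAt (Model n) p).left_inv (mem_chart_source _ p)
  set x := fieldHat X χ
  set y := fieldHat Y χ
  set j := jhat K.J χ with hj
  have hjd : DifferentiableAt ℝ j z := ((contDiffOn_jhat K.smooth_J hχ).contDiffAt
    (χ.open_source.mem_nhds hzs)).differentiableAt (by simp)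
  have hxd : DifferentiableAt ℝ x z := differentiableAt_fieldHat hX p
  have hyd : DifferentiableAt ℝ y z := differentiableAt_fieldHat hY p
  have hJev : ∀ Z : (p : M) → Tan n p, fieldHat (fun q => K.J q (Z q)) χ =ᶠ[𝓝 z]
      fun w => j w (fieldHat Z χ w) := fun Z => by
    filter_upwards [χ.open_source.mem_nhds hzs] with w hw
    exact fieldHat_J K.J hχ Z hw
  have hdJ : ∀ {w : Model n → Model n}, DifferentiableAt ℝ w z → ∀ u,
      fderiv ℝ (fun q => j q (w q)) z u = fderiv ℝ j z u (w z) + j z (fderiv ℝ w z u) := by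
    intro w hw u
    rw [fderiv_clm_apply hjd hw]
    simp [add_comm]
  have hjj : ∀ u, j z (j z u) = -u := jhat_jhat K hχ hzs
  have hJt : ∀ w : Model n, K.J.at p (tmap n χ z w) = tmap n χ z (j z w) := fun w => by
    rw [hj, hχ.jhat_tmap K.J hzs, hpz]
  have e1 : VectorField.mlieBracket 𝓘(ℝ, Model n) (fun q => K.J q (X q)) (fun q => K.J q (Y q)) p =
      tmap n χ z (fderiv ℝ (fun q => j q (y q)) z (j z (x z)) -
        fderiv ℝ (fun q => j q (x q)) z (j z (y z))) := by
    rw [mlieBracket_chart, Filter.EventuallyEq.lieBracket_vectorField_eq (hJev X) (hJev Y)]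
    rfl
  have e2 : VectorField.mlieBracket 𝓘(ℝ, Model n) X (fun q => K.J q (Y q)) p =
      tmap n χ z (fderiv ℝ (fun q => j q (y q)) z (x z) - fderiv ℝ x z (j z (y z))) := by
    rw [mlieBracket_chart,
      Filter.EventuallyEq.lieBracket_vectorField_eq (Filter.EventuallyEq.refl _ x) (hJev Y)]
    rfl
  have e3 : VectorField.mlieBracket 𝓘(ℝ, Model n) (fun q => K.J q (X q)) Y p =
      tmap n χ z (fderiv ℝ y z (j z (x z)) - fderiv ℝ (fun q => j q (x q)) z (y z)) := by
    rw [mlieBracket_chart,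
      Filter.EventuallyEq.lieBracket_vectorField_eq (hJev X) (Filter.EventuallyEq.refl _ y)]
    rfl
  have e4 : VectorField.mlieBracket 𝓘(ℝ, Model n) X Y p =
      tmap n χ z (fderiv ℝ y z (x z) - fderiv ℝ x z (y z)) := mlieBracket_chart X Y p
  rw [AKStructure.nijenhuis, e1, e2, e3, e4]
  change tmap n χ z _ - K.J.at p (tmap n χ z _) - K.J.at p (tmap n χ z _) - tmap n χ z _ = _
  rw [hJt, hJt, ← map_sub, ← map_sub, ← map_sub]
  refine congrArg (tmap n χ z) ?_
  simp only [hdJ hxd, hdJ hyd, map_sub, map_add, hjj, nhat]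
  abel

theorem exists_nhat_ne_zero (K : AKStructure n M) (hK : ¬ K.IsIntegrable) :
    ∃ (p : M) (u v : Model n),
      nhat K.J (chartAt (Model n) p).symm (chartAt (Model n) p p) u v ≠ 0 := by
  simp only [AKStructure.IsIntegrable, not_forall] at hK
  obtain ⟨X, Y, hX, hY, p, hp⟩ := hK
  rw [nijenhuis_chart K hX hY] at hp
  refine ⟨p, fieldHat X (chartAt (Model n) p).symm (chartAt (Model n) p p),
    fieldHat Y (chartAt (Model n) p).symm (chartAt (Model n) p p), fun h => hp ?_⟩
  rw [h]
  exact map_zero _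

end Nijenhuis

/-! ### A function with nonzero τ -/

section NonzeroTau

variable {n : ℕ} {M : Type*} [TopologicalSpace M] [ChartedSpace (Model n) M]
  [IsManifold 𝓘(ℝ, Model n) ∞ M] [T2Space M]

/-- Every linear function of the coordinates is near the centre of the chart the restriction of a
smooth function. -/
theorem exists_smooth_linear (p : M) (l : Model n →L[ℝ] ℝ) :
    ∃ f : M → ℝ, ContMDiff 𝓘(ℝ, Model n) 𝓘(ℝ, ℝ) ∞ f ∧
      f ∘ (chartAt (Model n) p).symm =ᶠ[𝓝 (chartAt (Model n) p p)] l := by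
  let b : SmoothBumpFunction 𝓘(ℝ, Model n) p := Classical.arbitrary _
  refine ⟨fun q => b q • l (chartAt (Model n) p q), b.contMDiff_smul ?_, ?_⟩
  · exact l.contMDiff.comp_contMDiffOn contMDiffOn_chart
  · have hp : chartAt (Model n) p p ∈ (chartAt (Model n) p).target := mem_chart_target _ p
    have hcont : Filter.Tendsto (chartAt (Model n) p).symm (𝓝 (chartAt (Model n) p p)) (𝓝 p) := by
      have := (chartAt (Model n) p).continuousAt_symm hp
      rwa [ContinuousAt, (chartAt (Model n) p).left_inv (mem_chart_source _ p)] at this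
    filter_upwards [hcont.eventually b.eventuallyEq_one,
      (chartAt (Model n) p).open_target.mem_nhds hp] with x hx hx2
    simp only [Function.comp_apply, hx, (chartAt (Model n) p).right_inv hx2]
    simp

/-- The derivative of J² = -1. -/
theorem fderiv_jhat_jhat {E : Type*} [NormedAddCommGroup E] [NormedSpace ℝ E]
    {χ : OpenPartialHomeomorph E M} (K : AKStructure n M) (hχ : IsParam n χ) {z : E}
    (hz : z ∈ χ.source) (w v : E) :
    fderiv ℝ (jhat K.J χ) z w (jhat K.J χ z v) = - jhat K.J χ z (fderiv ℝ (jhat K.J χ) z w v) := by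
  have hjd : DifferentiableAt ℝ (jhat K.J χ) z := ((contDiffOn_jhat K.smooth_J hχ).contDiffAt
    (χ.open_source.mem_nhds hz)).differentiableAt (by simp)
  have hv : DifferentiableAt ℝ (fun q => jhat K.J χ q v) z :=
    hjd.clm_apply (differentiableAt_const v)
  have hev : (fun q => jhat K.J χ q (jhat K.J χ q v)) =ᶠ[𝓝 z] fun _ => -v := by
    filter_upwards [χ.open_source.mem_nhds hz] with q hq
    exact jhat_jhat K hχ hq v
  have h := congrArg (fun L : E →L[ℝ] E => L w) hev.fderiv_eq
  simp only [fderiv_fun_const] at h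
  rw [fderiv_clm_apply hjd hv, fderiv_clm_apply hjd (differentiableAt_const v)] at h
  simp at h
  rw [eq_neg_iff_add_eq_zero, add_comm]
  exact h

theorem p20_re {E : Type*} (B : E → E → ℝ) (j : E → E) (u v : E) :
    (p20 B j u v).re = (B u v - B (j u) (j v)) / 4 := by
  simp [p20]

/-- For f with constant differential near p, d(J df)(a, b) = df(DJ(a)b - DJ(b)a), and its
J-anti-invariant combination on (u, v) is df(J N(u, v)). Taking df to be the inner product with w =
J N(u, v) makes this |w|² ≠ 0. Since Ω is J-invariant, 4 Re τ(tf)(u, v) = t |w|², and a small t ≠ 0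
preserves tameness. -/
theorem exists_tau_ne_zero [CompactSpace M] (K : AKStructure n M) (hK : ¬ K.IsIntegrable) :
    ∃ φ : M → ℝ, ContMDiff 𝓘(ℝ, Model n) 𝓘(ℝ, ℝ) ∞ φ ∧ Tames K.J (pot K.J K.Ω φ) ∧
      ∃ (p : M) (X Y : Tan n p), tau K.J K.Ω φ p X Y ≠ 0 := by
  obtain ⟨p, u, v, hN⟩ := exists_nhat_ne_zero K hK
  set χ := (chartAt (Model n) p).symm with hχdef
  set z := chartAt (Model n) p p with hzdef
  have hχ : IsParam n χ := isParam_chartAt_symm (n := n) p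
  have hz : z ∈ χ.source := mem_chart_target _ p
  have hpz : χ z = p := (chartAt (Model n) p).left_inv (mem_chart_source _ p)
  set N := nhat K.J χ z u v with hNdef
  set w := jhat K.J χ z N with hw
  have hw0 : w ≠ 0 := fun h0 => hN (by
    have := jhat_jhat K hχ hz N
    rw [← hw, h0, map_zero] at this
    exact (neg_eq_zero.1 this.symm))
  obtain ⟨f, hf, hfe⟩ := exists_smooth_linear p (innerSL ℝ w)
  have hf2 := hf.of_le two_le_infty
  have h0 : ContMDiff 𝓘(ℝ, Model n) 𝓘(ℝ, ℝ) 2 (fun _ : M => (0 : ℝ)) := contMDiff_const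
  have hev := eventually_tames K.smooth_J K.smooth_Ω h0 hf2
    (by simp only [Tames, pot_const K.smooth_J]; exact K.tames)
  obtain ⟨t, ht, ht0⟩ := ((hev.filter_mono (nhdsWithin_le_nhds (s := {0}ᶜ))).and
    self_mem_nhdsWithin).exists
  refine ⟨fun q => 0 + t * f q, contMDiff_const.add (contMDiff_const.mul hf), ht, χ z,
    tmap n χ z u, tmap n χ z v, fun h => ?_⟩
  have hD : ∀ a b, dhat K.J f χ z a b =
      inner ℝ w (fderiv ℝ (jhat K.J χ) z a b - fderiv ℝ (jhat K.J χ) z b a) := fun a b => by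
    have h1 : fderiv ℝ (f ∘ χ) =ᶠ[𝓝 z] fun _ => innerSL ℝ w := by
      filter_upwards [hfe.fderiv (𝕜 := ℝ)] with y hy
      rw [hy, ContinuousLinearMap.fderiv]
    rw [dhat_apply K.smooth_J hχ hf2 hz, h1.fderiv_eq, h1.eq_of_nhds]
    simp
  have hpb : ∀ a b, pb2 (pot K.J K.Ω (fun q => 0 + t * f q)) χ z a b =
      pb2 K.Ω χ z a b + t * dhat K.J f χ z a b := fun a b => by
    rw [← pb2_d_Jd_eq_dhat K.smooth_J hχ hf2 hz]
    simp only [pb2]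
    rw [pot_add_smul K.smooth_J K.Ω h0 hf2, pot_const K.smooth_J]
    rfl
  have hinv : pb2 K.Ω χ z (jhat K.J χ z u) (jhat K.J χ z v) = pb2 K.Ω χ z u v := by
    simp only [pb2, hχ.jhat_tmap K.J hz]
    exact K.invariant _ _ _
  have hre : (p20 (pb2 (pot K.J K.Ω (fun q => 0 + t * f q)) χ z) (jhat K.J χ z) u v).re = 0 :=
    congrArg Complex.re ((P20_tmap K.J (pot K.J K.Ω (fun q => 0 + t * f q)) hχ hz u v).symm.trans h)
  rw [p20_re, hpb, hpb, hinv, hD, hD, fderiv_jhat_jhat K hχ hz, fderiv_jhat_jhat K hχ hz] at hre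
  -- The anti-invariant combination is J applied to the Nijenhuis tensor, once J² = -1 has been
  -- differentiated.
  have hkey : fderiv ℝ (jhat K.J χ) z u v - fderiv ℝ (jhat K.J χ) z v u -
      (-jhat K.J χ z (fderiv ℝ (jhat K.J χ) z (jhat K.J χ z u) v) -
        -jhat K.J χ z (fderiv ℝ (jhat K.J χ) z (jhat K.J χ z v) u)) = w := by
    rw [hw, hNdef, nhat]
    simp only [map_sub, map_add, jhat_jhat K hχ hz]
    abel
  have h3 : t * inner ℝ w w = 0 := by
    conv_lhs => rw [← hkey]
    rw [← hkey] at hre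
    simp only [inner_sub_right] at hre ⊢
    linarith
  rcases mul_eq_zero.1 h3 with h3 | h3
  · exact ht0 h3
  · exact hw0 (inner_self_eq_zero.1 h3)

end NonzeroTau

/-! ### Simultaneous diagonalization of two Hermitian forms -/

section UnitaryFrame

variable {E : Type*} [NormedAddCommGroup E] [NormedSpace ℝ E] [FiniteDimensional ℝ E]

/-- A `J`-invariant inner product on a vector space with complex structure `j`. -/
structure IsHermitianForm (j : E →ₗ[ℝ] E) (g : E →ₗ[ℝ] E →ₗ[ℝ] ℝ) : Prop where
  symm : ∀ u v, g u v = g v u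
  invariant : ∀ u v, g (j u) (j v) = g u v

theorem IsHermitianForm.swap {j : E →ₗ[ℝ] E} {g : E →ₗ[ℝ] E →ₗ[ℝ] ℝ} (hg : IsHermitianForm j g)
    (hj : ∀ v, j (j v) = -v) (u v : E) : g (j u) v = - g u (j v) := by
  rw [← hg.invariant (j u) v, hj, map_neg, LinearMap.neg_apply]

theorem IsHermitianForm.self_J {j : E →ₗ[ℝ] E} {g : E →ₗ[ℝ] E →ₗ[ℝ] ℝ} (hg : IsHermitianForm j g)
    (hj : ∀ v, j (j v) = -v) (u : E) : g u (j u) = 0 := by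
  have := hg.swap hj u u
  rw [hg.symm] at this
  linarith

/-- A semidefinite form vanishing at a vector is degenerate there. -/
theorem eq_zero_of_nonneg {x y : ℝ} (hy : 0 ≤ y) (h : ∀ t : ℝ, 0 ≤ 2 * t * x + t ^ 2 * y) :
    x = 0 := by
  by_contra hx
  -- Nearly the minimizer of the quadratic; y + 1 in place of y also covers y = 0.
  have h1 := h (-x / (y + 1))
  have hy1 : 0 < y + 1 := by linarith
  have h2 : 2 * (-x / (y + 1)) * x + (-x / (y + 1)) ^ 2 * y = -(x ^ 2 * (y + 2)) / (y + 1) ^ 2 := by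
    field_simp
    ring
  rw [h2, le_div_iff₀ (by positivity)] at h1
  have : 0 < x ^ 2 * (y + 2) := by positivity
  linarith

/-- A unitary family of `m` vectors. -/
structure IsUnitary (j : E →ₗ[ℝ] E) (g : E →ₗ[ℝ] E →ₗ[ℝ] ℝ) (m : ℕ) (c : ℕ → E) : Prop where
  orth : ∀ a < m, ∀ b < m, g (c a) (c b) = if a = b then 1 else 0
  orth_J : ∀ a < m, ∀ b < m, g (c a) (j (c b)) = 0

/-- The difference of a vector and its projection to the span of a unitary family. -/
def residual (j : E →ₗ[ℝ] E) (g : E →ₗ[ℝ] E →ₗ[ℝ] ℝ) (m : ℕ) (c : ℕ → E) (w : E) : E :=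
  w - ∑ a ∈ Finset.range m, (g (c a) w • c a + g (j (c a)) w • j (c a))

theorem IsUnitary.orth_residual {j : E →ₗ[ℝ] E} {g : E →ₗ[ℝ] E →ₗ[ℝ] ℝ}
    (hg : IsHermitianForm j g) {m : ℕ} {c : ℕ → E} (hc : IsUnitary j g m c) (w : E) (b : ℕ)
    (hb : b < m) : g (c b) (residual j g m c w) = 0 ∧ g (j (c b)) (residual j g m c w) = 0 := by
  refine ⟨?_, ?_⟩
  · rw [residual, map_sub, map_sum, Finset.sum_eq_single b]
    · simp [hc.orth b hb b hb, hc.orth_J b hb b hb]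
    · intro a ha hab
      have ha := Finset.mem_range.1 ha
      simp [hc.orth b hb a ha, hc.orth_J b hb a ha, hab.symm]
    · intro h; exact absurd (Finset.mem_range.2 hb) h
  · have e1 : ∀ a < m, g (j (c b)) (c a) = 0 := fun a ha => by
      rw [hg.symm, hc.orth_J a ha b hb]
    rw [residual, map_sub, map_sum, Finset.sum_eq_single b]
    · simp [e1 b hb, hg.invariant, hc.orth b hb b hb]
    · intro a ha hab
      have ha := Finset.mem_range.1 ha
      simp [e1 a ha, hg.invariant, hc.orth b hb a ha, hab.symm]
    · intro h; exact absurd (Finset.mem_range.2 hb) h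

theorem IsUnitary.residual_eq {j : E →ₗ[ℝ] E} {g : E →ₗ[ℝ] E →ₗ[ℝ] ℝ}
    (hg : IsHermitianForm j g) {m : ℕ} {c : ℕ → E} (hc : IsUnitary j g (m + 1) c) :
    residual j g m c (c m) = c m := by
  rw [residual, sub_eq_self]
  refine Finset.sum_eq_zero fun a ha => ?_
  have ha := Finset.mem_range.1 ha
  rw [hc.orth a (by omega) m (by omega), hg.symm, hc.orth_J m (by omega) a (by omega),
    if_neg ha.ne]
  simp

/-- Normalizing v suffices: g(v, Jv) = 0 is automatic, and orthogonality to J(c a) gives that of c a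
to Jv. -/
theorem IsUnitary.update {j : E →ₗ[ℝ] E} (hj : ∀ v, j (j v) = -v) {g : E →ₗ[ℝ] E →ₗ[ℝ] ℝ}
    (hg : IsHermitianForm j g) {m : ℕ} {c : ℕ → E} (hc : IsUnitary j g m c) {v : E}
    (hv : 0 < g v v) (ho : ∀ a < m, g (c a) v = 0 ∧ g (j (c a)) v = 0) :
    IsUnitary j g (m + 1) (Function.update c m ((Real.sqrt (g v v))⁻¹ • v)) := by
  set r := (Real.sqrt (g v v))⁻¹ with hr
  have hr2 : r * r * g v v = 1 := by
    rw [hr, ← mul_inv, Real.mul_self_sqrt hv.le, inv_mul_cancel₀ hv.ne']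
  have hu : ∀ a < m, Function.update c m (r • v) a = c a := fun a ha =>
    Function.update_of_ne ha.ne _ _
  refine ⟨?_, ?_⟩
  · intro a ha b hb
    rcases Nat.lt_succ_iff_lt_or_eq.1 ha with ha | rfl <;>
      rcases Nat.lt_succ_iff_lt_or_eq.1 hb with hb | rfl
    · rw [hu a ha, hu b hb, hc.orth a ha b hb]
    · rw [hu a ha, Function.update_self, if_neg ha.ne, map_smul, (ho a ha).1, smul_zero]
    · rw [hu b hb, Function.update_self, if_neg hb.ne', hg.symm, map_smul, (ho b hb).1, smul_zero]
    · rw [Function.update_self, if_pos rfl, map_smul, map_smul, LinearMap.smul_apply, smul_eq_mul,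
        smul_eq_mul, ← hr2]
      ring
  · intro a ha b hb
    rcases Nat.lt_succ_iff_lt_or_eq.1 ha with ha | rfl <;>
      rcases Nat.lt_succ_iff_lt_or_eq.1 hb with hb | rfl
    · rw [hu a ha, hu b hb, hc.orth_J a ha b hb]
    · have := hg.swap hj (c a) v
      rw [(ho a ha).2] at this
      rw [hu a ha, Function.update_self, map_smul, map_smul, neg_eq_zero.1 this.symm, smul_zero]
    · rw [hu b hb, Function.update_self, hg.symm, map_smul, (ho b hb).2, smul_zero]
    · exact hg.self_J hj _

/-- A unitary family of `m` vectors which are eigenvectors of `h` with respect to `g`. -/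
structure IsEigenFrame (j : E →ₗ[ℝ] E) (g h : E →ₗ[ℝ] E →ₗ[ℝ] ℝ) (m : ℕ) (c : ℕ → E) (l : ℕ → ℝ) :
    Prop extends IsUnitary j g m c where
  eigen : ∀ a < m, ∀ w, h (c a) w = l a * g (c a) w

/-- Minimize h/g over the g-orthogonal complement of the vectors found and their images under J.
With μ the minimum, h - μg is semidefinite there and vanishes at the minimizer w₀, so h(w₀, ·) = μ
g(w₀, ·) on the complement. On the span of the earlier vectors both sides vanish, these being
eigenvectors orthogonal to w₀ and Jw₀. -/
theorem IsEigenFrame.exists_succ {j : E →ₗ[ℝ] E} (hj : ∀ v, j (j v) = -v)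
    {g h : E →ₗ[ℝ] E →ₗ[ℝ] ℝ} (hg : IsHermitianForm j g) (hh : IsHermitianForm j h)
    (hpos : ∀ v, v ≠ 0 → 0 < g v v) (hgc : Continuous fun w => g w w)
    (hhc : Continuous fun w => h w w) {m : ℕ} {c : ℕ → E} {l : ℕ → ℝ}
    (hc : IsEigenFrame j g h m c l) (hm : 2 * m < Module.finrank ℝ E) :
    ∃ c' l', IsEigenFrame j g h (m + 1) c' l' := by
  let Φ : E →ₗ[ℝ] (Fin m × Fin 2 → ℝ) :=
    LinearMap.pi fun k => g (![c k.1, j (c k.1)] k.2)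
  have hΦ : ∀ w, Φ w = 0 ↔ ∀ a < m, g (c a) w = 0 ∧ g (j (c a)) w = 0 := fun w => by
    constructor
    · intro h a ha
      exact ⟨congrFun h (⟨a, ha⟩, 0), congrFun h (⟨a, ha⟩, 1)⟩
    · intro h
      funext k
      obtain ⟨⟨a, ha⟩, s⟩ := k
      fin_cases s
      · exact (h a ha).1
      · exact (h a ha).2
  -- The complement is cut out by 2m linear conditions, fewer than the dimension.
  have hker : LinearMap.ker Φ ≠ ⊥ := by
    refine LinearMap.ker_ne_bot_of_finrank_lt ?_
    simp
    omega
  obtain ⟨w₁, hw₁, hw₁0⟩ := Submodule.exists_mem_ne_zero_of_ne_bot hker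
  have hWs : ∀ (t : ℝ) (w : E), Φ w = 0 → Φ (t • w) = 0 := fun t w hw => by rw [map_smul, hw, smul_zero]
  have hΦc : Continuous Φ := Φ.continuous_of_finiteDimensional
  set S : Set E := Metric.sphere 0 1 ∩ {w | Φ w = 0} with hS
  have hSc : IsCompact S := by
    have := FiniteDimensional.proper ℝ E
    exact (isCompact_sphere 0 1).inter_right (isClosed_eq hΦc continuous_const)
  have hne : ∀ w : E, ‖w‖ = 1 → w ≠ 0 := fun w hw h0 => by simp [h0] at hw
  have hnorm : ∀ w, w ≠ 0 → Φ w = 0 → ‖w‖⁻¹ • w ∈ S := fun w hw0 hw => by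
    refine ⟨?_, hWs _ _ hw⟩
    simp [norm_smul, norm_ne_zero_iff.2 hw0]
  have hSne : S.Nonempty := ⟨_, hnorm w₁ hw₁0 hw₁⟩
  have hcont : ContinuousOn (fun w => h w w / g w w) S := fun w hw =>
    (hhc.continuousAt.div hgc.continuousAt
      (hpos w (hne w (by simpa using hw.1))).ne').continuousWithinAt
  obtain ⟨w₀, hw₀, hmin⟩ := hSc.exists_isMinOn hSne hcont
  set μ := h w₀ w₀ / g w₀ w₀ with hμ
  have hw₀0 : w₀ ≠ 0 := hne w₀ (by simpa using hw₀.1)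
  have hg0 := hpos w₀ hw₀0
  have hq : ∀ w, Φ w = 0 → 0 ≤ h w w - μ * g w w := fun w hw => by
    by_cases hw0 : w = 0
    · simp [hw0]
    · have h1 := hmin (hnorm w hw0 hw)
      simp only [Set.mem_ofPred_eq, map_smul, LinearMap.smul_apply, smul_eq_mul] at h1
      have hn : ‖w‖⁻¹ ≠ 0 := inv_ne_zero (norm_ne_zero_iff.2 hw0)
      rw [mul_div_mul_left _ _ hn, mul_div_mul_left _ _ hn, ← hμ, le_div_iff₀ (hpos w hw0)] at h1
      linarith
  have hq0 : h w₀ w₀ - μ * g w₀ w₀ = 0 := by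
    rw [hμ]; field_simp; ring
  have hW : ∀ w, Φ w = 0 → h w₀ w = μ * g w₀ w := fun w hw => by
    have : h w₀ w - μ * g w₀ w = 0 := by
      refine eq_zero_of_nonneg (hq w hw) fun t => ?_
      have h1 := hq (w₀ + t • w) (by rw [map_add, map_smul, hw, hw₀.2]; simp)
      simp only [map_add, map_smul, LinearMap.add_apply, LinearMap.smul_apply, smul_eq_mul] at h1
      rw [hh.symm w w₀, hg.symm w w₀] at h1
      linarith
    linarith
  have ho : ∀ a < m, g (c a) w₀ = 0 ∧ g (j (c a)) w₀ = 0 := (hΦ w₀).1 hw₀.2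
  have hoJ : ∀ a < m, g (c a) (j w₀) = 0 := fun a ha => by
    have := hg.swap hj (c a) w₀
    rw [(ho a ha).2] at this
    linarith
  have heig : ∀ w, h w₀ w = μ * g w₀ w := fun w => by
    set w' := ∑ a ∈ Finset.range m, (g (c a) w • c a + g (j (c a)) w • j (c a)) with hw'
    have h0 : Φ (w - w') = 0 := (hΦ _).2 fun b hb => hc.orth_residual hg w b hb
    have h1 : h w₀ w' = 0 := by
      rw [hw', map_sum]
      refine Finset.sum_eq_zero fun a ha => ?_
      have ha := Finset.mem_range.1 ha
      have e1 : h w₀ (c a) = 0 := by rw [hh.symm, hc.eigen a ha, (ho a ha).1, mul_zero]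
      have e2 : h w₀ (j (c a)) = 0 := by
        rw [hh.symm, hh.swap hj, hc.eigen a ha, hoJ a ha, mul_zero, neg_zero]
      simp [e1, e2]
    have h2 : g w₀ w' = 0 := by
      rw [hw', map_sum]
      refine Finset.sum_eq_zero fun a ha => ?_
      have ha := Finset.mem_range.1 ha
      have e1 : g w₀ (c a) = 0 := by rw [hg.symm, (ho a ha).1]
      have e2 : g w₀ (j (c a)) = 0 := by rw [hg.symm, (ho a ha).2]
      simp [e1, e2]
    have h3 := hW _ h0
    rw [map_sub, map_sub, h1, h2] at h3
    linarith
  refine ⟨_, Function.update l m μ, hc.toIsUnitary.update hj hg hg0 ho, ?_⟩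
  intro a ha w
  rcases Nat.lt_succ_iff_lt_or_eq.1 ha with ha | rfl
  · rw [Function.update_of_ne ha.ne, Function.update_of_ne ha.ne, hc.eigen a ha]
  · rw [Function.update_self, Function.update_self, map_smul, map_smul, LinearMap.smul_apply,
      LinearMap.smul_apply, heig, smul_eq_mul, smul_eq_mul]
    ring

theorem exists_eigenFrame {j : E →ₗ[ℝ] E} (hj : ∀ v, j (j v) = -v)
    {g h : E →ₗ[ℝ] E →ₗ[ℝ] ℝ} (hg : IsHermitianForm j g) (hh : IsHermitianForm j h)
    (hpos : ∀ v, v ≠ 0 → 0 < g v v) (hgc : Continuous fun w => g w w)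
    (hhc : Continuous fun w => h w w) (m : ℕ) (hm : 2 * m ≤ Module.finrank ℝ E) :
    ∃ c l, IsEigenFrame j g h m c l := by
  induction m with
  | zero => exact ⟨fun _ => 0, fun _ => 0, ⟨⟨by simp, by simp⟩, by simp⟩⟩
  | succ m ih =>
    obtain ⟨c, l, hc⟩ := ih (by omega)
    exact hc.exists_succ hj hg hh hpos hgc hhc (by omega)

/-- A unitary family of maximal length spans. -/
theorem eq_sum_of_unitary {n : ℕ} {j : E →ₗ[ℝ] E} (hdim : Module.finrank ℝ E = 2 * n)
    {g : E →ₗ[ℝ] E →ₗ[ℝ] ℝ} (hg : IsHermitianForm j g) {c : Fin n → E}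
    (h1 : ∀ a b, g (c a) (c b) = if a = b then 1 else 0) (h2 : ∀ a b, g (c a) (j (c b)) = 0)
    (w : E) : w = ∑ a, (g (c a) w • c a + g (j (c a)) w • j (c a)) := by
  let Φ : E →ₗ[ℝ] (Fin n × Fin 2 → ℝ) :=
    LinearMap.pi fun k => g (![c k.1, j (c k.1)] k.2)
  have e1 : ∀ a b, g (j (c b)) (c a) = 0 := fun a b => by rw [hg.symm, h2]
  have hΦ : ∀ (x y : Fin n → ℝ) (b : Fin n), g (c b) (∑ a, (x a • c a + y a • j (c a))) = x b ∧
      g (j (c b)) (∑ a, (x a • c a + y a • j (c a))) = y b := fun x y b => by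
    constructor
    · rw [map_sum, Finset.sum_eq_single b]
      · simp [h1, h2]
      · intro a _ hab
        simp [h1, h2, hab.symm]
      · simp
    · rw [map_sum, Finset.sum_eq_single b]
      · simp [e1, hg.invariant, h1]
      · intro a _ hab
        simp [e1, hg.invariant, h1, hab.symm]
      · simp
  -- The coefficient map to ℝ²ⁿ is onto, hence injective by dimension; both sides have the same
  -- coefficients.
  have hsurj : Function.Surjective Φ := fun y => by
    refine ⟨∑ a, (y (a, 0) • c a + y (a, 1) • j (c a)), ?_⟩
    funext k
    obtain ⟨b, s⟩ := k
    fin_cases s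
    · exact (hΦ (fun a => y (a, 0)) (fun a => y (a, 1)) b).1
    · exact (hΦ (fun a => y (a, 0)) (fun a => y (a, 1)) b).2
  have hinj : Function.Injective Φ :=
    (LinearMap.injective_iff_surjective_of_finrank_eq_finrank (by simp [hdim, mul_comm])).2 hsurj
  apply hinj
  funext k
  obtain ⟨b, s⟩ := k
  fin_cases s
  · exact (hΦ (fun a => g (c a) w) (fun a => g (j (c a)) w) b).1.symm
  · exact (hΦ (fun a => g (c a) w) (fun a => g (j (c a)) w) b).2.symm

theorem exists_perm {n : ℕ} (hn : 2 ≤ n) {a b : Fin n} (hab : a ≠ b) :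
    ∃ π : Equiv.Perm (Fin n), π ⟨0, by omega⟩ = a ∧ π ⟨1, by omega⟩ = b := by
  set z : Fin n := ⟨0, by omega⟩
  set o : Fin n := ⟨1, by omega⟩
  have hzo : z ≠ o := by simp [z, o]
  set s := Equiv.swap z a
  refine ⟨(Equiv.swap o (s b)).trans s, ?_, ?_⟩
  · have : z ≠ s b := fun h => hab (by
      have h2 := congrArg s h
      rw [Equiv.swap_apply_left, Equiv.swap_apply_self] at h2
      exact h2)
    rw [Equiv.trans_apply, Equiv.swap_apply_of_ne_of_ne hzo this, Equiv.swap_apply_left]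
  · rw [Equiv.trans_apply, Equiv.swap_apply_left, Equiv.swap_apply_self]

/-- Simultaneous diagonalization, with a nonzero skew form in the first two directions. -/
theorem exists_diagonal_frame {n : ℕ} (hn : 2 ≤ n) (hdim : Module.finrank ℝ E = 2 * n)
    {j : E →ₗ[ℝ] E} (hj : ∀ v, j (j v) = -v)
    {g h : E →ₗ[ℝ] E →ₗ[ℝ] ℝ} (hg : IsHermitianForm j g) (hh : IsHermitianForm j h)
    (hpos : ∀ v, v ≠ 0 → 0 < g v v) (hgc : Continuous fun w => g w w)
    (hhc : Continuous fun w => h w w) (T : E →ₗ[ℝ] E →ₗ[ℝ] ℂ) (hT : ∀ u, T u u = 0)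
    (hTl : ∀ u v, T (j u) v = Complex.I * T u v) (hTr : ∀ u v, T u (j v) = Complex.I * T u v)
    (hne : ∃ u v, T u v ≠ 0) :
    ∃ (c : Fin n → E) (l : Fin n → ℝ),
      (∀ a b, g (c a) (c b) = if a = b then 1 else 0) ∧ (∀ a b, g (c a) (j (c b)) = 0) ∧
      (∀ a w, h (c a) w = l a * g (c a) w) ∧ T (c ⟨0, by omega⟩) (c ⟨1, by omega⟩) ≠ 0 := by
  obtain ⟨c, l, hc⟩ := exists_eigenFrame hj hg hh hpos hgc hhc n hdim.ge
  have h1 : ∀ a b : Fin n, g (c a) (c b) = if a = b then 1 else 0 := fun a b => by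
    rw [hc.orth a a.2 b b.2]
    simp [Fin.ext_iff]
  have h2 : ∀ a b : Fin n, g (c a) (j (c b)) = 0 := fun a b => hc.orth_J a a.2 b b.2
  -- The frame and its image under J span, so a complex bilinear form vanishing on all pairs of the
  -- frame is zero. A permutation then moves the good pair to the first two places.
  obtain ⟨a, b, hab⟩ : ∃ a b : Fin n, T (c a) (c b) ≠ 0 := by
    by_contra! h0
    obtain ⟨u, v, huv⟩ := hne
    refine huv ?_
    rw [eq_sum_of_unitary (c := fun a : Fin n => c a) hdim hg h1 h2 u,
      eq_sum_of_unitary (c := fun a : Fin n => c a) hdim hg h1 h2 v]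
    simp only [map_sum, map_add, map_smul, LinearMap.coe_sum, Finset.sum_apply,
      LinearMap.add_apply, LinearMap.smul_apply, hTl, hTr, h0]
    simp
  have hne' : a ≠ b := fun h => hab (by rw [h, hT])
  obtain ⟨π, h0, h1'⟩ := exists_perm hn hne'
  refine ⟨fun i => c (π i), fun i => l (π i), fun i k => ?_, fun i k => h2 _ _,
    fun i w => hc.eigen _ (π i).2 w, ?_⟩
  · rw [h1]
    simp
  · simp only [h0, h1']
    exact hab

end UnitaryFrame

/-! ### Smooth Gram–Schmidt -/

section GramSchmidt

variable {E : Type*} [NormedAddCommGroup E] [NormedSpace ℝ E] [FiniteDimensional ℝ E]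

/-- Local smooth extension of a unitary family at a point. -/
theorem exists_smooth_unitary {O : Set E} (hO : IsOpen O) {z₀ : E} (hz₀ : z₀ ∈ O)
    {g : E → E →L[ℝ] E →L[ℝ] ℝ} {j : E → E →L[ℝ] E} (hgs : ContDiffOn ℝ ∞ g O)
    (hjs : ContDiffOn ℝ ∞ j O) (hj : ∀ z ∈ O, ∀ v, j z (j z v) = -v)
    (hg : ∀ z ∈ O, IsHermitianForm (j z).toLinearMap (g z).toLinearMap₁₂)
    {c : ℕ → E} (m : ℕ) (hc : IsUnitary (j z₀).toLinearMap (g z₀).toLinearMap₁₂ m c) :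
    ∃ (O' : Set E) (ε : ℕ → E → E), IsOpen O' ∧ z₀ ∈ O' ∧ O' ⊆ O ∧
      (∀ a < m, ContDiffOn ℝ ∞ (ε a) O' ∧ ε a z₀ = c a) ∧
      ∀ z ∈ O', IsUnitary (j z).toLinearMap (g z).toLinearMap₁₂ m (fun a => ε a z) := by
  induction m with
  | zero =>
    exact ⟨O, fun _ _ => 0, hO, hz₀, subset_rfl, fun a ha => absurd ha (Nat.not_lt_zero a),
      fun z _ => ⟨by simp, by simp⟩⟩
  | succ m ih =>
    obtain ⟨O', ε, hO', hz', hsub, hε, hun⟩ := ih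
      ⟨fun a ha b hb => hc.orth a (by omega) b (by omega),
        fun a ha b hb => hc.orth_J a (by omega) b (by omega)⟩
    have hgs' := hgs.mono hsub
    have hjs' := hjs.mono hsub
    -- The constant vector c m minus its projection to the frame built so far. At z₀ the projection
    -- is zero, so w has norm 1 there and stays nonzero nearby.
    set w : E → E := fun z => c m - ∑ a ∈ Finset.range m,
      (g z (ε a z) (c m) • ε a z + g z (j z (ε a z)) (c m) • j z (ε a z)) with hw
    have hwr : ∀ z, w z = residual (j z).toLinearMap (g z).toLinearMap₁₂ m (fun a => ε a z) (c m) :=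
      fun z => rfl
    have hws : ContDiffOn ℝ ∞ w O' := by
      refine contDiffOn_const.sub (ContDiffOn.sum fun a ha => ?_)
      have h1 := (hε a (Finset.mem_range.1 ha)).1
      have h2 : ContDiffOn ℝ ∞ (fun z => j z (ε a z)) O' := hjs'.clm_apply h1
      exact (((hgs'.clm_apply h1).clm_apply contDiffOn_const).smul h1).add
        (((hgs'.clm_apply h2).clm_apply contDiffOn_const).smul h2)
    have hN : ContDiffOn ℝ ∞ (fun z => g z (w z) (w z)) O' := (hgs'.clm_apply hws).clm_apply hws
    have hw0 : w z₀ = c m := by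
      rw [hwr]
      refine Eq.trans ?_ (hc.residual_eq (hg z₀ hz₀))
      simp only [residual]
      refine congrArg _ (Finset.sum_congr rfl fun a ha => ?_)
      rw [(hε a (Finset.mem_range.1 ha)).2]
    have hN0 : g z₀ (w z₀) (w z₀) = 1 := by
      rw [hw0]
      have := hc.orth m (by omega) m (by omega)
      rwa [if_pos rfl] at this
    set O'' := O' ∩ (fun z => g z (w z) (w z)) ⁻¹' Set.Ioi 0 with hO''
    have hop : IsOpen O'' := hN.continuousOn.isOpen_inter_preimage hO' isOpen_Ioi
    refine ⟨O'', Function.update ε m (fun z => (Real.sqrt (g z (w z) (w z)))⁻¹ • w z), hop,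
      ⟨hz', by simp [hN0]⟩, Set.inter_subset_left.trans hsub, ?_, ?_⟩
    · intro a ha
      rcases Nat.lt_succ_iff_lt_or_eq.1 ha with ha | rfl
      · rw [Function.update_of_ne ha.ne]
        exact ⟨(hε a ha).1.mono Set.inter_subset_left, (hε a ha).2⟩
      · rw [Function.update_self]
        refine ⟨?_, by
          rw [hN0, hw0, Real.sqrt_one, inv_one, one_smul]⟩
        have hN' := hN.mono (Set.inter_subset_left (s := O')
          (t := (fun z => g z (w z) (w z)) ⁻¹' Set.Ioi 0))
        exact ((hN'.sqrt fun z hz => (ne_of_gt hz.2)).inv fun z hz =>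
          (Real.sqrt_pos.2 hz.2).ne').smul (hws.mono Set.inter_subset_left)
    · intro z hz
      have h1 := (hun z hz.1).update (hj z (hsub hz.1)) (hg z (hsub hz.1)) (v := w z) hz.2
        fun a ha => by
          rw [hwr]
          exact (hun z hz.1).orth_residual (hg z (hsub hz.1)) (c m) a ha
      convert h1 using 1
      funext a
      by_cases ha : a = m
      · subst ha
        simp only [Function.update_self]
        rfl
      · simp only [Function.update_of_ne ha]

end GramSchmidt

/-! ### The ball parametrization -/

section Chart

open OpenPartialHomeomorph in
/-- The derivative of the ball parametrization at the centre. -/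
theorem hasFDerivAt_univBall {E : Type*} [NormedAddCommGroup E] [InnerProductSpace ℝ E] (c : E)
    {r : ℝ} (hr : 0 < r) :
    HasFDerivAt (univBall c r : E → E) (r • ContinuousLinearMap.id ℝ E) 0 := by
  have h1 : HasFDerivAt (fun x : E => (Real.sqrt (1 + ‖x‖ ^ 2))⁻¹ • x)
      (ContinuousLinearMap.id ℝ E) 0 := by
    have hs : DifferentiableAt ℝ (fun x : E => (Real.sqrt (1 + ‖x‖ ^ 2))⁻¹) 0 := by
      have h2 : DifferentiableAt ℝ (fun x : E => 1 + ‖x‖ ^ 2) 0 :=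
        (differentiableAt_const _).add (differentiableAt_id.norm_sq ℝ)
      exact (h2.sqrt (by simp)).inv (by simp)
    -- The derivative of the scalar factor is multiplied by x = 0, so only its value 1 contributes.
    have h3 := hs.hasFDerivAt.smul (hasFDerivAt_id (𝕜 := ℝ) (0 : E))
    refine h3.congr_fderiv ?_
    ext v
    simp
  have h2 : (univBall c r : E → E) = fun x => r • ((Real.sqrt (1 + ‖x‖ ^ 2))⁻¹ • x) + c := by
    funext x
    rw [univBall, dif_pos hr]
    simp [univUnitBall, unitBallBall]
  rw [h2]
  exact (h1.const_smul r).add_const c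

end Chart

/-! ### Frames adapted to a taming pair of forms -/

section Hermitian

variable {E : Type*} [NormedAddCommGroup E] [NormedSpace ℝ E] [FiniteDimensional ℝ E]

theorem isHermitianForm_compl₂ {j : E →ₗ[ℝ] E} (hj : ∀ v, j (j v) = -v) {B : E →ₗ[ℝ] E →ₗ[ℝ] ℝ}
    (hB : ∀ u, B u u = 0) (hI : ∀ u v, B (j u) (j v) = B u v) :
    IsHermitianForm j (B.compl₂ j) := by
  have hs : ∀ u v, B u v = - B v u := fun u v => by
    have := hB (u + v)
    simp only [map_add, LinearMap.add_apply, hB] at this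
    linarith
  refine ⟨fun u v => ?_, fun u v => ?_⟩
  · rw [LinearMap.compl₂_apply, LinearMap.compl₂_apply, ← hI u (j v), hj, map_neg, hs (j u) v, neg_neg]
  · rw [LinearMap.compl₂_apply, LinearMap.compl₂_apply, hI]

theorem p11L_invariant {j : E →ₗ[ℝ] E} (hj : ∀ v, j (j v) = -v) (B : E →ₗ[ℝ] E →ₗ[ℝ] ℝ)
    (u v : E) : p11L B j (j u) (j v) = p11L B j u v := by
  rw [p11L_apply, p11L_apply, hj, hj]
  simp only [map_neg, LinearMap.neg_apply]
  ring

theorem p20L_J_left {j : E →ₗ[ℝ] E} (hj : ∀ v, j (j v) = -v) (B : E →ₗ[ℝ] E →ₗ[ℝ] ℝ)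
    (u v : E) : p20L B j (j u) v = Complex.I * p20L B j u v := by
  rw [p20L_apply, p20L_apply, hj]
  simp only [map_neg, LinearMap.neg_apply]
  push_cast
  linear_combination ((B u (j v) : ℂ) + B (j u) v) / 4 * Complex.I_mul_I

theorem p20L_J_right {j : E →ₗ[ℝ] E} (hj : ∀ v, j (j v) = -v) (B : E →ₗ[ℝ] E →ₗ[ℝ] ℝ)
    (u v : E) : p20L B j u (j v) = Complex.I * p20L B j u v := by
  rw [p20L_apply, p20L_apply, hj]
  simp only [map_neg]
  push_cast
  linear_combination ((B u (j v) : ℂ) + B (j u) v) / 4 * Complex.I_mul_I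

/-- A diagonalizing frame at a point, for the forms given by a taming pair. -/
theorem exists_frame_at {n : ℕ} (hn : 2 ≤ n) (hdim : Module.finrank ℝ E = 2 * n)
    {j : E →ₗ[ℝ] E} (hj : ∀ v, j (j v) = -v) {A B : E →ₗ[ℝ] E →ₗ[ℝ] ℝ}
    (hA : ∀ u, A u u = 0) (hB : ∀ u, B u u = 0) (hI : ∀ u v, A (j u) (j v) = A u v)
    (hpos : ∀ v, v ≠ 0 → 0 < A v (j v)) (hne : ∃ u v, p20L B j u v ≠ 0) :
    ∃ (c : Fin n → E) (l : Fin n → ℝ),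
      (∀ a b, A (c a) (j (c b)) = if a = b then 1 else 0) ∧ (∀ a b, A (c a) (c b) = 0) ∧
      (∀ a b, p11L B j (c a) (j (c b)) = if a = b then l a else 0) ∧
      (∀ a b, p11L B j (c a) (c b) = 0) ∧
      p20L B j (c ⟨0, by omega⟩) (c ⟨1, by omega⟩) ≠ 0 := by
  have hcont : ∀ G : E →ₗ[ℝ] E →ₗ[ℝ] ℝ, Continuous fun w => G w w := fun G => by
    have h1 : Continuous fun w : E => LinearMap.toContinuousLinearMap (G w) :=
      (LinearMap.toContinuousLinearMap.toLinearMap ∘ₗ G).continuous_of_finiteDimensional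
    exact h1.clm_apply continuous_id
  have hp11 : ∀ u, p11L B j u u = 0 := fun u => by
    rw [p11L_apply, hB, hB]; simp
  -- The Hermitian forms are A(·, J·) and the (1,1)-part of B composed likewise; only the first has
  -- to be definite.
  obtain ⟨c, l, h1, h2, h3, h4⟩ := exists_diagonal_frame hn hdim hj
    (isHermitianForm_compl₂ hj hA hI) (isHermitianForm_compl₂ hj hp11 (p11L_invariant hj B))
    hpos (hcont _) (hcont _) (p20L B j) (fun u => self_eq_neg.1 (p20L_swap B hB j u u))
    (p20L_J_left hj B) (p20L_J_right hj B) hne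
  have h2' : ∀ a b, A (c a) (c b) = 0 := fun a b => by
    have := h2 a b
    rw [LinearMap.compl₂_apply, hj, map_neg, neg_eq_zero] at this
    exact this
  refine ⟨c, l, h1, h2', fun a b => ?_, fun a b => ?_, h4⟩
  · have := h3 a (c b)
    rw [LinearMap.compl₂_apply, h1] at this
    rw [this]
    split_ifs <;> simp
  · have := h3 a (j (c b))
    rw [LinearMap.compl₂_apply, LinearMap.compl₂_apply, hj, map_neg, map_neg, h2'] at this
    linarith

/-- The real linear isomorphism from `ℂⁿ` given by a unitary frame, up to a factor. -/
theorem exists_linear_equiv {n : ℕ} (hdim : Module.finrank ℝ E = 2 * n)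
    {j : E →ₗ[ℝ] E} {g : E →ₗ[ℝ] E →ₗ[ℝ] ℝ} (hg : IsHermitianForm j g) {c : Fin n → E}
    (h1 : ∀ a b, g (c a) (c b) = if a = b then 1 else 0) (h2 : ∀ a b, g (c a) (j (c b)) = 0)
    {s : ℝ} (hs : s ≠ 0) :
    ∃ L : (Fin n → ℂ) ≃L[ℝ] E, (∀ a, L (Pi.single a 1) = s • c a) ∧
      ∀ a, L (Pi.single a Complex.I) = s • j (c a) := by
  let L₀ : (Fin n → ℂ) →ₗ[ℝ] E := (cbasis n).constr ℝ fun i =>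
    s • ![c ((pairEquiv n).symm i).1, j (c ((pairEquiv n).symm i).1)] ((pairEquiv n).symm i).2
  have hL : ∀ k : Fin n × Fin 2, L₀ (Pi.single k.1 (![1, Complex.I] k.2)) = s • ![c k.1, j (c k.1)] k.2 := fun k => by
    rw [← cbasis_apply, Module.Basis.constr_basis, Equiv.symm_apply_apply]
  have e1 : ∀ a, L₀ (Pi.single a 1) = s • c a := fun a => hL (a, 0)
  have e2 : ∀ a, L₀ (Pi.single a Complex.I) = s • j (c a) := fun a => hL (a, 1)
  have hsurj : Function.Surjective L₀ := fun w => by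
    refine ⟨∑ a, ((s⁻¹ * g (c a) w) • (Pi.single a 1 : Fin n → ℂ) +
      (s⁻¹ * g (j (c a)) w) • (Pi.single a Complex.I : Fin n → ℂ)), ?_⟩
    conv_rhs => rw [eq_sum_of_unitary hdim hg h1 h2 w]
    rw [map_sum]
    refine Finset.sum_congr rfl fun a _ => ?_
    rw [map_add, map_smul, map_smul, e1, e2, smul_smul, smul_smul, mul_right_comm,
      inv_mul_cancel₀ hs, one_mul, mul_right_comm, inv_mul_cancel₀ hs, one_mul]
  have hd : Module.finrank ℝ (Fin n → ℂ) = Module.finrank ℝ E := by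
    rw [hdim, Module.finrank_eq_card_basis (cbasis n), Fintype.card_fin]
  have hinj : Function.Injective L₀ :=
    (LinearMap.injective_iff_surjective_of_finrank_eq_finrank hd).2 hsurj
  exact ⟨(LinearEquiv.ofBijective L₀ ⟨hinj, hsurj⟩).toContinuousLinearEquiv, e1, e2⟩

end Hermitian

/-! ### Values of H and τ on the complex frame -/

section Pointwise

variable {n : ℕ} {M : Type*} [TopologicalSpace M] [ChartedSpace (Model n) M]

theorem inv_sqrt_two_mul : (Real.sqrt 2)⁻¹ * (Real.sqrt 2)⁻¹ = 1 / 2 := by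
  rw [← mul_inv, Real.mul_self_sqrt (by norm_num)]
  norm_num

theorem cext_H (K : AKStructure n M) (φ : M → ℝ) (p : M) (X Y : Tan n p) :
    cext (fun X Y => (H K.J K.Ω φ p X Y : ℂ)) (eVec K X) (eBar K Y) =
      (H K.J K.Ω φ p X Y : ℂ) + Complex.I * (H K.J K.Ω φ p X (K.J p Y) : ℂ) := by
  have h := inv_sqrt_two_mul
  have hs : ∀ X Y : Tan n p, H K.J K.Ω φ p ((Real.sqrt 2)⁻¹ • X) ((Real.sqrt 2)⁻¹ • Y) = H K.J K.Ω φ p X Y / 2 := fun X Y => by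
    simp only [H, P11, map_smul, form_smul_left, form_smul_right]
    linear_combination (pot K.J K.Ω φ p ![X, Y] + pot K.J K.Ω φ p ![K.J p X, K.J p Y]) / 2 * h
  have hn : ∀ X Y : Tan n p, H K.J K.Ω φ p (-X) Y = - H K.J K.Ω φ p X Y := fun X Y => by
    simp only [H, P11, map_neg, form_neg_left]
    ring
  have hJ : ∀ X Y : Tan n p, H K.J K.Ω φ p (K.J p X) (K.J p Y) = H K.J K.Ω φ p X Y := fun X Y => by
    simp only [H, P11, K.sq_J, form_neg_left, form_neg_right]
    ring
  have hJ' : H K.J K.Ω φ p (K.J p X) Y = - H K.J K.Ω φ p X (K.J p Y) := by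
    rw [← hJ (K.J p X) Y, K.sq_J, hn]
  simp only [cext, eVec, eBar, hn, hs, hJ, hJ']
  push_cast
  ring

/-- As τ is complex linear for J, it sends (X - iJX)/√2 to √2 times its value at X, in each slot. -/
theorem cext_tau (K : AKStructure n M) (φ : M → ℝ) (p : M) (X Y : Tan n p) :
    cext (tau K.J K.Ω φ p) (eVec K X) (eVec K Y) = 2 * tau K.J K.Ω φ p X Y := by
  have h := inv_sqrt_two_mul
  have hc : ((Real.sqrt 2 : ℝ) : ℂ)⁻¹ * ((Real.sqrt 2 : ℝ) : ℂ)⁻¹ = 1 / 2 := by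
    rw [← Complex.ofReal_inv, ← Complex.ofReal_mul, h]; push_cast; ring
  have hs : ∀ X Y : Tan n p, tau K.J K.Ω φ p ((Real.sqrt 2)⁻¹ • X) ((Real.sqrt 2)⁻¹ • Y) = tau K.J K.Ω φ p X Y / 2 :=
    fun X Y => by
      simp only [tau, P20, map_smul, form_smul_left, form_smul_right]
      push_cast
      linear_combination (((pot K.J K.Ω φ p ![X, Y] : ℂ) - pot K.J K.Ω φ p ![K.J p X, K.J p Y]) -
        Complex.I * ((pot K.J K.Ω φ p ![K.J p X, Y] : ℂ) + pot K.J K.Ω φ p ![X, K.J p Y])) / 4 * hc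
  have hl : ∀ X Y : Tan n p, tau K.J K.Ω φ p (-X) Y = - tau K.J K.Ω φ p X Y := fun X Y => by
    simp only [tau, P20, map_neg, form_neg_left]
    push_cast
    ring
  have hr : ∀ X Y : Tan n p, tau K.J K.Ω φ p X (-Y) = - tau K.J K.Ω φ p X Y := fun X Y => by
    simp only [tau, P20, map_neg, form_neg_right]
    push_cast
    ring
  have hJl : ∀ X Y : Tan n p, tau K.J K.Ω φ p (K.J p X) Y = Complex.I * tau K.J K.Ω φ p X Y :=
    fun X Y => by
      simp only [tau, P20, K.sq_J, form_neg_left]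
      push_cast
      linear_combination ((pot K.J K.Ω φ p ![X, K.J p Y] : ℂ) + pot K.J K.Ω φ p ![K.J p X, Y]) / 4 *
        Complex.I_mul_I
  have hJr : ∀ X Y : Tan n p, tau K.J K.Ω φ p X (K.J p Y) = Complex.I * tau K.J K.Ω φ p X Y :=
    fun X Y => by
      simp only [tau, P20, K.sq_J, form_neg_right]
      push_cast
      linear_combination ((pot K.J K.Ω φ p ![X, K.J p Y] : ℂ) + pot K.J K.Ω φ p ![K.J p X, Y]) / 4 *
        Complex.I_mul_I
  simp only [cext, eVec, hl, hr, hs, hJl, hJr]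
  linear_combination (-3 / 2 * tau K.J K.Ω φ p X Y) * Complex.I_mul_I

end Pointwise

/-! ### Vector fields from coordinate expressions -/

section PushField

variable {n : ℕ} {M : Type*} [TopologicalSpace M] [ChartedSpace (Model n) M]
  {E : Type*} [NormedAddCommGroup E] [NormedSpace ℝ E] {χ : OpenPartialHomeomorph E M}

/-- The vector field on `M` with a given expression in the coordinates of a parametrization. -/
noncomputable def pushField (χ : OpenPartialHomeomorph E M) (w : E → E) (q : M) : Tan n q :=
  tmap n χ (χ.symm q) (w (χ.symm q))

theorem pushField_apply (w : E → E) {z : E} (hz : z ∈ χ.source) :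
    pushField χ w (χ z) = (tmap n χ z (w z) : Tan n (χ z)) := by
  unfold pushField
  rw [χ.left_inv hz]

theorem g_tmap (K : AKStructure n M) (hχ : IsParam n χ) {z : E} (hz : z ∈ χ.source) (u v : E) :
    K.g (χ z) (tmap n χ z u) (tmap n χ z v) = pb2 K.Ω χ z u (jhat K.J χ z v) := by
  unfold AKStructure.g pb2
  exact congrArg (fun w : Tan n (χ z) => K.Ω (χ z) ![tmap n χ z u, w]) (hχ.jhat_tmap K.J hz v).symm

variable [IsManifold 𝓘(ℝ, Model n) ∞ M]

/-- The section is the tangent map of χ composed with the section (x, w(x)) and with the inverse of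
χ. -/
theorem isSmoothField_pushField (hχ : IsParam n χ) {O : Set E} (hO : O ⊆ χ.source)
    {w : E → E} (hw : ContDiffOn ℝ ∞ w O) :
    IsSmoothField (n := n) (pushField χ w) (χ.target ∩ χ.symm ⁻¹' O) := by
  have h1 : ContMDiffOn 𝓘(ℝ, E) 𝓘(ℝ, E).tangent ∞
      (fun x => (⟨x, w x⟩ : TangentBundle 𝓘(ℝ, E) E)) O :=
    contMDiffOn_vectorSpace_iff_contDiffOn.2 hw
  have h2 := hχ.smooth.contMDiffOn_tangentMapWithin (m := ∞) (by simp)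
    χ.open_source.uniqueMDiffOn
  have h3 := h2.comp h1 fun x hx => hO hx
  have h4 := h3.comp (hχ.smooth_symm.mono Set.inter_subset_left) fun q hq => hq.2
  refine h4.congr fun q hq => ?_
  have hs : χ.symm q ∈ χ.source := χ.map_target hq.1
  have e : ∀ (q' : M) (v : Model n), q' = q → (⟨q, v⟩ : TangentBundle 𝓘(ℝ, Model n) M) = ⟨q', v⟩ := by
    rintro q' v rfl
    rfl
  refine (e (χ (χ.symm q)) _ (χ.right_inv hq.1)).trans ?_
  simp only [Function.comp_apply, tangentMapWithin]
  rw [mfderivWithin_of_isOpen χ.open_source hs]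
  rfl

end PushField

/-! ### Parametrizing a ball by ℂⁿ -/

section Polydisk

open OpenPartialHomeomorph in
/-- A global parametrization of a ball of the model space with prescribed derivative at the
centre. -/
theorem exists_ball_param {n : ℕ} {E : Type*} [NormedAddCommGroup E] [InnerProductSpace ℝ E]
    (z₀ : E) {r : ℝ} (hr : 0 < r) (L : (Fin n → ℂ) ≃L[ℝ] E) :
    ∃ A : OpenPartialHomeomorph (Fin n → ℂ) E, A.source = Set.univ ∧ A.target = Metric.ball z₀ r ∧
      A 0 = z₀ ∧ ContDiff ℝ ∞ A ∧ ContDiffOn ℝ ∞ A.symm (Metric.ball z₀ r) ∧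
      HasFDerivAt A (r • (L : (Fin n → ℂ) →L[ℝ] E)) 0 := by
  refine ⟨L.toHomeomorph.transOpenPartialHomeomorph (univBall z₀ r), ?_, ?_, ?_, ?_, ?_, ?_⟩
  · simp
  · simp [univBall_target z₀ hr]
  · simp
  · exact contDiff_univBall.comp L.contDiff
  · exact L.symm.contDiff.comp_contDiffOn contDiffOn_univBall_symm
  · have h := hasFDerivAt_univBall z₀ hr
    rw [← map_zero L] at h
    exact h.comp (0 : Fin n → ℂ) L.hasFDerivAt

end Polydisk

/-! ### Existence of the data -/

section Existence

variable {n : ℕ} {M : Type*} [TopologicalSpace M] [ChartedSpace (Model n) M]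
  [IsManifold 𝓘(ℝ, Model n) ∞ M]

theorem finrank_model : Module.finrank ℝ (Model n) = 2 * n := by simp

theorem pb2_self (α : DForm n M 2) (χ : OpenPartialHomeomorph (Model n) M) (z u : Model n) :
    pb2 α χ z u u = 0 := form_self α _ _

theorem pb2_invariant (K : AKStructure n M) {χ : OpenPartialHomeomorph (Model n) M}
    (hχ : IsParam n χ) {z : Model n} (hz : z ∈ χ.source) (u v : Model n) :
    pb2 K.Ω χ z (jhat K.J χ z u) (jhat K.J χ z v) = pb2 K.Ω χ z u v := by
  simp only [pb2, hχ.jhat_tmap K.J hz]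
  exact K.invariant _ _ _

theorem pb2_pos {J : EndField n M} {α : DForm n M 2} (hα : Tames J α)
    {χ : OpenPartialHomeomorph (Model n) M}
    (hχ : IsParam n χ) {z : Model n} (hz : z ∈ χ.source) {u : Model n} (hu : u ≠ 0) :
    0 < pb2 α χ z u (jhat J χ z u) := by
  have h : tmap n χ z u ≠ 0 := fun h => hu (by rw [← hχ.tinv_tmap hz u, h, map_zero])
  simp only [pb2, hχ.jhat_tmap J hz]
  exact hα _ _ h

theorem g_J (K : AKStructure n M) (p : M) (X Y : Tan n p) :
    K.g p X (K.J p Y) = - K.Ω p ![X, Y] := by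
  unfold AKStructure.g
  rw [K.sq_J, form_neg_right]

/-- The data of the construction, from a unitary frame in a coordinate ball. -/
theorem nonempty_data_of_frame (K : AKStructure n M) (hn : 2 ≤ n) (k : ℕ∞) {φ : M → ℝ}
    (hφ : ContMDiff 𝓘(ℝ, Model n) 𝓘(ℝ, ℝ) ∞ φ) (hpos : Tames K.J (pot K.J K.Ω φ))
    {χ₀ : OpenPartialHomeomorph (Model n) M} (hχ₀ : IsParam n χ₀) {z₀ : Model n} {r : ℝ} (hr : 0 < r)
    (hball : Metric.ball z₀ r ⊆ χ₀.source) {w : Fin n → Model n → Model n}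
    (hw : ∀ a, ContDiffOn ℝ ∞ (w a) (Metric.ball z₀ r))
    (h1 : ∀ z ∈ Metric.ball z₀ r, ∀ a b,
      pb2 K.Ω χ₀ z (w a z) (jhat K.J χ₀ z (w b z)) = if a = b then 1 else 0)
    (h2 : ∀ z ∈ Metric.ball z₀ r, ∀ a b, pb2 K.Ω χ₀ z (w a z) (w b z) = 0)
    (L : (Fin n → ℂ) ≃L[ℝ] Model n)
    (hL1 : ∀ a, L (Pi.single a 1) = (r⁻¹ * Real.sqrt 2) • w a z₀)
    (hL2 : ∀ a, L (Pi.single a Complex.I) = (r⁻¹ * Real.sqrt 2) • jhat K.J χ₀ z₀ (w a z₀))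
    {l : Fin n → ℝ}
    (h3 : ∀ a b, p11 (pb2 (pot K.J K.Ω φ) χ₀ z₀) (jhat K.J χ₀ z₀) (w a z₀)
      (jhat K.J χ₀ z₀ (w b z₀)) = if a = b then l a else 0)
    (h4 : ∀ a b, p11 (pb2 (pot K.J K.Ω φ) χ₀ z₀) (jhat K.J χ₀ z₀) (w a z₀) (w b z₀) = 0)
    {δ : ℝ} (hδ : 0 < δ)
    (h5 : ∀ z ∈ Metric.ball z₀ r, δ ≤ ‖p20 (pb2 (pot K.J K.Ω φ) χ₀ z) (jhat K.J χ₀ z)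
      (w ⟨0, by omega⟩ z) (w ⟨1, by omega⟩ z)‖) :
    Nonempty (Data K hn k) := by
  obtain ⟨A, hAs, hAt, hA0, hA, hAsymm, hAd⟩ := exists_ball_param z₀ hr L
  have hz₀ : z₀ ∈ χ₀.source := hball (Metric.mem_ball_self hr)
  set χ := A.trans χ₀ with hχdef
  have hAm : ∀ z, A z ∈ Metric.ball z₀ r := fun z => by
    rw [← hAt]; exact A.map_source (by rw [hAs]; exact Set.mem_univ z)
  have hsrc : χ.source = Set.univ := by
    rw [hχdef, OpenPartialHomeomorph.trans_source, hAs, Set.univ_inter]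
    exact Set.eq_univ_of_forall fun z => hball (hAm z)
  have htgt : χ.target = χ₀.target ∩ χ₀.symm ⁻¹' Metric.ball z₀ r := by
    rw [hχdef, OpenPartialHomeomorph.trans_target, hAt]
  have hpt : ∀ p ∈ χ.target, ∃ z ∈ Metric.ball z₀ r, χ₀ z = p := fun p hp => by
    rw [htgt] at hp
    exact ⟨χ₀.symm p, hp.2, χ₀.right_inv hp.1⟩
  have hbs : ∀ {z}, z ∈ Metric.ball z₀ r → z ∈ χ₀.source := fun hz => hball hz
  have htau : ∀ z ∈ Metric.ball z₀ r, δ ≤ ‖tau K.J K.Ω φ (χ₀ z)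
      (pushField χ₀ (w ⟨0, by omega⟩) (χ₀ z)) (pushField χ₀ (w ⟨1, by omega⟩) (χ₀ z))‖ := by
    intro z hz
    rw [pushField_apply _ (hbs hz), pushField_apply _ (hbs hz)]
    exact (h5 z hz).trans_eq (congrArg norm (P20_tmap K.J _ hχ₀ (hbs hz) _ _).symm)
  have hmf : ∀ u, tmap n χ 0 u = tmap n χ₀ z₀ (r • L u) := fun u => by
    have hd : MDifferentiableAt 𝓘(ℝ, Model n) 𝓘(ℝ, Model n) χ₀ (A 0) := by
      rw [hA0]; exact hχ₀.mdifferentiableAt hz₀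
    have h := mfderiv_comp (0 : Fin n → ℂ) hd hAd.differentiableAt.mdifferentiableAt
    rw [mfderiv_eq_fderiv, hAd.fderiv, hA0] at h
    exact congrArg (fun T : (Fin n → ℂ) →L[ℝ] Model n => T u) h
  have hrs : r * (r⁻¹ * Real.sqrt 2) = Real.sqrt 2 := by
    rw [← mul_assoc, mul_inv_cancel₀ hr.ne', one_mul]
  have hJt : ∀ v : Model n, K.J.at (χ₀ z₀) (tmap n χ₀ z₀ v) = tmap n χ₀ z₀ (jhat K.J χ₀ z₀ v) :=
    fun v => (hχ₀.jhat_tmap K.J hz₀ v).symm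
  -- Stated for a variable point equal to z₀, since the centre of the new chart is A 0 and the
  -- tangent spaces depend on it.
  have hdiag : ∀ x, x = z₀ → ∀ a b, cext (fun X Y => (H K.J K.Ω φ (χ₀ x) X Y : ℂ))
      (eVec K (pushField χ₀ (w a) (χ₀ x))) (eBar K (pushField χ₀ (w b) (χ₀ x))) =
      if a = b then Complex.I * (l a : ℂ) else 0 := by
    rintro x rfl a b
    rw [cext_H, pushField_apply _ hz₀, pushField_apply _ hz₀]
    have e1 : H K.J K.Ω φ (χ₀ x) (tmap n χ₀ x (w a x)) (tmap n χ₀ x (w b x)) = 0 :=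
      (P11_tmap K.J _ hχ₀ hz₀ _ _).trans (h4 a b)
    have e2 : H K.J K.Ω φ (χ₀ x) (tmap n χ₀ x (w a x)) (K.J.at (χ₀ x) (tmap n χ₀ x (w b x))) =
        if a = b then l a else 0 := by
      rw [hJt]
      exact (P11_tmap K.J _ hχ₀ hz₀ _ _).trans (h3 a b)
    have e2' : H K.J K.Ω φ (χ₀ x) (tmap n χ₀ x (w a x)) (K.J (χ₀ x) (tmap n χ₀ x (w b x))) =
        if a = b then l a else 0 := e2
    rw [e1, e2']
    split_ifs <;> simp
  have hcoord : ∀ x, x = z₀ → ∀ a, fieldAt (pushField χ₀ (w a)) (χ₀ x) = tmap n χ₀ z₀ (w a z₀) := by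
    rintro x rfl a
    exact pushField_apply _ hz₀
  have hcoordJ : ∀ x, x = z₀ → ∀ a, K.J.at (χ₀ x) (fieldAt (pushField χ₀ (w a)) (χ₀ x)) =
      tmap n χ₀ z₀ (jhat K.J χ₀ z₀ (w a z₀)) := by
    rintro x rfl a
    rw [hcoord x rfl, hJt]
  refine ⟨{
    φ := φ
    smooth_φ := hφ
    hpos := (hPos_iff_tames K.sq_J K.Ω φ).2 hpos
    χ := χ
    smooth_χ := ?_
    smooth_χ_symm := ?_
    polydisk_subset := by rw [hsrc]; exact Set.subset_univ _
    tau_ne := ?_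
    ε := fun a => pushField χ₀ (w a)
    smooth_ε := fun a => by
      rw [htgt]
      exact isSmoothField_pushField hχ₀ hball (hw a)
    orthonormal := ?_
    coord_re := ?_
    coord_im := ?_
    lam := l
    diag := hdiag (A 0) hA0
    tau_12 := ⟨2 * δ, by positivity, fun z _ => ?_⟩
    -- The argument 2 - 2r is at least 1 for r ≤ 1/2 and at most 0 for r ≥ 1.
    η := fun r => Real.smoothTransition (2 - 2 * r)
    contDiff_η := Real.smoothTransition.contDiff.comp
      (contDiff_const.sub (contDiff_const.mul contDiff_id))
    η_one := fun r hr => Real.smoothTransition.one_of_one_le (by linarith)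
    η_zero := fun r hr => Real.smoothTransition.zero_of_nonpos (by linarith) }⟩
  · exact hχ₀.smooth.comp hA.contMDiff.contMDiffOn fun z _ => hball (hAm z)
  · rw [htgt]
    exact hAsymm.contMDiffOn.comp (hχ₀.smooth_symm.mono Set.inter_subset_left) fun q hq => hq.2
  · intro p hp
    obtain ⟨z, hz, rfl⟩ := hpt p hp
    exact ⟨_, _, norm_pos_iff.1 (hδ.trans_le (htau z hz))⟩
  · intro p hp a b
    obtain ⟨z, hz, rfl⟩ := hpt p hp
    rw [pushField_apply _ (hbs hz), pushField_apply _ (hbs hz)]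
    refine ⟨(g_tmap K hχ₀ (hbs hz) _ _).trans (h1 z hz a b), ?_⟩
    exact (g_J K (χ₀ z) _ _).trans (neg_eq_zero.2 (h2 z hz a b))
  · intro a
    have h := hmf (Pi.single a 1)
    rw [hL1, smul_smul, hrs, map_smul] at h
    exact h.trans (congrArg (fun v : Model n => Real.sqrt 2 • v) (hcoord (A 0) hA0 a).symm)
  · intro a
    have h := hmf (Pi.single a Complex.I)
    rw [hL2, smul_smul, hrs, map_smul] at h
    exact h.trans (congrArg (fun v : Model n => Real.sqrt 2 • v) (hcoordJ (A 0) hA0 a).symm)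
  · rw [cext_tau, norm_mul, Complex.norm_ofNat]
    exact mul_le_mul_of_nonneg_left (htau (A z) (hAm z)) (by norm_num)

-- A function with τ ≠ 0 at p gives a diagonalizing unitary frame there with τ₁₂ ≠ 0; it extends
-- smoothly, and on a small ball |τ₁₂| stays above half its central value. That ball, parametrized
-- by all of ℂⁿ, contains the image of the polydisk whatever its size.
set_option maxHeartbeats 1000000 in
theorem nonempty_data [CompactSpace M] [T2Space M] (K : AKStructure n M) (hK : ¬ K.IsIntegrable)
    (hn : 2 ≤ n) (k : ℕ∞) : Nonempty (Data K hn k) := by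
  obtain ⟨φ, hφ, hφt, p, X, Y, hτ⟩ := exists_tau_ne_zero K hK
  have hφ2 := hφ.of_le two_le_infty
  set χ := (chartAt (Model n) p).symm with hχdef
  set z₀ := chartAt (Model n) p p with hz₀def
  have hχ : IsParam n χ := isParam_chartAt_symm (n := n) p
  have hz₀ : z₀ ∈ χ.source := mem_chart_target _ p
  have hpz : χ z₀ = p := (chartAt (Model n) p).left_inv (mem_chart_source _ p)
  set j := jhat K.J χ with hjdef
  set b := bhat K.Ω χ with hbdef
  set g : Model n → Model n →L[ℝ] Model n →L[ℝ] ℝ := fun z => ((b z).flip.comp (j z)).flip with hg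
  have hb : ∀ z u v, b z u v = pb2 K.Ω χ z u v := bhat_apply K.Ω χ
  have hgb : ∀ z, (g z).toLinearMap₁₂ = ((b z).toLinearMap₁₂).compl₂ (j z).toLinearMap := fun z => rfl
  have hjj : ∀ z ∈ χ.source, ∀ v, j z (j z v) = -v := fun z hz => jhat_jhat K hχ hz
  have hjs : ContDiffOn ℝ ∞ j χ.source := contDiffOn_jhat K.smooth_J hχ
  have hgs : ContDiffOn ℝ ∞ g χ.source := (contDiff_flip (Model n) (Model n)).comp_contDiffOn
    (((contDiff_flip (Model n) (Model n)).comp_contDiffOn (contDiffOn_bhat K.smooth_Ω hχ)).clm_comp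
      hjs)
  have hgH : ∀ z ∈ χ.source, IsHermitianForm (j z).toLinearMap (g z).toLinearMap₁₂ := fun z hz => by
    rw [hgb]
    refine isHermitianForm_compl₂ (hjj z hz) (fun u => ?_) fun u v => ?_
    · exact (hb z u u).trans (pb2_self _ _ _ _)
    · exact (hb z _ _).trans ((pb2_invariant K hχ hz u v).trans (hb z u v).symm)
  set a := ahat K.J K.Ω φ χ with hadef
  have ha : ∀ z ∈ χ.source, ∀ u v, a z u v = pb2 (pot K.J K.Ω φ) χ z u v := fun z hz u v =>
    (pb2_pot K.smooth_J K.Ω hχ hφ2 hz u v).symm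
  have hp20 : ∀ z ∈ χ.source, ∀ u v, p20L (a z).toLinearMap₁₂ (j z).toLinearMap u v =
      p20 (pb2 (pot K.J K.Ω φ) χ z) (j z) u v := fun z hz u v => by
    rw [← funext₂ (ha z hz)]
    rfl
  have hp11 : ∀ z ∈ χ.source, ∀ u v, p11L (a z).toLinearMap₁₂ (j z).toLinearMap u v =
      p11 (pb2 (pot K.J K.Ω φ) χ z) (j z) u v := fun z hz u v => by
    rw [← funext₂ (ha z hz)]
    rfl
  have hne : ∃ u v, p20L (a z₀).toLinearMap₁₂ (j z₀).toLinearMap u v ≠ 0 := by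
    have hgen : ∀ q, q = p → ∃ X Y : Tan n q, tau K.J K.Ω φ q X Y ≠ 0 := by
      rintro q rfl
      exact ⟨X, Y, hτ⟩
    obtain ⟨X', Y', h'⟩ := hgen _ hpz
    refine ⟨tinv n χ z₀ X', tinv n χ z₀ Y', fun h0 => h' ?_⟩
    rw [hp20 z₀ hz₀] at h0
    have h1 := (P20_tmap K.J (pot K.J K.Ω φ) hχ hz₀ _ _).trans h0
    have ht : ∀ W : Tan n (χ z₀), tmap n χ z₀ (tinv n χ z₀ W) = W := hχ.tmap_tinv hz₀
    exact (congrArg₂ (fun A B : Tan n (χ z₀) => P20 K.J (pot K.J K.Ω φ) (χ z₀) A B)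
      (ht X') (ht Y')).symm.trans h1
  obtain ⟨c, l, c1, c2, c3, c4, c5⟩ := exists_frame_at hn finrank_model
    (j := (j z₀).toLinearMap) (hjj z₀ hz₀) (A := (b z₀).toLinearMap₁₂) (B := (a z₀).toLinearMap₁₂)
    (fun u => (hb z₀ u u).trans (pb2_self _ _ _ _))
    (fun u => (ha z₀ hz₀ u u).trans (pb2_self _ _ _ _))
    (fun u v => (hb z₀ _ _).trans ((pb2_invariant K hχ hz₀ u v).trans (hb z₀ u v).symm))
    (fun v hv => (pb2_pos K.tames hχ hz₀ hv).trans_eq (hb z₀ _ _).symm) hne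
  have c2' : ∀ i i', (g z₀).toLinearMap₁₂ (c i) ((j z₀).toLinearMap (c i')) = 0 := fun i i' => by
    rw [hgb, LinearMap.compl₂_apply]
    have e : (j z₀).toLinearMap ((j z₀).toLinearMap (c i')) = - c i' := hjj z₀ hz₀ _
    rw [e, map_neg, c2, neg_zero]
  obtain ⟨O, ε, hO, hzO, hOs, hε, hun⟩ := exists_smooth_unitary χ.open_source hz₀ hgs hjs hjj hgH
    -- The frame is extended by zero to indices in ℕ; only indices below n are used.
    (c := fun i => if h : i < n then c ⟨i, h⟩ else 0) n
    ⟨fun i hi i' hi' => by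
      simp only [hi, hi', dif_pos]
      exact (c1 _ _).trans (by simp [Fin.ext_iff]),
     fun i hi i' hi' => by
      simp only [hi, hi', dif_pos]
      exact c2' _ _⟩
  have hεz : ∀ i : Fin n, ε i z₀ = c i := fun i => by
    rw [(hε i i.2).2, dif_pos i.2]
  set T : Model n → ℂ := fun z => p20L (a z).toLinearMap₁₂ (j z).toLinearMap (ε 0 z) (ε 1 z) with hT
  have hTc : ContinuousOn T O := by
    have haO : ContinuousOn a O := (continuousOn_ahat K.smooth_J K.smooth_Ω hχ hφ2).mono hOs
    have hjO : ContinuousOn j O := hjs.continuousOn.mono hOs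
    have e0 : ContinuousOn (ε 0) O := (hε 0 (by omega)).1.continuousOn
    have e1 : ContinuousOn (ε 1) O := (hε 1 (by omega)).1.continuousOn
    have key : ∀ {f h : Model n → Model n}, ContinuousOn f O → ContinuousOn h O →
        ContinuousOn (fun z => a z (f z) (h z)) O := fun hf hh => (haO.clm_apply hf).clm_apply hh
    have j0 := hjO.clm_apply e0
    have j1 := hjO.clm_apply e1
    exact ((Complex.continuous_ofReal.comp_continuousOn ((key e0 e1).sub (key j0 j1))).sub
      (continuousOn_const.mul (Complex.continuous_ofReal.comp_continuousOn
        ((key j0 e1).add (key e0 j1))))).div_const 4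
  have hT0 : 0 < ‖T z₀‖ := norm_pos_iff.2 (by
    have e0 := hεz ⟨0, by omega⟩
    have e1 := hεz ⟨1, by omega⟩
    simp only at e0 e1
    rw [hT]
    simp only [e0, e1]
    exact c5)
  obtain ⟨r, hr, hrb⟩ := Metric.isOpen_iff.1
    (hTc.norm.isOpen_inter_preimage hO (isOpen_Ioi (a := ‖T z₀‖ / 2))) z₀
    ⟨hzO, half_lt_self hT0⟩
  -- The parametrization of the ball multiplies L by r at the centre, so L carries r⁻¹ to leave the
  -- derivative √2 ε_a.
  have hs : r⁻¹ * Real.sqrt 2 ≠ 0 := by positivity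
  obtain ⟨L, hL1, hL2⟩ := exists_linear_equiv finrank_model (hgH z₀ hz₀) c1 c2' hs
  have hrO : Metric.ball z₀ r ⊆ O := fun z hz => (hrb hz).1
  refine nonempty_data_of_frame K hn k hφ hφt hχ hr (hrO.trans hOs) (w := fun i => ε i)
    (fun i => (hε i i.2).1.mono hrO) (fun z hz i i' => ?_) (fun z hz i i' => ?_) L
    (fun i => by rw [hL1, hεz]) (fun i => by rw [hL2, hεz]; rfl) (l := l)
    (fun i i' => by rw [hεz, hεz, ← hp11 z₀ hz₀]; exact c3 i i')
    (fun i i' => by rw [hεz, hεz, ← hp11 z₀ hz₀]; exact c4 i i') (half_pos hT0) fun z hz => ?_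
  · refine (hb z _ _).symm.trans (((hun z (hrO hz)).orth i i.2 i' i'.2).trans ?_)
    simp [Fin.ext_iff]
  · have h := (hun z (hrO hz)).orth_J i i.2 i' i'.2
    rw [hgb, LinearMap.compl₂_apply] at h
    have e : (j z).toLinearMap ((j z).toLinearMap (ε i' z)) = - ε i' z := hjj z (hOs (hrO hz)) _
    rw [e, map_neg, neg_eq_zero] at h
    exact (hb z _ _).symm.trans h
  · rw [← hp20 z (hOs (hrO hz))]
    exact (hrb hz).2.le

end Existence

end AlmostKahler

theorem lemma3p6 {n : ℕ} (hn : 2 ≤ n) {M : Type*} [TopologicalSpace M]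
    [ChartedSpace (AlmostKahler.Model n) M] [IsManifold 𝓘(ℝ, AlmostKahler.Model n) ∞ M]
    [CompactSpace M] [T2Space M]
    (K : AlmostKahler.AKStructure n M) (hJ : ¬ K.IsIntegrable) (k : ℕ∞) (hk : 2 ≤ k) :
    Nonempty (AlmostKahler.Data K hn k) ∧
    ∀ (D : AlmostKahler.Data K hn k) (R₁ : ℝ), 2 < R₁ → ∃ R₀ : ℝ, R₁ ≤ R₀ ∧
      0 < D.amp R₀ ∧ D.amp R₀ ≤ 1 ∧
      (∃ f ∈ frontier (AlmostKahler.APlus K k), ∃ c : ℝ, ∀ p : M, f.1 p = D.phiR R₀ p + c) ∧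
      (∀ p ∈ D.χ '' AlmostKahler.polydisk n (1 / R₀),
        0 < AlmostKahler.Fj K.J K.Ω 1 (D.phiR R₀) p) ∧
      ∀ p : M, 0 < AlmostKahler.F K.J K.Ω (D.phiR R₀) p := by
  exact ⟨AlmostKahler.nonempty_data K hJ hn k, fun D R₁ hR₁ => D.exists_radius hk R₁ hR₁⟩
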